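/- Let $k=\mathbb{Q}(\beta)$ and let $k[[x]]=k[[x_1,x_2,\dots]]$ carry the topology of coefficientwise convergence ($k$ discrete). A series is called symmetric if it is invariant under permutations of the variables; $p_n(x)=\sum_i x_i^n$. *Fermions.* Let $\mathcal F$ be the Fock space over $k$ of the neutral fermions $\phi_n$ ($n\in\mathbb{Z}$), where $\phi_m\phi_n+\phi_n\phi_m=2(-1)^m\delta_{m+n,0}$, with vacuum vectors satisfying $\phi_{-n}|0\rangle=0=\langle 0|\phi_n$ for $n>0$, $\langle 0|0\rangle=1$, $\langle0|\phi_0|0\rangle=0$. For a strict partition $\lambda=(\lambda_1>\dots>\lambda_r>0)$ put $|\lambda\rangle=\phi_{\lambda_1}\cdots\phi_{\lambda_r}|0\rangle$ if $r$ is even and $|\lambda\rangle=\phi_{\lambda_1}\cdots\phi_{\lambda_r}\phi_0|0\rangle$ if $r$ is odd. For odd $m$ let $b_m=\frac14\sum_{i\in\mathbb{Z}}(-1)^i\phi_{-i-m}\phi_i$; for $n\ge1$ let $b^{(\beta)}_n$ be obtained from the odd polynomial $\frac12\big((X-\frac\beta2)^n-(-X-\frac\beta2)^n\big)$ by $X^j\mapsto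 b_j$; and let $\mathcal H^{(\beta)}=2\sum_{n\ge1}\frac{p_n}{n}b^{(\beta)}_n$ with indeterminates $p_1,p_2,\dots$. Then $\langle0|e^{\mathcal H^{(\beta)}}|\lambda\rangle\in k[[p_1,p_2,\dots]]$, and it is regarded as an element of $k[[x]]$ through $p_n\mapsto p_n(x)$. *Symmetric functions.* Let $\sum_n q_n(x)z^n=\prod_i\frac{1+x_iz}{1-x_iz}$, $\Gamma=k[q_1,q_2,\dots]$, and let $Q_\lambda(x)$ be Schur's $Q$-function of the strict partition $\lambda$. Let $\widehat\Gamma\subset k[[x]]$ be the $k$-subspace generated by the symmetric series $f$ for which $f(t,-t,x_3,x_4,\dots)$ does not depend on $t$, and let $G\Gamma\subset k[[x]]$ be the $k$-subalgebra generated by the symmetric series $f$ for which $f(t,\frac{-t}{1+\beta t},x_3,x_4,\dots)$ does not depend on $t$. **Proposition.** 1. For every strict partition $\lambda$, $$Q_\lambda\Big(\frac{x}{1+\frac\beta2x}\Big)=\langle0|e^{\mathcal H^{(\beta)}}|\lambda\rangle ,$$ where the left side is obtained from $Q_\lambda(x)$ by the substitution $x_i\mapsto \frac{x_i}{1+\frac\beta2x_i}$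 for all $i$. 2. The family $\{\langle0|e^{\mathcal H^{(\beta)}}|\lambda\rangle : \lambda \text{ strict}\}$ is linearly independent over $k$, it is contained in $G\Gamma$, and its $k$-span is dense in $G\Gamma$. 3. $\widehat\Gamma$ is the closure of $\Gamma$ in $k[[x]]$; it is a $k$-subalgebra, and the substitution $x_i\mapsto\frac{x_i}{1+\frac\beta2x_i}$ restricts to an isomorphism of $k$-algebras $\widehat\Gamma\to G\Gamma$ that is a homeomorphism. -/

import Mathlib

open scoped MvPowerSeries.WithPiTopology symmDiff

namespace NeutralFermion

/-- The ground field `ℚ(β)`, with the discrete topology. -/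
abbrev K : Type := RatFunc ℚ

/-- The parameter `β`. -/
noncomputable abbrev β : K := RatFunc.X

instance instTopologicalSpaceK : TopologicalSpace K := ⊥

instance instDiscreteTopologyK : DiscreteTopology K := ⟨rfl⟩

/-! ## Neutral fermions -/

/-- The Fock space: the vector space with basis `|S⟩ = φ_{n₁} φ_{n₂} ⋯ φ_{nᵣ} |0⟩`, one for each
finite set `S = {n₁ > n₂ > ⋯ > nᵣ ≥ 0}`. -/
abbrev Fock : Type := Finset ℕ →₀ K

/-- The vacuum `|0⟩`. -/
noncomputable def vacuum : Fock := Finsupp.single ∅ 1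

/-- The linear functional `|v⟩ ↦ ⟨0|v⟩`: the coefficient of the vacuum. -/
noncomputable def vacuumExp : Fock →ₗ[K] K := Finsupp.lapply ∅

/-- The sign obtained by moving `φ_n`, `|n| = a`, past all `φ_s` with `s ∈ S`, `s > a`. -/
noncomputable def fermionSign (a : ℕ) (S : Finset ℕ) : K := (-1) ^ (S.filter (a < ·)).card

/-- The scalar by which `φ_n` acts, up to the sign above. If `|n| ∉ S`, then `φ_n` adds `n` to `S`
when `n ≥ 0`, and kills `|S⟩` when `n < 0`. If `|n| ∈ S`, then `φ_n` removes `|n|` from `S` when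
`n ≤ 0`, with factor `φ_0² = 1` or `[φ_n, φ_{-n}]₊ = 2 (-1)^n`, and kills `|S⟩` when `n > 0`. -/
noncomputable def fermionCoeff (n : ℤ) (S : Finset ℕ) : K :=
  if n.natAbs ∈ S then (if n < 0 then 2 * (-1) ^ n.natAbs else if n = 0 then 1 else 0)
  else (if 0 ≤ n then 1 else 0)

/-- The neutral fermion `φ_n` (`n ∈ ℤ`) as an operator on the Fock space. The symmetric difference
`S ∆ {|n|}` is `S ∪ {|n|}` if `|n| ∉ S` and `S \ {|n|}` if `|n| ∈ S`. -/
noncomputable def phi (n : ℤ) : Module.End K Fock :=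
  Finsupp.linearCombination K fun S : Finset ℕ =>
    Finsupp.single (S ∆ {n.natAbs}) (fermionSign n.natAbs S * fermionCoeff n S)

/-- The Heisenberg generator `b_m = (1/4) ∑_{i ∈ ℤ} (-1)^i φ_{-i-m} φ_i`, for `m` odd. Applied to
a basis vector, all but finitely many terms vanish. -/
noncomputable def heis (m : ℤ) : Module.End K Fock :=
  Finsupp.linearCombination K fun S : Finset ℕ =>
    (4⁻¹ : K) • ∑ᶠ i : ℤ, ((-1 : K) ^ i) • phi (-i - m) (phi i (Finsupp.single S 1))

open Polynomial in
/-- The odd polynomial `((X - β/2)^m - (-X - β/2)^m) / 2`. -/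
noncomputable def betaPoly (m : ℕ) : K[X] :=
  C (2⁻¹ : K) * ((X - C (β / 2)) ^ m - (-X - C (β / 2)) ^ m)

/-- The `β`-deformed Heisenberg generator `b^{(β)}_m`, `m ≥ 0`: substitute `X^j ↦ b_j` in
`((X - β/2)^m - (-X - β/2)^m) / 2`. -/
noncomputable def heisBeta (m : ℕ) : Module.End K Fock :=
  (betaPoly m).sum fun j c => c • heis (j : ℤ)

/-- The space `F[[p₁, p₂, …]]` of series in the indeterminates `p_n` (`n ≥ 1`) with coefficients
in the Fock space, as the family of coefficients. -/
abbrev FockSeries : Type := (ℕ+ →₀ ℕ) → Fock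

/-- The operator `H^{(β)} = 2 ∑_{n ≥ 1} (p_n / n) b^{(β)}_n` on `F[[p]]`. -/
noncomputable def hamBeta (w : FockSeries) : FockSeries := fun d =>
  ∑ n ∈ d.support, (2 / (n : K)) • heisBeta n (w (d - Finsupp.single n 1))

/-- A vector of the Fock space as a constant series. -/
noncomputable def constSeries (v : Fock) : FockSeries := fun d => if d = 0 then v else 0

/-- `e^{H^{(β)}} |v⟩ = ∑_N (H^{(β)})^N |v⟩ / N!`. Since `(H^{(β)})^N |v⟩` is homogeneous of degree
`N` in the `p_n`, only `N = deg d` contributes to the coefficient of `p^d`. -/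
noncomputable def expHamBeta (v : Fock) : FockSeries := fun d =>
  ∑ N ∈ Finset.range (d.degree + 1), ((N.factorial : K)⁻¹) • (hamBeta^[N] (constSeries v)) d

/-- Strict partitions `λ₁ > λ₂ > ⋯ > λᵣ > 0`. -/
def StrictPartition : Type :=
  {l : List ℕ // l.Pairwise (· > ·) ∧ ∀ a ∈ l, 0 < a}

/-- `(λ₁, …, λᵣ)` for even `r`, and `(λ₁, …, λᵣ, 0)` for odd `r`. -/
def StrictPartition.padded (l : StrictPartition) : List ℕ :=
  if Even l.1.length then l.1 else l.1 ++ [0]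

/-- `|λ⟩ = φ_{λ₁} ⋯ φ_{λᵣ} |0⟩` for even `r`, and `φ_{λ₁} ⋯ φ_{λᵣ} φ_0 |0⟩` for odd `r`. -/
noncomputable def ket (l : StrictPartition) : Fock :=
  l.padded.foldr (fun n v => phi (n : ℤ) v) vacuum

/-- `⟨0| e^{H^{(β)}} |λ⟩` as a formal power series in `p₁, p₂, …`. -/
noncomputable def vevSeries (l : StrictPartition) : MvPowerSeries ℕ+ K := fun d =>
  vacuumExp (expHamBeta (ket l) d)

/-! ## Symmetric power series in `x₁, x₂, …`

The variable `x_{i+1}` is `MvPowerSeries.X i`. -/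

/-- Formal power series in `x₁, x₂, …` over `ℚ(β)`; they carry the topology of coefficientwise
convergence. -/
abbrev XSeries : Type := MvPowerSeries ℕ K

/-- Invariance under all permutations of the variables. -/
def IsSymm (f : XSeries) : Prop :=
  ∀ (σ : Equiv.Perm ℕ) (d : ℕ →₀ ℕ),
    MvPowerSeries.coeff (d.mapDomain σ) f = MvPowerSeries.coeff d f

open Classical in
/-- The power sum `p_n(x) = x₁^n + x₂^n + ⋯`, `n ≥ 1`. -/
noncomputable def powerSum (n : ℕ+) : XSeries := fun d =>
  if ∃ i, d = Finsupp.single i (n : ℕ) then 1 else 0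

/-- `⟨0| e^{H^{(β)}} |λ⟩` under the identification `p_n ↦ p_n(x)`. -/
noncomputable def vev (l : StrictPartition) : XSeries :=
  MvPowerSeries.subst powerSum (vevSeries l)

/-- The substitution `x_i ↦ x_i / (1 + (β/2) x_i)` for all `i`. -/
noncomputable def substBeta (f : XSeries) : XSeries :=
  MvPowerSeries.subst
    (fun i : ℕ => (MvPowerSeries.X i * (1 + MvPowerSeries.C (β / 2) * MvPowerSeries.X i)⁻¹ :
      XSeries)) f

/-- `f(t, s, x₃, x₄, …)`, where the series `s` may involve `t`, which is written as the first
variable. -/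
noncomputable def substTwo (s : XSeries) (f : XSeries) : XSeries :=
  MvPowerSeries.subst
    (fun i : ℕ => if i = 0 then (MvPowerSeries.X 0 : XSeries)
      else if i = 1 then s else MvPowerSeries.X i) f

/-- The series does not depend on the first variable. -/
def IndepFirst (f : XSeries) : Prop :=
  ∀ d : ℕ →₀ ℕ, d 0 ≠ 0 → MvPowerSeries.coeff d f = 0

/-- The `Q`-cancellation property: `f(t, -t, x₃, x₄, …)` does not depend on `t`. -/
def QCancel (f : XSeries) : Prop := IndepFirst (substTwo (-MvPowerSeries.X 0) f)

/-- The `K`-theoretic `Q`-cancellation property: `f(t, -t / (1 + β t), x₃, x₄, …)` does not depend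
on `t`. -/
def KQCancel (f : XSeries) : Prop :=
  IndepFirst (substTwo
    (-MvPowerSeries.X 0 * (1 + MvPowerSeries.C β * MvPowerSeries.X 0)⁻¹) f)

/-- The algebra `GΓ` generated by the symmetric series with the `K`-theoretic `Q`-cancellation
property. -/
noncomputable def GGamma : Subalgebra K XSeries :=
  Algebra.adjoin K {f | IsSymm f ∧ KQCancel f}

/-- The space `Γ̂` generated by the symmetric series with the `Q`-cancellation property. -/
noncomputable def GammaHat : Submodule K XSeries :=
  Submodule.span K {f | IsSymm f ∧ QCancel f}

/-- `q_n(x)`, the coefficient of `z^n` in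
`∏ᵢ (1 + xᵢ z) / (1 - xᵢ z) = ∏ᵢ (1 + 2 xᵢ z + 2 xᵢ² z² + ⋯)`: the coefficient of a monomial of
degree `n` in which exactly `j` variables occur is `2^j`. -/
noncomputable def schurq (n : ℕ) : XSeries := fun d =>
  if d.degree = n then 2 ^ d.support.card else 0

/-- The algebra `Γ = ℚ(β)[q₁, q₂, …]` of Schur's `Q`-functions. -/
noncomputable def Gamma : Subalgebra K XSeries := Algebra.adjoin K (Set.range schurq)

/-- `Q_{(m, n)} = q_m q_n + 2 ∑_{i=1}^n (-1)^i q_{m+i} q_{n-i}`, for `m > n ≥ 0`. -/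
noncomputable def schurQTwo (m n : ℕ) : XSeries :=
  schurq m * schurq n +
    2 * ∑ i ∈ Finset.Icc 1 n, (-1) ^ i * (schurq (m + i) * schurq (n - i))

/-- The Pfaffian of the array `a (l_i) (l_j)`, `i < j`, by expansion along the first row:
`Pf = ∑_{j=2}^{r} (-1)^j a_{1j} Pf_{1̂ĵ}`; the Pfaffian of the empty array is `1`. (Below, the index
`j` counts from `0` in the tail of the list.) -/
noncomputable def pfaffian (a : ℕ → ℕ → XSeries) : List ℕ → XSeries
  | [] => 1
  | m :: l => ∑ j : Fin l.length, (-1) ^ (j : ℕ) * (a m l[j] * pfaffian a (l.eraseIdx j))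
termination_by l => l.length
decreasing_by
  have := List.length_eraseIdx_of_lt j.2
  simp only [List.length_cons]
  omega

/-- Schur's `Q`-function `Q_λ(x)`, by Schur's definition: the Pfaffian of `Q_{(λᵢ, λⱼ)}`,
where `λ` is extended by a zero if its length is odd. -/
noncomputable def schurQ (l : StrictPartition) : XSeries := pfaffian schurQTwo l.padded

/-! ## The definitions above are meaningful: the relations of the neutral fermions, finiteness of the
sums in `b_m`, and convergence of the substitutions. -/

theorem phi_single (n : ℤ) (S : Finset ℕ) (c : K) :
    phi n (Finsupp.single S c) =
      Finsupp.single (S ∆ {n.natAbs}) (c * (fermionSign n.natAbs S * fermionCoeff n S)) := by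
  rw [phi, Finsupp.linearCombination_single, Finsupp.smul_single, smul_eq_mul]

theorem phi_vacuum_neg (n : ℤ) (hn : n < 0) : phi n vacuum = 0 := by
  simp [vacuum, phi_single, fermionCoeff, not_le.mpr hn]

theorem vacuumExp_phi_pos (n : ℤ) (hn : 0 < n) (v : Fock) : vacuumExp (phi n v) = 0 := by
  induction v using Finsupp.induction_linear with
  | zero => simp
  | add f g hf hg => simp [hf, hg]
  | single S c =>
    rw [phi_single, vacuumExp, Finsupp.lapply_apply, Finsupp.single_apply]
    split_ifs with h
    · have h2 : S = {n.natAbs} := by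
        rwa [← Finset.bot_eq_empty, symmDiff_eq_bot] at h
      have h3 : ¬ n < 0 := not_lt.mpr hn.le
      have h4 : n ≠ 0 := hn.ne'
      simp [fermionCoeff, h2, h3, h4]
    · rfl

theorem mem_symmDiff_singleton_of_ne {a b : ℕ} (h : a ≠ b) (S : Finset ℕ) :
    b ∈ S ∆ {a} ↔ b ∈ S := by
  simp [Finset.mem_symmDiff, h.symm]

theorem mem_symmDiff_singleton_self (a : ℕ) (S : Finset ℕ) : a ∈ S ∆ {a} ↔ a ∉ S := by
  simp [Finset.mem_symmDiff]

theorem fermionSign_symmDiff_of_le {a b : ℕ} (h : a ≤ b) (S : Finset ℕ) :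
    fermionSign b (S ∆ {a}) = fermionSign b S := by
  unfold fermionSign
  congr 2
  ext s
  simp only [Finset.mem_filter, Finset.mem_symmDiff, Finset.mem_singleton]
  constructor <;> rintro ⟨h1, h2⟩ <;> refine ⟨?_, h2⟩ <;> have : s ≠ a := by omega
  · tauto
  · tauto

theorem fermionSign_symmDiff_of_lt {a b : ℕ} (h : b < a) (S : Finset ℕ) :
    fermionSign b (S ∆ {a}) = - fermionSign b S := by
  unfold fermionSign
  by_cases ha : a ∈ S
  · have h1 : (S ∆ {a}).filter (b < ·) = (S.filter (b < ·)).erase a := by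
      ext s
      simp only [Finset.mem_filter, Finset.mem_symmDiff, Finset.mem_singleton, Finset.mem_erase]
      by_cases hs : s = a
      · subst hs; simp [ha]
      · simp [hs]
    have h2 : (S.filter (b < ·)).card = ((S.filter (b < ·)).erase a).card + 1 := by
      rw [Finset.card_erase_add_one]; simp [ha, h]
    rw [h1, h2, pow_succ]; ring
  · have h1 : (S ∆ {a}).filter (b < ·) = insert a (S.filter (b < ·)) := by
      ext s
      simp only [Finset.mem_filter, Finset.mem_symmDiff, Finset.mem_singleton, Finset.mem_insert]
      by_cases hs : s = a
      · subst hs; simp [ha, h]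
      · simp [hs]
    rw [h1, Finset.card_insert_of_notMem (by simp [ha]), pow_succ]; ring

theorem fermionCoeff_symmDiff {m n : ℤ} (h : m.natAbs ≠ n.natAbs) (S : Finset ℕ) :
    fermionCoeff n (S ∆ {m.natAbs}) = fermionCoeff n S := by
  simp only [fermionCoeff, mem_symmDiff_singleton_of_ne h]

theorem fermionSign_mul_self (a : ℕ) (S : Finset ℕ) :
    fermionSign a S * fermionSign a S = 1 := by
  simp [fermionSign, ← mul_pow]

/-- The defining relation `[φ_m, φ_n]₊ = 2 (-1)^m δ_{m+n,0}`. -/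
theorem phi_anticomm (m n : ℤ) :
    phi m * phi n + phi n * phi m = if m + n = 0 then (2 * (-1) ^ m : K) • 1 else 0 := by
  refine Finsupp.lhom_ext fun S c => ?_
  simp only [LinearMap.add_apply, Module.End.mul_apply, phi_single]
  by_cases h : m.natAbs = n.natAbs
  · have hS : S ∆ {n.natAbs} ∆ {n.natAbs} = S := by
      rw [symmDiff_assoc, symmDiff_self, symmDiff_bot]
    have hz : ((-1 : K)) ^ m = (-1) ^ n.natAbs := by
      rw [← h]
      rcases Int.natAbs_eq m with h' | h'
      · conv_lhs => rw [h', zpow_natCast]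
      · conv_lhs => rw [h', zpow_neg, zpow_natCast, ← inv_pow]
        norm_num
    rw [h, hS, hz, fermionSign_symmDiff_of_le le_rfl, ← Finsupp.single_add]
    have hs := fermionSign_mul_self n.natAbs S
    have key : fermionCoeff n S * fermionCoeff m (S ∆ {n.natAbs}) +
        fermionCoeff m S * fermionCoeff n (S ∆ {n.natAbs}) =
        if m + n = 0 then 2 * (-1) ^ n.natAbs else 0 := by
      unfold fermionCoeff
      rw [h]
      simp only [mem_symmDiff_singleton_self]
      rcases Int.natAbs_eq_natAbs_iff.mp h with rfl | rfl
      · rcases lt_trichotomy m 0 with h0 | h0 | h0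
        · have : ¬ (0 ≤ m) := by omega
          have : ¬ (m + m = 0) := by omega
          by_cases hm : m.natAbs ∈ S <;> simp [*]
        · subst h0
          by_cases hm : 0 ∈ S <;> simp [hm] <;> norm_num
        · have : ¬ (m < 0) := by omega
          have : ¬ (m = 0) := by omega
          have : ¬ (m + m = 0) := by omega
          by_cases hm : m.natAbs ∈ S <;> simp [*]
      · rcases lt_trichotomy n 0 with h0 | h0 | h0
        · have : ¬ (0 ≤ n) := by omega
          have : ¬ (n = 0) := by omega
          have : ¬ (0 < n) := by omega
          have : n ≤ 0 := by omega
          by_cases hm : n.natAbs ∈ S <;> simp [*]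
        · subst h0
          by_cases hm : 0 ∈ S <;> simp [hm] <;> norm_num
        · have : ¬ (n < 0) := by omega
          have : ¬ (n = 0) := by omega
          have : ¬ (n ≤ 0) := by omega
          have : 0 ≤ n := by omega
          by_cases hm : n.natAbs ∈ S <;> simp [*]
    have e : c * (fermionSign n.natAbs S * fermionCoeff n S) *
          (fermionSign n.natAbs S * fermionCoeff m (S ∆ {n.natAbs})) +
        c * (fermionSign n.natAbs S * fermionCoeff m S) *
          (fermionSign n.natAbs S * fermionCoeff n (S ∆ {n.natAbs})) =
        c * if m + n = 0 then 2 * (-1) ^ n.natAbs else 0 := by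
      rw [← key]
      linear_combination (c * (fermionCoeff n S * fermionCoeff m (S ∆ {n.natAbs}) +
        fermionCoeff m S * fermionCoeff n (S ∆ {n.natAbs}))) * hs
    rw [e]
    split_ifs
    · simp [mul_comm]
    · simp
  · have hmn : ¬ (m + n = 0) := by omega
    rw [if_neg hmn, symmDiff_right_comm S, ← Finsupp.single_add, fermionCoeff_symmDiff h,
      fermionCoeff_symmDiff (Ne.symm h), LinearMap.zero_apply, Finsupp.single_eq_zero]
    rcases lt_or_gt_of_ne h with h' | h'
    · rw [fermionSign_symmDiff_of_lt h', fermionSign_symmDiff_of_le h'.le]; ring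
    · rw [fermionSign_symmDiff_of_lt h', fermionSign_symmDiff_of_le h'.le]; ring

theorem heis_finite (m : ℤ) (hm : m ≠ 0) (S : Finset ℕ) :
    (Function.support fun i : ℤ =>
      ((-1 : K) ^ i) • phi (-i - m) (phi i (Finsupp.single S 1))).Finite := by
  have hb : ∃ B : ℕ, ∀ s ∈ S, s ≤ B := ⟨S.sup id, fun s hs => Finset.le_sup (f := id) hs⟩
  obtain ⟨B, hB⟩ := hb
  refine (Set.finite_Icc (-(B : ℤ) - |m|) (B + |m|)).subset fun i hi => ?_
  by_contra hc
  apply hi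
  have hlow : ∀ j : ℤ, j < -(B : ℤ) → phi j (Finsupp.single S (1 : K)) = 0 := by
    intro j hj
    have h1 : j.natAbs ∉ S := fun h => by have := hB _ h; omega
    have h2 : ¬ (0 ≤ j) := by omega
    simp [phi_single, fermionCoeff, h1, h2]
  have : -|m| ≤ m := neg_abs_le m
  have : m ≤ |m| := le_abs_self m
  have : 0 ≤ |m| := abs_nonneg m
  rw [Set.mem_Icc, not_and_or, not_le, not_le] at hc
  dsimp only
  rcases hc with hc | hc
  · rw [hlow i (by omega)]; simp
  · have h := congrArg (fun T : Module.End K Fock => T (Finsupp.single S (1 : K)))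
      (phi_anticomm (-i - m) i)
    rw [if_neg (by omega)] at h
    simp only [LinearMap.add_apply, Module.End.mul_apply, LinearMap.zero_apply] at h
    rw [hlow (-i - m) (by omega)] at h
    simp only [map_zero, add_zero] at h
    rw [h, smul_zero]

theorem hasSubst_powerSum : MvPowerSeries.HasSubst powerSum := by
  constructor
  · intro n
    have : MvPowerSeries.constantCoeff (powerSum n) = 0 := by
      rw [← MvPowerSeries.coeff_zero_eq_constantCoeff_apply]
      refine if_neg ?_
      rintro ⟨i, hi⟩
      have := DFunLike.congr_fun hi i
      simp only [Finsupp.coe_zero, Pi.zero_apply, Finsupp.single_eq_same] at this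
      exact n.ne_zero this.symm
    rw [this]; exact IsNilpotent.zero
  · intro d
    refine (Set.finite_Iic (Nat.succPNat d.degree)).subset fun n hn => ?_
    by_contra hc
    apply hn
    refine if_neg ?_
    rintro ⟨i, hi⟩
    apply hc
    rw [Set.mem_Iic, ← PNat.coe_le_coe, hi]
    simp

theorem hasSubst_of_supported (a : ℕ → XSeries) (g : ℕ → XSeries) (r : ℕ → ℕ)
    (hr : ∀ b, {i | r i ≤ b}.Finite)
    (h : ∀ i, a i = MvPowerSeries.X (r i) * g i) : MvPowerSeries.HasSubst a := by
  constructor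
  · intro i
    rw [h]; simp
  · intro d
    refine (hr (d.support.sup id)).subset fun i hi => ?_
    by_contra hc
    apply hi
    rw [h, MvPowerSeries.X, MvPowerSeries.coeff_monomial_mul, if_neg]
    intro hle
    apply hc
    refine Finset.le_sup (f := id) (b := r i) ?_
    have := hle (r i)
    simp at this
    simp; omega

theorem hasSubst_substBeta : MvPowerSeries.HasSubst (fun i : ℕ =>
    (MvPowerSeries.X i * (1 + MvPowerSeries.C (β / 2) * MvPowerSeries.X i)⁻¹ : XSeries)) :=
  hasSubst_of_supported _ _ id (fun b => Set.finite_Iic b) fun _ => rfl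

theorem hasSubst_substTwo (g : XSeries) : MvPowerSeries.HasSubst (fun i : ℕ =>
    if i = 0 then (MvPowerSeries.X 0 : XSeries)
      else if i = 1 then MvPowerSeries.X 0 * g else MvPowerSeries.X i) := by
  refine hasSubst_of_supported _ (fun i => if i = 0 then 1 else if i = 1 then g else 1)
    (fun i => if i = 1 then 0 else i) (fun b => ?_) fun i => ?_
  · refine (Set.finite_Iic (b + 1)).subset fun i hi => ?_
    simp only [Set.mem_ofPred_eq] at hi
    simp only [Set.mem_Iic]
    split_ifs at hi <;> omega
  · rcases i with _ | _ | i <;> simp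

end NeutralFermion

open NeutralFermion

namespace NeutralFermion

/-! ### Commutators of the Heisenberg generators with the fermions. -/

section

open Polynomial

/-! Fermionic side. From `[b_m, φ_n] = φ_{n-m}` one gets, for `φ(z) = ∑ φ_n z^n`, the rule `e^H φ(z)
= exp(∑ p_n h_n(z)) φ(z) e^H` with odd polynomials `h_n` (`expHam_mul_phi`). Passing `e^H` through
the first fermion, and the resulting `⟨0|φ_{-t}` through the remaining ones, gives the expansion of
`⟨0|e^H|λ⟩` along its first fermion (`vevOf_ketList_cons`). This is the recursion of the Pfaffian
with entries `hamQTwo`, and these have the form of Schur's `Q_{(m,n)}` with `q_i` replaced by the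
coefficient `hamQ i` of `z^i` in `exp(∑ p_n h_n(z))`. So only `hamQ i` under `p_n ↦ p_n(x)` remains
to be compared with `q_i(y)`, `y = x/(1 + βx/2)`. With `h_n(z) = ((z - β/2)^n - (-z - β/2)^n)/n`,
summing logarithms gives `∏ (1 + y_i z)/(1 - y_i z)`. Formally, both sides satisfy the same Euler
equation in the `x`-degree (`subst_powerSum_hamQ`).

Cancellation side. In the coordinate `1/x` the map `x ↦ x/(1 + cx)` is translation by `c`, so `x ↦
x/(1 + βx/2)` conjugates `t ↦ -t/(1 + βt)` to `t ↦ -t` (`subst_twoVar_substMob`). Both cancellation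
conditions cut out subalgebras exchanged by this substitution, whose inverse is of the same kind,
and everything reduces to the undeformed algebra `cancelAlg 0`.

Density. Through any given degree a series in `cancelAlg 0` is determined by its coefficients at
exponents whose nonzero entries are distinct (`coeff_eq_zero_of_strict`). On these the matrix of the
`Q_λ` is invertible for every finite set of strict partitions: `Q_λ / 2^r`, `r` the number of parts,
is integral and agrees modulo 2 with the product of the power sums `p_{λ_i}` on monomials with at
least `r` variables (`det_strictCoeff_ne_zero`). Invertibility gives linear independence and, by
interpolation, density of the span. Since `cancelAlg 0` is closed and contains `Γ`, it is the
closure of `Γ`. -/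

theorem phi_anticomm_apply (m n : ℤ) (v : Fock) :
    phi m (phi n v) = (if m + n = 0 then (2 * (-1) ^ m : K) else 0) • v - phi n (phi m v) := by
  have h := congrArg (fun T : Module.End K Fock => T v) (phi_anticomm m n)
  simp only [LinearMap.add_apply, Module.End.mul_apply] at h
  rw [eq_sub_iff_add_eq, h]
  split_ifs <;> simp

/-- Every vector is killed by `φ_n` for `n` sufficiently negative. -/
theorem exists_phi_eq_zero (v : Fock) : ∃ B : ℕ, ∀ n : ℤ, n < -(B : ℤ) → phi n v = 0 := by
  induction v using Finsupp.induction_linear with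
  | zero => exact ⟨0, fun n _ => map_zero _⟩
  | add f g hf hg =>
    obtain ⟨B, hB⟩ := hf
    obtain ⟨B', hB'⟩ := hg
    refine ⟨max B B', fun n hn => ?_⟩
    rw [map_add, hB n (by push_cast at hn; omega), hB' n (by push_cast at hn; omega), add_zero]
  | single S c =>
    refine ⟨S.sup id, fun n hn => ?_⟩
    have h1 : n.natAbs ∉ S := fun h => by
      have := Finset.le_sup (f := id) h
      simp only [id] at this
      omega
    have h2 : ¬ (0 ≤ n) := by omega
    simp [phi_single, fermionCoeff, h1, h2]

/-- The finite partial sums of `b_m`. -/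
noncomputable def heisPart (m : ℤ) (B : ℕ) : Module.End K Fock :=
  (4⁻¹ : K) • ∑ i ∈ Finset.Icc (-(B : ℤ)) B, ((-1 : K) ^ i) • (phi (-i - m) * phi i)

/-- For `i` very negative, `φ_i` kills `v`. For `i` very large, `-i - m` is very negative, and since
`m ≠ 0` the two fermions anticommute. -/
theorem heis_term_eq_zero {m : ℤ} (hm : m ≠ 0) {v : Fock} {B : ℕ}
    (hB : ∀ n : ℤ, n < -(B : ℤ) → phi n v = 0) {i : ℤ}
    (hi : i ∉ Finset.Icc (-((B + m.natAbs : ℕ) : ℤ)) (B + m.natAbs : ℕ)) :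
    phi (-i - m) (phi i v) = 0 := by
  rw [Finset.mem_Icc, not_and_or, not_le, not_le] at hi
  rw [Nat.cast_add] at hi
  rcases hi with hi | hi
  · rw [hB i (by omega), map_zero]
  · rw [phi_anticomm_apply, if_neg (by omega), hB (-i - m) (by omega), map_zero, zero_smul,
      sub_zero]

/-- All sufficiently long truncations agree with `b_m` on a given vector, so an identity involving
several vectors can be checked on one common finite sum. -/
theorem heis_eq_heisPart {m : ℤ} (hm : m ≠ 0) (v : Fock) :
    ∃ B₀ : ℕ, ∀ B ≥ B₀, heis m v = heisPart m B v := by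
  induction v using Finsupp.induction_linear with
  | zero => exact ⟨0, fun B _ => by simp⟩
  | add f g hf hg =>
    obtain ⟨B, hB⟩ := hf
    obtain ⟨B', hB'⟩ := hg
    refine ⟨max B B', fun n hn => ?_⟩
    rw [map_add, hB n (le_trans (le_max_left _ _) hn), hB' n (le_trans (le_max_right _ _) hn),
      map_add]
  | single S c =>
    obtain ⟨B₀, hB₀⟩ := exists_phi_eq_zero (Finsupp.single S (1 : K))
    refine ⟨B₀ + m.natAbs, fun B hB => ?_⟩
    have hs : Finsupp.single S c = c • Finsupp.single S (1 : K) := by simp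
    rw [hs, map_smul, map_smul, heis, Finsupp.linearCombination_single, one_smul, heisPart]
    congr 1
    rw [LinearMap.smul_apply, LinearMap.sum_apply]
    congr 1
    refine finsum_eq_sum_of_support_subset _ fun i hi => ?_
    by_contra hc
    apply hi
    dsimp only
    rw [heis_term_eq_zero hm hB₀, smul_zero]
    intro h
    apply hc
    rw [Finset.mem_Icc] at h
    rw [Finset.mem_coe, Finset.mem_Icc]
    omega

theorem neg_one_zpow_of_odd {m : ℤ} (hm : Odd m) : (-1 : K) ^ m = -1 := hm.neg_one_zpow

theorem neg_one_zpow_mul_self (i : ℤ) : (-1 : K) ^ i * (-1) ^ i = 1 := by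
  rw [← zpow_add₀ (by norm_num), Even.neg_one_zpow ⟨i, rfl⟩]

theorem neg_one_zpow_neg (i : ℤ) : (-1 : K) ^ (-i) = (-1) ^ i := by
  rw [zpow_neg, ← inv_zpow]; norm_num

/-- `[b_m, φ_n] = φ_{n-m}` for odd `m`. -/
theorem heis_phi {m : ℤ} (hm : Odd m) (n : ℤ) (v : Fock) :
    heis m (phi n v) = phi n (heis m v) + phi (n - m) v := by
  have hm0 : m ≠ 0 := by rintro rfl; exact absurd hm (by decide)
  obtain ⟨B₁, h1⟩ := heis_eq_heisPart hm0 (phi n v)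
  obtain ⟨B₂, h2⟩ := heis_eq_heisPart hm0 v
  -- The window must also contain `-n` and `n - m`, the indices at which a contraction with `φ_n`
  -- occurs.
  set B := max (max B₁ B₂) (n.natAbs + m.natAbs) with hB
  rw [h1 B (by omega), h2 B (by omega)]
  -- Both contractions produce `2 φ_{n-m}`. Oddness of `m` makes their signs agree, and the
  -- prefactor `1/4` normalises `2 + 2`.
  have key : ∀ i : ℤ, ((-1 : K) ^ i) • phi (-i - m) (phi i (phi n v)) =
      ((-1 : K) ^ i) • phi n (phi (-i - m) (phi i v)) +
      ((if i = -n then (2 : K) else 0) • phi (n - m) v +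
        (if i = n - m then (2 : K) else 0) • phi (n - m) v) := by
    intro i
    rw [phi_anticomm_apply i n v, map_sub, map_smul, phi_anticomm_apply (-i - m) n, smul_sub,
      smul_sub, smul_smul, smul_smul]
    have e1 : ((-1 : K) ^ i * if i + n = 0 then 2 * (-1) ^ i else 0) • phi (-i - m) v =
        (if i = -n then (2 : K) else 0) • phi (n - m) v := by
      by_cases h : i = -n
      · subst h
        rw [if_pos (by omega), if_pos rfl, neg_neg, mul_left_comm, neg_one_zpow_mul_self, mul_one]
      · rw [if_neg (by omega), if_neg h]; simp
    have e2 : ((-1 : K) ^ i * if -i - m + n = 0 then 2 * (-1) ^ (-i - m) else 0) • phi i v =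
        -((if i = n - m then (2 : K) else 0) • phi (n - m) v) := by
      by_cases h : i = n - m
      · subst h
        rw [if_pos (by omega), if_pos rfl, mul_left_comm, ← zpow_add₀ (by norm_num),
          show n - m + (-(n - m) - m) = -m by ring, neg_one_zpow_neg, neg_one_zpow_of_odd hm]
        simp
      · rw [if_neg (by omega), if_neg h]; simp
    rw [e1, e2]; abel
  have hs1 : ∑ i ∈ Finset.Icc (-(B : ℤ)) B, (if i = -n then (2 : K) else 0) • phi (n - m) v =
      (2 : K) • phi (n - m) v := by
    rw [← Finset.sum_smul, Finset.sum_ite_eq', if_pos]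
    rw [Finset.mem_Icc]; omega
  have hs2 : ∑ i ∈ Finset.Icc (-(B : ℤ)) B, (if i = n - m then (2 : K) else 0) • phi (n - m) v =
      (2 : K) • phi (n - m) v := by
    rw [← Finset.sum_smul, Finset.sum_ite_eq', if_pos]
    rw [Finset.mem_Icc]; omega
  simp only [heisPart, LinearMap.smul_apply, LinearMap.sum_apply, Module.End.mul_apply, key,
    Finset.sum_add_distrib, hs1, hs2, map_smul, map_sum]
  rw [smul_add, ← add_smul, smul_smul]
  norm_num

theorem heis_vacuum {m : ℤ} (hm : 0 < m) : heis m vacuum = 0 := by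
  have hm0 : m ≠ 0 := by omega
  obtain ⟨B, h⟩ := heis_eq_heisPart hm0 vacuum
  rw [h B le_rfl, heisPart, LinearMap.smul_apply, LinearMap.sum_apply, Finset.sum_eq_zero,
    smul_zero]
  intro i _
  rw [LinearMap.smul_apply, Module.End.mul_apply]
  rcases lt_or_ge i 0 with hi | hi
  · rw [phi_vacuum_neg i hi, map_zero, smul_zero]
  · rw [phi_anticomm_apply, if_neg (by omega), phi_vacuum_neg _ (by omega)]; simp

/-- Right multiplication by `φ_0`: `|S⟩ ↦ |S ∆ {0}⟩`. -/
noncomputable def rmulPhiZero : Module.End K Fock :=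
  Finsupp.linearCombination K fun S : Finset ℕ => Finsupp.single (S ∆ {0}) (1 : K)

theorem rmulPhiZero_single (S : Finset ℕ) (c : K) :
    rmulPhiZero (Finsupp.single S c) = Finsupp.single (S ∆ {0}) c := by
  rw [rmulPhiZero, Finsupp.linearCombination_single, Finsupp.smul_single, smul_eq_mul, mul_one]

theorem fermionSign_symmDiff_zero (a : ℕ) (S : Finset ℕ) :
    fermionSign a (S ∆ {0}) = fermionSign a S :=
  fermionSign_symmDiff_of_le (Nat.zero_le a) S

theorem fermionCoeff_symmDiff_zero (n : ℤ) (S : Finset ℕ) :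
    fermionCoeff n (S ∆ {0}) = fermionCoeff n S := by
  by_cases hn : n = 0
  · subst hn
    simp [fermionCoeff]
  · exact fermionCoeff_symmDiff (m := 0) (by rw [Int.natAbs_zero]; omega) S

/-- Left and right multiplications commute. There is no sign because `0` is the smallest index:
inserting it on the right changes no `fermionSign`. -/
theorem rmulPhiZero_phi (n : ℤ) (v : Fock) :
    rmulPhiZero (phi n v) = phi n (rmulPhiZero v) := by
  induction v using Finsupp.induction_linear with
  | zero => simp
  | add f g hf hg => simp only [map_add, hf, hg]
  | single S c =>
    rw [rmulPhiZero_single, phi_single, phi_single, rmulPhiZero_single, fermionSign_symmDiff_zero,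
      fermionCoeff_symmDiff_zero, symmDiff_right_comm]

theorem rmulPhiZero_heis {m : ℤ} (hm : m ≠ 0) (v : Fock) :
    rmulPhiZero (heis m v) = heis m (rmulPhiZero v) := by
  obtain ⟨B₁, h1⟩ := heis_eq_heisPart hm v
  obtain ⟨B₂, h2⟩ := heis_eq_heisPart hm (rmulPhiZero v)
  rw [h1 (max B₁ B₂) (le_max_left _ _), h2 (max B₁ B₂) (le_max_right _ _)]
  simp only [heisPart, LinearMap.smul_apply, LinearMap.sum_apply, Module.End.mul_apply, map_smul,
    map_sum, rmulPhiZero_phi]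

/-- `φ_0 |0⟩` is the right multiple of the vacuum by `φ_0`. -/
theorem phi_zero_vacuum : phi 0 vacuum = rmulPhiZero vacuum := by
  rw [vacuum, phi_single, rmulPhiZero_single]
  simp [fermionSign, fermionCoeff]

/-- Both sides read off the coefficient of `φ_0|0⟩`. Thus a zero mode next to `⟨0|` can be traded
for right multiplication, which commutes with `e^H`. -/
theorem vacuumExp_phi_zero (v : Fock) : vacuumExp (phi 0 v) = vacuumExp (rmulPhiZero v) := by
  induction v using Finsupp.induction_linear with
  | zero => simp
  | add f g hf hg => simp only [map_add, hf, hg]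
  | single S c =>
    rw [rmulPhiZero_single, phi_single, Int.natAbs_zero, vacuumExp, Finsupp.lapply_apply,
      Finsupp.lapply_apply, Finsupp.single_apply, Finsupp.single_apply]
    split_ifs with h
    · have h2 : S = {0} := by rwa [← Finset.bot_eq_empty, symmDiff_eq_bot] at h
      subst h2
      simp [fermionCoeff, fermionSign, Finset.filter_singleton]
    · rfl

theorem vacuumExp_vacuum : vacuumExp vacuum = 1 := by
  simp [vacuumExp, vacuum]

/-- `∑_i C_i φ_{n-i}`, the coefficient of `z^n` in `C(z) φ(z)`. -/
noncomputable def phiPoly (n : ℤ) : K[X] →ₗ[K] Module.End K Fock :=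
  Polynomial.lsum fun i => LinearMap.toSpanSingleton K (Module.End K Fock) (phi (n - i))

theorem phiPoly_apply (n : ℤ) (C : K[X]) : phiPoly n C = C.sum fun i c => c • phi (n - i) := rfl

theorem phiPoly_monomial (n : ℤ) (i : ℕ) (c : K) :
    phiPoly n (monomial i c) = c • phi (n - i) := by
  rw [phiPoly_apply, Polynomial.sum_monomial_index]; simp

theorem phiPoly_one (n : ℤ) : phiPoly n 1 = phi n := by
  rw [← monomial_zero_one, phiPoly_monomial]; simp

theorem betaPoly_comp_neg (m : ℕ) : (betaPoly m).comp (-X) = -betaPoly m := by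
  simp [betaPoly]; ring

theorem coeff_comp_neg (p : K[X]) (i : ℕ) : (p.comp (-X)).coeff i = (-1) ^ i * p.coeff i := by
  rw [show (-X : K[X]) = C (-1) * X by simp, comp_C_mul_X_coeff, mul_comm]

theorem betaPoly_coeff_even {m j : ℕ} (hj : Even j) : (betaPoly m).coeff j = 0 := by
  have h := congrArg (fun p : K[X] => p.coeff j) (betaPoly_comp_neg m)
  simp only [coeff_comp_neg, hj.neg_one_pow, coeff_neg, one_mul] at h
  linear_combination (2⁻¹ : K) * h

theorem heisBeta_apply (m : ℕ) (v : Fock) :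
    heisBeta m v = ∑ j ∈ (betaPoly m).support, (betaPoly m).coeff j • heis j v := by
  rw [heisBeta, Polynomial.sum_def, LinearMap.sum_apply]
  rfl

theorem odd_of_mem_support_betaPoly {m j : ℕ} (hj : j ∈ (betaPoly m).support) :
    Odd (j : ℤ) := by
  rw [Int.odd_coe_nat, ← Nat.not_even_iff_odd]
  exact fun h => mem_support_iff.mp hj (betaPoly_coeff_even h)

theorem heisBeta_vacuum (m : ℕ) : heisBeta m vacuum = 0 := by
  rw [heisBeta_apply]
  refine Finset.sum_eq_zero fun j hj => ?_
  have := odd_of_mem_support_betaPoly hj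
  rw [heis_vacuum (by exact_mod_cast ((Int.odd_coe_nat j).1 this).pos), smul_zero]

theorem rmulPhiZero_heisBeta (m : ℕ) (v : Fock) :
    rmulPhiZero (heisBeta m v) = heisBeta m (rmulPhiZero v) := by
  rw [heisBeta_apply, heisBeta_apply, map_sum]
  refine Finset.sum_congr rfl fun j hj => ?_
  have := odd_of_mem_support_betaPoly hj
  rw [map_smul, rmulPhiZero_heis (by intro h; rw [h] at this; exact absurd this (by decide))]

theorem heisBeta_phi (m : ℕ) (n : ℤ) :
    heisBeta m * phi n = phi n * heisBeta m + phiPoly n (betaPoly m) := by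
  refine LinearMap.ext fun w => ?_
  simp only [LinearMap.add_apply, Module.End.mul_apply]
  rw [heisBeta_apply, heisBeta_apply, phiPoly_apply, Polynomial.sum_def, LinearMap.sum_apply,
    map_sum, ← Finset.sum_add_distrib]
  refine Finset.sum_congr rfl fun j hj => ?_
  rw [heis_phi (odd_of_mem_support_betaPoly hj), map_smul, smul_add, LinearMap.smul_apply]

/-- `[b^{(β)}_m, C(z) φ(z)] = P_m(z) C(z) φ(z)`. -/
theorem heisBeta_phiPoly (m : ℕ) (n : ℤ) (D : K[X]) :
    heisBeta m * phiPoly n D = phiPoly n D * heisBeta m + phiPoly n (betaPoly m * D) := by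
  induction D using Polynomial.induction_on' with
  | add p q hp hq => simp only [map_add, mul_add, add_mul, hp, hq]; abel
  | monomial i c =>
    rw [phiPoly_monomial, mul_smul_comm, heisBeta_phi, smul_add, smul_mul_assoc]
    congr 1
    generalize betaPoly m = p
    induction p using Polynomial.induction_on' with
    | add p q hp hq => simp only [map_add, smul_add, add_mul, hp, hq]
    | monomial j b =>
      rw [monomial_mul_monomial, phiPoly_monomial, phiPoly_monomial, smul_smul, mul_comm b c]
      congr 2
      push_cast; ring

/-! ### Linear forms and the Euler operator on power series -/

section Euler

variable {σ R : Type*}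

/-- The linear form `∑ L_n X_n`. -/
noncomputable def linSeries [Semiring R] (L : σ → R) : MvPowerSeries σ R := fun d =>
  if d.degree = 1 then ∑ n ∈ d.support, L n else 0

theorem exists_eq_single_of_degree_eq_one {d : σ →₀ ℕ} (hd : d.degree = 1) :
    ∃ n, d = Finsupp.single n 1 := by
  have h0 : d ≠ 0 := by rintro rfl; simp at hd
  obtain ⟨n, hn⟩ := Finsupp.ne_iff.mp h0
  have hle : Finsupp.single n 1 ≤ d := by
    rw [Finsupp.single_le_iff]; exact Nat.one_le_iff_ne_zero.mpr hn
  refine ⟨n, ?_⟩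
  have h := congrArg Finsupp.degree (tsub_add_cancel_of_le hle)
  rw [map_add, Finsupp.degree_single, hd, Nat.add_eq_right, Finsupp.degree_eq_zero_iff] at h
  rw [← tsub_add_cancel_of_le hle, h, zero_add]

theorem coeff_linSeries [Semiring R] (L : σ → R) (d : σ →₀ ℕ) :
    MvPowerSeries.coeff d (linSeries L) =
      if d.degree = 1 then ∑ n ∈ d.support, L n else 0 := rfl

theorem coeff_linSeries_single [Semiring R] (L : σ → R) (n : σ) :
    MvPowerSeries.coeff (Finsupp.single n 1) (linSeries L) = L n := by
  rw [coeff_linSeries, if_pos (by simp), Finsupp.support_single _ one_ne_zero,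
    Finset.sum_singleton]

theorem single_le_of_mem_support {d : σ →₀ ℕ} {n : σ} (hn : n ∈ d.support) :
    Finsupp.single n 1 ≤ d := by
  rw [Finsupp.single_le_iff]; exact Nat.one_le_iff_ne_zero.mpr (Finsupp.mem_support_iff.mp hn)

theorem degree_sub_single_add_one {d : σ →₀ ℕ} {n : σ} (hn : n ∈ d.support) :
    (d - Finsupp.single n 1).degree + 1 = d.degree := by
  conv_rhs => rw [← tsub_add_cancel_of_le (single_le_of_mem_support hn)]
  rw [map_add, Finsupp.degree_single]

theorem coeff_linSeries_mul [Semiring R] (L : σ → R) (f : MvPowerSeries σ R) (d : σ →₀ ℕ) :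
    MvPowerSeries.coeff d (linSeries L * f) =
      ∑ n ∈ d.support, L n * MvPowerSeries.coeff (d - Finsupp.single n 1) f := by
  classical
  rw [MvPowerSeries.coeff_mul]
  symm
  refine Finset.sum_of_injOn (fun n => (Finsupp.single n 1, d - Finsupp.single n 1)) ?_ ?_ ?_ ?_
  · intro a _ b _ h
    exact Finsupp.single_left_injective one_ne_zero (congrArg Prod.fst h)
  · intro n hn
    simp only [Finset.mem_coe, Finset.HasAntidiagonal.mem_antidiagonal]
    exact add_tsub_cancel_of_le (single_le_of_mem_support hn)
  · rintro ⟨a, b⟩ hab hn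
    rw [Finset.HasAntidiagonal.mem_antidiagonal] at hab
    rw [coeff_linSeries, if_neg, zero_mul]
    intro ha
    obtain ⟨n, hn'⟩ := exists_eq_single_of_degree_eq_one ha
    dsimp only at hab hn'
    subst hn'
    refine hn ⟨n, ?_, ?_⟩
    · rw [← hab]; simp
    · rw [← hab]; simp
  · intro n _
    rw [coeff_linSeries_single]

theorem coeff_mul_linSeries [Semiring R] (L : σ → R) (f : MvPowerSeries σ R) (d : σ →₀ ℕ) :
    MvPowerSeries.coeff d (f * linSeries L) =
      ∑ n ∈ d.support, MvPowerSeries.coeff (d - Finsupp.single n 1) f * L n := by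
  classical
  rw [MvPowerSeries.coeff_mul]
  symm
  refine Finset.sum_of_injOn (fun n => (d - Finsupp.single n 1, Finsupp.single n 1)) ?_ ?_ ?_ ?_
  · intro a _ b _ h
    exact Finsupp.single_left_injective one_ne_zero (congrArg Prod.snd h)
  · intro n hn
    simp only [Finset.mem_coe, Finset.HasAntidiagonal.mem_antidiagonal]
    exact tsub_add_cancel_of_le (single_le_of_mem_support hn)
  · rintro ⟨b, a⟩ hab hn
    rw [Finset.HasAntidiagonal.mem_antidiagonal] at hab
    rw [coeff_linSeries, if_neg, mul_zero]
    intro ha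
    obtain ⟨n, hn'⟩ := exists_eq_single_of_degree_eq_one ha
    dsimp only at hab hn'
    subst hn'
    refine hn ⟨n, ?_, ?_⟩
    · rw [← hab]; simp
    · rw [← hab]; simp
  · intro n _
    rw [coeff_linSeries_single]

/-- The Euler operator, which multiplies a monomial by its degree. -/
noncomputable def euler [Semiring R] (f : MvPowerSeries σ R) : MvPowerSeries σ R := fun d =>
  d.degree • MvPowerSeries.coeff d f

theorem coeff_euler [Semiring R] (f : MvPowerSeries σ R) (d : σ →₀ ℕ) :
    MvPowerSeries.coeff d (euler f) = d.degree • MvPowerSeries.coeff d f := rfl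

theorem euler_mul [Semiring R] (f g : MvPowerSeries σ R) :
    euler (f * g) = euler f * g + f * euler g := by
  classical
  ext d
  rw [coeff_euler, map_add, MvPowerSeries.coeff_mul, MvPowerSeries.coeff_mul,
    MvPowerSeries.coeff_mul, ← Finset.sum_add_distrib, Finset.smul_sum]
  refine Finset.sum_congr rfl fun p hp => ?_
  rw [Finset.HasAntidiagonal.mem_antidiagonal] at hp
  rw [coeff_euler, coeff_euler, smul_mul_assoc, mul_smul_comm, ← add_smul, ← map_add, hp]

theorem euler_C [Semiring R] (r : R) : euler (MvPowerSeries.C (σ := σ) r) = 0 := by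
  classical
  ext d
  rw [coeff_euler, MvPowerSeries.coeff_C]
  split_ifs with h
  · subst h; simp
  · simp

/-- The equation determines the coefficients of degree `k` from those of degree `k - 1`, because `k`
is invertible in `K`. The coefficient ring may be noncommutative, hence a left and a right version.
-/
theorem eq_of_euler_left [Semiring R] [Module K R] {L : σ → R} {f g : MvPowerSeries σ R}
    (h0 : MvPowerSeries.coeff 0 f = MvPowerSeries.coeff 0 g) (hf : euler f = linSeries L * f)
    (hg : euler g = linSeries L * g) : f = g := by
  ext d
  induction hd : d.degree using Nat.strong_induction_on generalizing d with
  | _ k ih =>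
    rcases Nat.eq_zero_or_pos k with hk | hk
    · rw [hk, Finsupp.degree_eq_zero_iff] at hd
      rw [hd, h0]
    · have h1 := congrArg (MvPowerSeries.coeff d) hf
      have h2 := congrArg (MvPowerSeries.coeff d) hg
      rw [coeff_euler, coeff_linSeries_mul, hd, ← Nat.cast_smul_eq_nsmul K] at h1 h2
      have hk' : (k : K) ≠ 0 := Nat.cast_ne_zero.mpr hk.ne'
      rw [← inv_smul_smul₀ hk' (MvPowerSeries.coeff d f), h1,
        ← inv_smul_smul₀ hk' (MvPowerSeries.coeff d g), h2]
      congr 1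
      refine Finset.sum_congr rfl fun n hn => ?_
      have := degree_sub_single_add_one hn
      rw [ih (k - 1) (by omega) _ (by omega)]

theorem eq_of_euler_right [Semiring R] [Module K R] {L : σ → R} {f g : MvPowerSeries σ R}
    (h0 : MvPowerSeries.coeff 0 f = MvPowerSeries.coeff 0 g) (hf : euler f = f * linSeries L)
    (hg : euler g = g * linSeries L) : f = g := by
  ext d
  induction hd : d.degree using Nat.strong_induction_on generalizing d with
  | _ k ih =>
    rcases Nat.eq_zero_or_pos k with hk | hk
    · rw [hk, Finsupp.degree_eq_zero_iff] at hd
      rw [hd, h0]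
    · have h1 := congrArg (MvPowerSeries.coeff d) hf
      have h2 := congrArg (MvPowerSeries.coeff d) hg
      rw [coeff_euler, coeff_mul_linSeries, hd, ← Nat.cast_smul_eq_nsmul K] at h1 h2
      have hk' : (k : K) ≠ 0 := Nat.cast_ne_zero.mpr hk.ne'
      rw [← inv_smul_smul₀ hk' (MvPowerSeries.coeff d f), h1,
        ← inv_smul_smul₀ hk' (MvPowerSeries.coeff d g), h2]
      congr 1
      refine Finset.sum_congr rfl fun n hn => ?_
      have := degree_sub_single_add_one hn
      rw [ih (k - 1) (by omega) _ (by omega)]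

/-- Conjugation by `E = e^L` without inverting it: if `G` satisfies `euler G = [L, G]` and `F` is
constant, then `E F` and `G E` solve the same Euler equation. -/
theorem mul_eq_mul_of_euler_left [Semiring R] [Module K R] {L : σ → R}
    {E F G : MvPowerSeries σ R} (hE : euler E = linSeries L * E) (hF : euler F = 0)
    (hG : euler G + G * linSeries L = linSeries L * G)
    (h0 : MvPowerSeries.coeff 0 (E * F) = MvPowerSeries.coeff 0 (G * E)) : E * F = G * E := by
  refine eq_of_euler_left (L := L) h0 ?_ ?_
  · rw [euler_mul, hF, mul_zero, add_zero, hE, mul_assoc]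
  · rw [euler_mul, hE, ← mul_assoc G, ← add_mul, hG, mul_assoc]

theorem mul_eq_mul_of_euler_right [Semiring R] [Module K R] {L : σ → R}
    {E F G : MvPowerSeries σ R} (hE : euler E = E * linSeries L) (hF : euler F = 0)
    (hG : euler G + linSeries L * G = G * linSeries L)
    (h0 : MvPowerSeries.coeff 0 (F * E) = MvPowerSeries.coeff 0 (E * G)) : F * E = E * G := by
  refine eq_of_euler_right (L := L) h0 ?_ ?_
  · rw [euler_mul, hF, zero_mul, zero_add, hE, mul_assoc]
  · rw [euler_mul, hE, mul_assoc E, ← mul_add, add_comm, hG, mul_assoc]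

end Euler

/-! ### The exponential of a linear form with polynomial coefficients -/

/-- The coefficient `∏ h_n^{a_n} / a_n!` of `exp (∑ h_n p_n)`. -/
noncomputable def expPoly (h : ℕ+ → K[X]) (a : ℕ+ →₀ ℕ) : K[X] :=
  a.prod fun n k => C ((k.factorial : K)⁻¹) * h n ^ k

theorem expPoly_zero (h : ℕ+ → K[X]) : expPoly h 0 = 1 := by simp [expPoly]

/-- This is the effect of `p_n ∂/∂p_n` on `exp (∑ h_n p_n)`, read off at `p^a`. -/
theorem smul_expPoly (h : ℕ+ → K[X]) (a : ℕ+ →₀ ℕ) {n : ℕ+} (hn : n ∈ a.support) :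
    a n • expPoly h a = h n * expPoly h (a - Finsupp.single n 1) := by
  have hg : ∀ i : ℕ+, C (((0 : ℕ).factorial : K)⁻¹) * h i ^ 0 = 1 := by simp
  have he : (a - Finsupp.single n 1).erase n = a.erase n := by
    ext i
    by_cases hi : i = n
    · subst hi; simp
    · simp [Finsupp.erase_ne hi, Finsupp.single_eq_of_ne hi]
  rw [expPoly, expPoly, ← Finsupp.mul_prod_erase' a n _ hg,
    ← Finsupp.mul_prod_erase' (a - Finsupp.single n 1) n _ hg, he]
  obtain ⟨k, hk⟩ := Nat.exists_eq_succ_of_ne_zero (Finsupp.mem_support_iff.mp hn)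
  have h2 : (a - Finsupp.single n 1 : ℕ+ →₀ ℕ) n = k := by simp [hk]
  rw [h2, hk, Nat.succ_eq_add_one, ← smul_mul_assoc, ← mul_assoc, ← Nat.cast_smul_eq_nsmul K,
    smul_eq_C_mul, ← mul_assoc, ← C_mul, pow_succ]
  have : ((k + 1 : ℕ) : K) * (((k + 1).factorial : ℕ) : K)⁻¹ = ((k.factorial : ℕ) : K)⁻¹ := by
    rw [Nat.factorial_succ, Nat.cast_mul, mul_inv, mul_inv_cancel_left₀]
    exact Nat.cast_ne_zero.mpr k.succ_ne_zero
  rw [this]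
  ring

theorem degree_smul_expPoly (h : ℕ+ → K[X]) (a : ℕ+ →₀ ℕ) :
    a.degree • expPoly h a = ∑ n ∈ a.support, h n * expPoly h (a - Finsupp.single n 1) := by
  rw [Finsupp.degree_apply, Finset.sum_smul]
  exact Finset.sum_congr rfl fun n hn => smul_expPoly h a hn

/-! ### The operator `e^{H^{(β)}}` -/

/-- `[H^{(β)}, φ(z)] = (∑ p_n h_n(z)) φ(z)` with `h_n = (2 / n) P_n`. -/
noncomputable def hamPoly (n : ℕ+) : K[X] := C (2 / (n : K)) * betaPoly n

/-- The coefficient of `p_n` in `H^{(β)}`. -/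
noncomputable def hamCoeff (n : ℕ+) : Module.End K Fock := (2 / (n : K)) • heisBeta n

theorem hamCoeff_phiPoly (m : ℕ+) (n : ℤ) (D : K[X]) :
    hamCoeff m * phiPoly n D = phiPoly n D * hamCoeff m + phiPoly n (hamPoly m * D) := by
  rw [hamCoeff, hamPoly, smul_mul_assoc, heisBeta_phiPoly, smul_add, mul_smul_comm, mul_assoc,
    ← smul_eq_C_mul, map_smul]

theorem hamPoly_comp_neg (n : ℕ+) : (hamPoly n).comp (-X) = -hamPoly n := by
  rw [hamPoly, mul_comp, betaPoly_comp_neg, C_comp, mul_neg]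

/-- `H^{(β)}` as a power series with operator coefficients. -/
noncomputable def hamSeries : MvPowerSeries ℕ+ (Module.End K Fock) := linSeries hamCoeff

theorem hamBeta_apply (w : FockSeries) (d : ℕ+ →₀ ℕ) :
    hamBeta w d = ∑ n ∈ d.support, hamCoeff n (w (d - Finsupp.single n 1)) := rfl

/-- Moves from iterating an operator on `F[[p]]` to multiplication in the ring of power series with
operator coefficients. -/
theorem hamBeta_iterate (N : ℕ) (v : Fock) (d : ℕ+ →₀ ℕ) :
    (hamBeta^[N] (constSeries v)) d = MvPowerSeries.coeff d (hamSeries ^ N) v := by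
  classical
  induction N generalizing d with
  | zero =>
    rw [Function.iterate_zero, id, pow_zero, MvPowerSeries.coeff_one, constSeries]
    split_ifs <;> rfl
  | succ N ih =>
    rw [Function.iterate_succ_apply', hamBeta_apply, pow_succ', hamSeries, coeff_linSeries_mul,
      LinearMap.sum_apply]
    refine Finset.sum_congr rfl fun n _ => ?_
    rw [ih, Module.End.mul_apply, hamSeries]

theorem coeff_hamSeries_pow_eq_zero {N : ℕ} {d : ℕ+ →₀ ℕ} (h : d.degree ≠ N) :
    MvPowerSeries.coeff d (hamSeries ^ N) = 0 := by
  classical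
  induction N generalizing d with
  | zero =>
    rw [pow_zero, MvPowerSeries.coeff_one, if_neg]
    rintro rfl
    simp at h
  | succ N ih =>
    rw [pow_succ', hamSeries, coeff_linSeries_mul]
    refine Finset.sum_eq_zero fun n hn => ?_
    have := degree_sub_single_add_one hn
    rw [← hamSeries, ih (by omega), mul_zero]

/-- `e^{H^{(β)}}` as a power series with operator coefficients. -/
noncomputable def expHam : MvPowerSeries ℕ+ (Module.End K Fock) := fun d =>
  ((d.degree.factorial : K)⁻¹) • MvPowerSeries.coeff d (hamSeries ^ d.degree)

theorem coeff_expHam (d : ℕ+ →₀ ℕ) : MvPowerSeries.coeff d expHam =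
    ((d.degree.factorial : K)⁻¹) • MvPowerSeries.coeff d (hamSeries ^ d.degree) := rfl

theorem expHamBeta_eq (v : Fock) (d : ℕ+ →₀ ℕ) :
    expHamBeta v d = MvPowerSeries.coeff d expHam v := by
  rw [expHamBeta, Finset.sum_eq_single d.degree, hamBeta_iterate, coeff_expHam,
    LinearMap.smul_apply]
  · intro N _ hN
    rw [hamBeta_iterate, coeff_hamSeries_pow_eq_zero hN.symm, LinearMap.zero_apply, smul_zero]
  · intro h
    simp at h

theorem coeff_zero_expHam : MvPowerSeries.coeff 0 expHam = 1 := by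
  rw [coeff_expHam]; simp

theorem smul_factorial_aux (k : ℕ) (T : Module.End K Fock) :
    (k + 1) • (((k + 1).factorial : K)⁻¹ • T) = ((k.factorial : K)⁻¹) • T := by
  rw [← Nat.cast_smul_eq_nsmul K, smul_smul, Nat.factorial_succ, Nat.cast_mul, mul_inv,
    mul_inv_cancel_left₀]
  exact Nat.cast_ne_zero.mpr k.succ_ne_zero

/-- Splitting `H^{k+1}` as `H * H^k` gives this equation, splitting it as `H^k * H` the one on the
right. The `b_m` need not commute with each other. -/
theorem euler_expHam_left : euler expHam = linSeries hamCoeff * expHam := by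
  ext1 d
  rw [coeff_euler, coeff_linSeries_mul]
  rcases hd : d.degree with _ | k
  · rw [Finsupp.degree_eq_zero_iff] at hd
    subst hd
    simp
  · rw [coeff_expHam, hd, smul_factorial_aux, pow_succ', hamSeries, coeff_linSeries_mul,
      Finset.smul_sum]
    refine Finset.sum_congr rfl fun n hn => ?_
    have := degree_sub_single_add_one hn
    rw [coeff_expHam, show (d - Finsupp.single n 1 : ℕ+ →₀ ℕ).degree = k by omega, mul_smul_comm,
      hamSeries]

theorem euler_expHam_right : euler expHam = expHam * linSeries hamCoeff := by
  ext1 d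
  rw [coeff_euler, coeff_mul_linSeries]
  rcases hd : d.degree with _ | k
  · rw [Finsupp.degree_eq_zero_iff] at hd
    subst hd
    simp
  · rw [coeff_expHam, hd, smul_factorial_aux, pow_succ, hamSeries, coeff_mul_linSeries,
      Finset.smul_sum]
    refine Finset.sum_congr rfl fun n hn => ?_
    have := degree_sub_single_add_one hn
    rw [coeff_expHam, show (d - Finsupp.single n 1 : ℕ+ →₀ ℕ).degree = k by omega, smul_mul_assoc,
      hamSeries]

/-- The coefficient of `z^n` in `exp (∑ p_m h_m(z)) φ(z)`. -/
noncomputable def phiExp (h : ℕ+ → K[X]) (n : ℤ) : MvPowerSeries ℕ+ (Module.End K Fock) :=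
  fun a => phiPoly n (expPoly h a)

theorem coeff_phiExp (h : ℕ+ → K[X]) (n : ℤ) (a : ℕ+ →₀ ℕ) :
    MvPowerSeries.coeff a (phiExp h n) = phiPoly n (expPoly h a) := rfl

/-- The Euler operator multiplies `exp(∑ p_m h_m(z)) φ(z)` by `∑ p_m h_m(z)`, and by
`hamCoeff_phiPoly` the commutator with `H` does the same. -/
theorem euler_phiExp (n : ℤ) : euler (phiExp hamPoly n) + phiExp hamPoly n * linSeries hamCoeff =
    linSeries hamCoeff * phiExp hamPoly n := by
  ext1 d
  rw [map_add, coeff_euler, coeff_linSeries_mul, coeff_mul_linSeries, coeff_phiExp, ← map_nsmul,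
    degree_smul_expPoly, map_sum]
  refine Finset.sum_add_distrib.symm.trans (Finset.sum_congr rfl fun m _ => ?_)
  rw [coeff_phiExp, hamCoeff_phiPoly, add_comm]

theorem euler_phiExp_neg (n : ℤ) :
    euler (phiExp (-hamPoly) n) + linSeries hamCoeff * phiExp (-hamPoly) n =
      phiExp (-hamPoly) n * linSeries hamCoeff := by
  ext1 d
  rw [map_add, coeff_euler, coeff_linSeries_mul, coeff_mul_linSeries, coeff_phiExp, ← map_nsmul,
    degree_smul_expPoly, map_sum]
  refine Finset.sum_add_distrib.symm.trans (Finset.sum_congr rfl fun m _ => ?_)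
  rw [coeff_phiExp, hamCoeff_phiPoly, Pi.neg_apply, neg_mul, map_neg, neg_add_cancel_comm_assoc]

theorem coeff_zero_phiExp (h : ℕ+ → K[X]) (n : ℤ) :
    MvPowerSeries.coeff 0 (phiExp h n) = phi n := by
  rw [coeff_phiExp, expPoly_zero, phiPoly_one]

/-- `e^{H} φ_n = (e^{H} φ_n e^{-H}) e^{H}`. -/
theorem expHam_mul_phi (n : ℤ) :
    expHam * MvPowerSeries.C (phi n) = phiExp hamPoly n * expHam := by
  classical
  refine mul_eq_mul_of_euler_left euler_expHam_left (euler_C _) (euler_phiExp n) ?_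
  simp [MvPowerSeries.coeff_mul, coeff_zero_expHam, coeff_zero_phiExp]

/-- `φ_n e^{H} = e^{H} (e^{-H} φ_n e^{H})`. -/
theorem phi_mul_expHam (n : ℤ) :
    MvPowerSeries.C (phi n) * expHam = expHam * phiExp (-hamPoly) n := by
  classical
  refine mul_eq_mul_of_euler_right euler_expHam_right (euler_C _) (euler_phiExp_neg n) ?_
  simp [MvPowerSeries.coeff_mul, coeff_zero_expHam, coeff_zero_phiExp]

theorem hamCoeff_vacuum (n : ℕ+) : hamCoeff n vacuum = 0 := by
  rw [hamCoeff, LinearMap.smul_apply, heisBeta_vacuum, smul_zero]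

theorem expHam_vacuum (d : ℕ+ →₀ ℕ) :
    MvPowerSeries.coeff d expHam vacuum = if d = 0 then vacuum else 0 := by
  split_ifs with h
  · rw [h, coeff_zero_expHam, Module.End.one_apply]
  · rw [coeff_expHam]
    obtain ⟨k, hk⟩ := Nat.exists_eq_succ_of_ne_zero
      (mt (Finsupp.degree_eq_zero_iff d).mp h)
    rw [hk, pow_succ, hamSeries, coeff_mul_linSeries, LinearMap.smul_apply, LinearMap.sum_apply,
      Finset.sum_eq_zero, smul_zero]
    intro n _
    rw [Module.End.mul_apply, hamCoeff_vacuum, map_zero]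

theorem rmulPhiZero_expHam (d : ℕ+ →₀ ℕ) (v : Fock) :
    rmulPhiZero (MvPowerSeries.coeff d expHam v) =
      MvPowerSeries.coeff d expHam (rmulPhiZero v) := by
  have h : ∀ (N : ℕ) (d : ℕ+ →₀ ℕ), rmulPhiZero (MvPowerSeries.coeff d (hamSeries ^ N) v) =
      MvPowerSeries.coeff d (hamSeries ^ N) (rmulPhiZero v) := by
    classical
    intro N
    induction N with
    | zero =>
      intro d
      rw [pow_zero, MvPowerSeries.coeff_one]
      split_ifs <;> simp
    | succ N ih =>
      intro d
      rw [pow_succ', hamSeries, coeff_linSeries_mul, LinearMap.sum_apply, LinearMap.sum_apply,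
        map_sum]
      refine Finset.sum_congr rfl fun n _ => ?_
      rw [Module.End.mul_apply, Module.End.mul_apply, ← hamSeries, ← ih, hamCoeff,
        LinearMap.smul_apply, LinearMap.smul_apply, map_smul, rmulPhiZero_heisBeta]
  rw [coeff_expHam, LinearMap.smul_apply, LinearMap.smul_apply, map_smul, h]

/-! ### Wick's theorem -/

theorem polySum_eq_sum_range {p : K[X]} {g : ℕ → K} {n : ℕ} (hg : ∀ i, n ≤ i → g i = 0) :
    (p.sum fun i c => c * g i) = ∑ i ∈ Finset.range n, p.coeff i * g i := by
  rw [Polynomial.sum_def]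
  have h1 := Finset.sum_subset (Finset.subset_union_left (s₁ := p.support) (s₂ := Finset.range n))
    (f := fun i => p.coeff i * g i) (by
      intro i _ hi
      rw [notMem_support_iff.mp hi, zero_mul])
  have h2 := Finset.sum_subset (Finset.subset_union_right (s₁ := p.support) (s₂ := Finset.range n))
    (f := fun i => p.coeff i * g i) (by
      intro i _ hi
      rw [hg i (by simpa using hi), mul_zero])
  rw [h1, h2]

/-- The `h_n` are odd, so `exp(-h(z)) = exp(h(-z))`: conjugating by `e^H` in the opposite direction
brings in the same coefficients `hamQ i`, up to the sign `(-1)^i`. -/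
theorem expPoly_neg_hamPoly (a : ℕ+ →₀ ℕ) :
    expPoly (-hamPoly) a = (expPoly hamPoly a).comp (-X) := by
  rw [expPoly, expPoly, Finsupp.prod, Finsupp.prod, Polynomial.prod_comp]
  refine Finset.prod_congr rfl fun n _ => ?_
  rw [mul_comp, pow_comp, hamPoly_comp_neg, C_comp, Pi.neg_apply]

theorem coeff_zero_hamPoly (n : ℕ+) : (hamPoly n).coeff 0 = 0 := by
  rw [hamPoly, coeff_C_mul, betaPoly_coeff_even Even.zero, mul_zero]

/-- The coefficient of `z^i` in `exp (∑ p_n h_n(z))`. -/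
noncomputable def hamQ (i : ℕ) : MvPowerSeries ℕ+ K := fun a => (expPoly hamPoly a).coeff i

theorem coeff_hamQ (i : ℕ) (a : ℕ+ →₀ ℕ) :
    MvPowerSeries.coeff a (hamQ i) = (expPoly hamPoly a).coeff i := rfl

theorem hamQ_zero : hamQ 0 = 1 := by
  classical
  ext a
  rw [coeff_hamQ, MvPowerSeries.coeff_one]
  split_ifs with h
  · rw [h, expPoly_zero, coeff_one_zero]
  · obtain ⟨n, hn⟩ := Finsupp.support_nonempty_iff.mpr h
    rw [coeff_zero_eq_eval_zero, expPoly, Finsupp.prod, eval_prod]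
    refine Finset.prod_eq_zero hn ?_
    rw [eval_mul, eval_pow, ← coeff_zero_eq_eval_zero (hamPoly n), coeff_zero_hamPoly,
      zero_pow (Finsupp.mem_support_iff.mp hn), mul_zero]

/-- `⟨0| e^{H} |v⟩`. -/
noncomputable def vevOf (v : Fock) : MvPowerSeries ℕ+ K := fun d =>
  vacuumExp (MvPowerSeries.coeff d expHam v)

theorem coeff_vevOf (v : Fock) (d : ℕ+ →₀ ℕ) :
    MvPowerSeries.coeff d (vevOf v) = vacuumExp (MvPowerSeries.coeff d expHam v) := rfl

theorem vevSeries_eq (l : StrictPartition) : vevSeries l = vevOf (ket l) := by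
  funext d
  rw [vevSeries, expHamBeta_eq]; rfl

theorem vevOf_vacuum : vevOf vacuum = 1 := by
  classical
  ext d
  rw [coeff_vevOf, expHam_vacuum, MvPowerSeries.coeff_one]
  split_ifs
  · exact vacuumExp_vacuum
  · exact map_zero _

/-- `⟨0| φ_{-s} e^{H} |v⟩`. -/
noncomputable def vevPhi (s : ℕ) (v : Fock) : MvPowerSeries ℕ+ K := fun d =>
  vacuumExp (phi (-(s : ℤ)) (MvPowerSeries.coeff d expHam v))

theorem coeff_vevPhi (s : ℕ) (v : Fock) (d : ℕ+ →₀ ℕ) : MvPowerSeries.coeff d (vevPhi s v) =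
    vacuumExp (phi (-(s : ℤ)) (MvPowerSeries.coeff d expHam v)) := rfl

theorem vevPhi_zero (v : Fock) : vevPhi 0 v = vevOf (rmulPhiZero v) := by
  ext d
  rw [coeff_vevPhi, coeff_vevOf, Nat.cast_zero, neg_zero, vacuumExp_phi_zero, rmulPhiZero_expHam]

theorem expHam_phi_apply (n : ℤ) (v : Fock) (d : ℕ+ →₀ ℕ) :
    MvPowerSeries.coeff d expHam (phi n v) = ∑ p ∈ Finset.HasAntidiagonal.antidiagonal d,
      phiPoly n (expPoly hamPoly p.1) (MvPowerSeries.coeff p.2 expHam v) := by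
  classical
  have h := congrArg (fun f : MvPowerSeries ℕ+ (Module.End K Fock) => MvPowerSeries.coeff d f v)
    (expHam_mul_phi n)
  rw [MvPowerSeries.coeff_mul_C, MvPowerSeries.coeff_mul, LinearMap.sum_apply] at h
  exact h

theorem phi_expHam_apply (n : ℤ) (v : Fock) (d : ℕ+ →₀ ℕ) :
    phi n (MvPowerSeries.coeff d expHam v) = ∑ p ∈ Finset.HasAntidiagonal.antidiagonal d,
      MvPowerSeries.coeff p.1 expHam (phiPoly n (expPoly (-hamPoly) p.2) v) := by
  classical
  have h := congrArg (fun f : MvPowerSeries ℕ+ (Module.End K Fock) => MvPowerSeries.coeff d f v)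
    (phi_mul_expHam n)
  rw [MvPowerSeries.coeff_C_mul, MvPowerSeries.coeff_mul, LinearMap.sum_apply] at h
  exact h

/-- Here `e^H φ_m = ∑_i hamQ_i φ_{m-i} e^H`, and `⟨0|` kills the terms with `m - i > 0`. The others
have `i = m + s`, and `hM` makes their sum finite. -/
theorem vevOf_phi (m : ℕ) (v : Fock) (M : ℕ) (hM : ∀ s, M ≤ s → vevPhi s v = 0) :
    vevOf (phi m v) = ∑ s ∈ Finset.range M, hamQ (m + s) * vevPhi s v := by
  classical
  ext d
  rw [coeff_vevOf, expHam_phi_apply, map_sum, map_sum]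
  simp_rw [MvPowerSeries.coeff_mul]
  rw [Finset.sum_comm]
  refine Finset.sum_congr rfl fun p _ => ?_
  rw [phiPoly_apply, Polynomial.sum_def, LinearMap.sum_apply, map_sum]
  simp_rw [LinearMap.smul_apply, map_smul, smul_eq_mul]
  have hneg : ∀ s : ℕ, vacuumExp (phi ((m : ℤ) - ((m + s : ℕ) : ℤ))
      (MvPowerSeries.coeff p.2 expHam v)) = MvPowerSeries.coeff p.2 (vevPhi s v) := by
    intro s
    rw [coeff_vevPhi]
    congr 3
    push_cast; ring
  have := polySum_eq_sum_range (p := expPoly hamPoly p.1) (n := m + M)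
    (g := fun i => vacuumExp (phi ((m : ℤ) - (i : ℤ)) (MvPowerSeries.coeff p.2 expHam v))) (by
      intro i hi
      obtain ⟨s, rfl⟩ := Nat.exists_eq_add_of_le (le_trans (Nat.le_add_right m M) hi)
      rw [hneg, hM s (by omega), map_zero])
  rw [Polynomial.sum_def] at this
  rw [this, Finset.sum_range_add, Finset.sum_eq_zero, zero_add]
  · refine Finset.sum_congr rfl fun s _ => ?_
    rw [hneg, coeff_hamQ]
  · intro i hi
    rw [vacuumExp_phi_pos, mul_zero]
    rw [Finset.mem_range] at hi
    omega

/-- `φ_{n₁} ⋯ φ_{n_r} |0⟩`. -/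
noncomputable def ketList (l : List ℕ) : Fock := l.foldr (fun n v => phi (n : ℤ) v) vacuum

theorem ketList_nil : ketList [] = vacuum := rfl

theorem ketList_cons (m : ℕ) (l : List ℕ) : ketList (m :: l) = phi m (ketList l) := rfl

theorem ket_eq (l : StrictPartition) : ket l = ketList l.padded := rfl

/-- Moving `φ_{-t}` to the right through `φ_{n₁} ⋯ φ_{n_r} |0⟩`. -/
theorem phi_neg_ketList (t : ℕ) (l : List ℕ) :
    phi (-(t : ℤ)) (ketList l) =
      ∑ j : Fin l.length, ((-1 : K) ^ (j : ℕ) * if l[j] = t then 2 * (-1) ^ t else 0) •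
        ketList (l.eraseIdx j) +
      (if t = 0 then (-1 : K) ^ l.length else 0) • rmulPhiZero (ketList l) := by
  induction l with
  | nil =>
    rw [ketList_nil]
    -- The zero mode does not kill the vacuum. It survives as right multiplication, which is the
    -- source of the extra term.
    by_cases ht : t = 0
    · subst ht
      simp [phi_zero_vacuum]
    · rw [phi_vacuum_neg _ (by omega)]
      simp [ht]
  | cons m l ih =>
    have hz : (-1 : K) ^ (-(t : ℤ)) = (-1) ^ t := by rw [neg_one_zpow_neg, zpow_natCast]
    rw [ketList_cons, phi_anticomm_apply, ih, map_add, map_smul, map_sum, rmulPhiZero_phi, hz]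
    simp only [List.length_cons]
    rw [Fin.sum_univ_succ, sub_add_eq_sub_sub, sub_eq_add_neg, sub_eq_add_neg]
    congr 1
    · congr 1
      · simp only [Fin.val_zero, pow_zero, one_mul, Fin.getElem_fin, List.getElem_cons_zero,
          List.eraseIdx_cons_zero]
        congr 1
        simp only [neg_add_eq_zero, Nat.cast_inj, eq_comm]
      · rw [← Finset.sum_neg_distrib]
        refine Finset.sum_congr rfl fun j _ => ?_
        simp only [Fin.val_succ, Fin.getElem_fin, List.getElem_cons_succ, List.eraseIdx_cons_succ,
          map_smul, ketList_cons]
        rw [← neg_smul, pow_succ]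
        congr 1
        ring
    · rw [← neg_smul, pow_succ]
      congr 1
      split_ifs <;> ring

/-- Only `i = n - t` contributes. Its sign `(-1)^i` from `z ↦ -z` cancels against that of the
anticommutator `2 (-1)^{t+i}`, leaving `2 (-1)^t`. -/
theorem polySum_ite (p : K[X]) (t n : ℕ) (V : K) :
    ∑ i ∈ (p.comp (-X)).support, (p.comp (-X)).coeff i *
      ((if n = t + i then 2 * (-1) ^ (t + i) else 0) * V) =
    (if t ≤ n then 2 * (-1) ^ t else 0) * (V * p.coeff (n - t)) := by
  split_ifs with h
  · obtain ⟨k, rfl⟩ := Nat.exists_eq_add_of_le h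
    rw [Finset.sum_eq_single k, if_pos rfl, coeff_comp_neg, Nat.add_sub_cancel_left, pow_add]
    · have : (-1 : K) ^ k * (-1) ^ k = 1 := by rw [← mul_pow]; simp
      linear_combination (2 * (-1) ^ t * V * p.coeff k) * this
    · intro i _ hi
      rw [if_neg (by omega), zero_mul, mul_zero]
    · intro hk
      rw [notMem_support_iff.mp hk, zero_mul]
  · rw [zero_mul]
    refine Finset.sum_eq_zero fun i _ => ?_
    rw [if_neg (by omega), zero_mul, mul_zero]

/-- Since `φ_{-t} e^H = e^H ∑_i (-1)^i hamQ_i φ_{-t-i}`, each fermion `φ_{l_j}` with `t ≤ l_j` is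
contracted once, by the term `i = l_j - t`. -/
theorem vevPhi_ketList_aux (t : ℕ) (l : List ℕ) : vevPhi t (ketList l) =
    ∑ j : Fin l.length, MvPowerSeries.C ((-1 : K) ^ (j : ℕ) * if t ≤ l[j] then 2 * (-1) ^ t else 0)
      * (vevOf (ketList (l.eraseIdx j)) * hamQ (l[j] - t)) +
    MvPowerSeries.C (if t = 0 then (-1 : K) ^ l.length else 0) *
      (vevOf (rmulPhiZero (ketList l)) * hamQ 0) := by
  classical
  ext d
  rw [coeff_vevPhi, phi_expHam_apply, map_sum, map_add, map_sum]
  simp_rw [MvPowerSeries.coeff_C_mul, MvPowerSeries.coeff_mul, Finset.mul_sum]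
  rw [Finset.sum_comm, ← Finset.sum_add_distrib]
  refine Finset.sum_congr rfl fun p _ => ?_
  rw [expPoly_neg_hamPoly, phiPoly_apply, Polynomial.sum_def, LinearMap.sum_apply, map_sum,
    map_sum]
  have hg : ∀ i : ℕ, vacuumExp (MvPowerSeries.coeff p.1 expHam
      (phi (-(t : ℤ) - (i : ℤ)) (ketList l))) =
      ∑ j : Fin l.length, ((-1 : K) ^ (j : ℕ) * if l[j] = t + i then 2 * (-1) ^ (t + i) else 0) *
        MvPowerSeries.coeff p.1 (vevOf (ketList (l.eraseIdx j))) +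
      (if t + i = 0 then (-1 : K) ^ l.length else 0) *
        MvPowerSeries.coeff p.1 (vevOf (rmulPhiZero (ketList l))) := by
    intro i
    rw [show (-(t : ℤ) - (i : ℤ)) = -((t + i : ℕ) : ℤ) by push_cast; ring, phi_neg_ketList]
    simp only [map_add, map_sum, map_smul, smul_eq_mul, coeff_vevOf]
  simp_rw [LinearMap.smul_apply, map_smul, smul_eq_mul, hg, mul_add, Finset.sum_add_distrib,
    Finset.mul_sum]
  congr 1
  · rw [Finset.sum_comm]
    refine Finset.sum_congr rfl fun j _ => ?_
    rw [mul_assoc, coeff_hamQ, ← polySum_ite, Finset.mul_sum]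
    exact Finset.sum_congr rfl fun i _ => by ring
  · rw [coeff_hamQ]
    by_cases ht : t = 0
    · rw [Finset.sum_eq_single 0, coeff_comp_neg]
      · simp only [ht]
        simp
        ring
      · intro i _ hi
        rw [if_neg (by omega), zero_mul, mul_zero]
      · intro h0
        rw [notMem_support_iff.mp h0, zero_mul]
    · rw [if_neg ht, zero_mul]
      refine Finset.sum_eq_zero fun i _ => ?_
      rw [if_neg (by omega), zero_mul, mul_zero]

/-- `⟨φ_{-t} φ_t⟩`. -/
noncomputable def contraction (t : ℕ) : K := if t = 0 then 1 else 2 * (-1) ^ t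

/-- For `t = 0` and odd length the extra term is minus the left side itself. Hence twice the left
side is the sum with weights `2`, and the contraction of `φ_0` becomes `1`. -/
theorem vevPhi_ketList (t : ℕ) {l : List ℕ} (hl : Odd l.length) : vevPhi t (ketList l) =
    ∑ j : Fin l.length, MvPowerSeries.C ((-1 : K) ^ (j : ℕ) * if t ≤ l[j] then contraction t else 0)
      * (vevOf (ketList (l.eraseIdx j)) * hamQ (l[j] - t)) := by
  have h := vevPhi_ketList_aux t l
  by_cases ht : t = 0
  · subst ht
    rw [← vevPhi_zero, if_pos rfl, hl.neg_one_pow, hamQ_zero, mul_one, map_neg, map_one, neg_one_mul,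
      ← sub_eq_add_neg, eq_sub_iff_add_eq, ← two_mul] at h
    have h2 : (MvPowerSeries.C (2⁻¹ : K) : MvPowerSeries ℕ+ K) * 2 = 1 := by
      rw [show (2 : MvPowerSeries ℕ+ K) = MvPowerSeries.C (2 : K) from (map_ofNat _ 2).symm,
      ← map_mul]
      simp
    rw [← one_mul (vevPhi 0 _), ← h2, mul_assoc, h, Finset.mul_sum]
    refine Finset.sum_congr rfl fun j _ => ?_
    rw [← mul_assoc, ← map_mul]
    congr 2
    simp [contraction]
    ring
  · rw [h, if_neg ht, map_zero, zero_mul, add_zero]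
    simp [contraction, ht]

/-- `⟨0| e^{H} φ_m φ_n |0⟩`. -/
noncomputable def hamQTwo (m n : ℕ) : MvPowerSeries ℕ+ K :=
  hamQ m * hamQ n + 2 * ∑ i ∈ Finset.Icc 1 n, (-1) ^ i * (hamQ (m + i) * hamQ (n - i))

/-- The weight `1` at `t = 0` and the weights `2 (-1)^t` for `t ≥ 1` are those in Schur's formula
for `Q_{(m,n)}`. -/
theorem sum_contraction (m n M : ℕ) (hM : n < M) :
    ∑ t ∈ Finset.range M, MvPowerSeries.C (if t ≤ n then contraction t else 0) *
      (hamQ (m + t) * hamQ (n - t)) = hamQTwo m n := by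
  have h1 : ∑ t ∈ Finset.range M, MvPowerSeries.C (if t ≤ n then contraction t else 0) *
      (hamQ (m + t) * hamQ (n - t)) = ∑ t ∈ Finset.range (n + 1),
      MvPowerSeries.C (contraction t) * (hamQ (m + t) * hamQ (n - t)) := by
    rw [← Finset.sum_subset (Finset.range_subset_range.mpr (Nat.succ_le_of_lt hM))]
    · refine Finset.sum_congr rfl fun t ht => ?_
      rw [if_pos (by rw [Finset.mem_range] at ht; omega)]
    · intro t _ ht
      rw [if_neg (by rw [Finset.mem_range] at ht; omega), map_zero, zero_mul]
  rw [h1, Finset.sum_range_succ', hamQTwo, add_comm, Finset.mul_sum]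
  congr 1
  · simp [contraction]
  · rw [Finset.range_eq_Ico, Finset.sum_Ico_add' (fun t => MvPowerSeries.C (contraction t) *
      (hamQ (m + t) * hamQ (n - t)))]
    refine Finset.sum_congr ?_ fun t ht => ?_
    · ext t; simp
    · rw [Finset.mem_Icc] at ht
      rw [contraction, if_neg (by omega), map_mul, map_pow, map_neg, map_one, mul_assoc,
        map_ofNat]

/-- Expansion of `⟨0| e^{H} φ_m φ_{n₁} ⋯ φ_{n_r} |0⟩` along the first fermion. -/
theorem vevOf_ketList_cons (m : ℕ) {l : List ℕ} (hl : Odd l.length) :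
    vevOf (ketList (m :: l)) =
      ∑ j : Fin l.length, (-1) ^ (j : ℕ) * (hamQTwo m l[j] * vevOf (ketList (l.eraseIdx j))) := by
  -- One bound beyond all parts: for `t ≥ M` no fermion in the list can be contracted with `φ_{-t}`.
  set M := l.foldr max 0 + 1 with hMdef
  have hlt : ∀ j : Fin l.length, l[j] < M := fun j =>
    Nat.lt_succ_of_le (List.le_max_of_le' 0 (List.getElem_mem _) le_rfl)
  rw [ketList_cons, vevOf_phi m _ M]
  · simp_rw [vevPhi_ketList _ hl, Finset.mul_sum]
    rw [Finset.sum_comm]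
    refine Finset.sum_congr rfl fun j _ => ?_
    rw [← sum_contraction m _ M (hlt j), Finset.sum_mul, Finset.mul_sum]
    refine Finset.sum_congr rfl fun t _ => ?_
    rw [map_mul, map_pow, map_neg, map_one]
    ring
  · intro s hs
    rw [vevPhi_ketList _ hl]
    refine Finset.sum_eq_zero fun j _ => ?_
    rw [if_neg (by have := hlt j; omega), mul_zero, map_zero, zero_mul]

/-! ### Möbius substitutions -/

theorem coeff_X_mul_ite (j : ℕ) (f : XSeries) (d : ℕ →₀ ℕ) :
    MvPowerSeries.coeff d (MvPowerSeries.X j * f) =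
      if d j = 0 then 0 else MvPowerSeries.coeff (d - Finsupp.single j 1) f := by
  rw [MvPowerSeries.X, MvPowerSeries.coeff_monomial_mul, one_mul]
  simp only [Finsupp.single_le_iff, Nat.one_le_iff_ne_zero]
  split_ifs with h h' <;> first | rfl | exact absurd h' h

theorem hasSubst_X_mul (g : ℕ → XSeries) :
    MvPowerSeries.HasSubst (fun i => (MvPowerSeries.X i * g i : XSeries)) :=
  hasSubst_of_supported _ g id (fun b => Set.finite_Iic b) fun _ => rfl

theorem subst_C_K {a : ℕ → XSeries} (r : K) :
    MvPowerSeries.subst a (MvPowerSeries.C r : XSeries) = MvPowerSeries.C r :=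
  MvPowerSeries.subst_C r

theorem subst_one_K {a : ℕ → XSeries} : MvPowerSeries.subst a (1 : XSeries) = (1 : XSeries) := by
  have := subst_C_K (a := a) 1
  rwa [map_one] at this

/-- The Möbius transformation `g ↦ g / (1 + c g)`. -/
noncomputable def mob (c : K) (g : XSeries) : XSeries := g * (1 + MvPowerSeries.C c * g)⁻¹

theorem constantCoeff_one_add {c : K} {g : XSeries} (hg : MvPowerSeries.constantCoeff g = 0) :
    MvPowerSeries.constantCoeff (1 + MvPowerSeries.C c * g) = 1 := by
  rw [map_add, map_mul, hg, mul_zero, add_zero, map_one]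

theorem one_add_ne_zero {c : K} {g : XSeries} (hg : MvPowerSeries.constantCoeff g = 0) :
    MvPowerSeries.constantCoeff (1 + MvPowerSeries.C c * g) ≠ 0 := by
  rw [constantCoeff_one_add hg]; exact one_ne_zero

theorem mob_mul {c : K} {g : XSeries} (hg : MvPowerSeries.constantCoeff g = 0) :
    mob c g * (1 + MvPowerSeries.C c * g) = g := by
  rw [mob, mul_assoc, MvPowerSeries.inv_mul_cancel _ (one_add_ne_zero hg), mul_one]

/-- Characterises the Möbius transform by its cleared denominator, so that later identities become
polynomial ones. -/
theorem eq_mob {c : K} {g h : XSeries} (hg : MvPowerSeries.constantCoeff g = 0)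
    (hh : h * (1 + MvPowerSeries.C c * g) = g) : h = mob c g := by
  rw [mob, MvPowerSeries.eq_mul_inv_iff_mul_eq (one_add_ne_zero hg), hh]

theorem constantCoeff_mob {c : K} {g : XSeries} (hg : MvPowerSeries.constantCoeff g = 0) :
    MvPowerSeries.constantCoeff (mob c g) = 0 := by
  rw [mob, map_mul, hg, zero_mul]

theorem mob_zero (c : K) : mob c 0 = 0 := by rw [mob, zero_mul]

theorem zero_mob (g : XSeries) (hg : MvPowerSeries.constantCoeff g = 0) : mob 0 g = g :=
  (eq_mob hg (by rw [map_zero, zero_mul, add_zero, mul_one])).symm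

/-- In the coordinate `1/g` these maps are the translations by `c`, so they form an additive
one-parameter group. For the same reason negation conjugates the map of `c` to that of `-c`. -/
theorem mob_mob {c c' : K} {g : XSeries} (hg : MvPowerSeries.constantCoeff g = 0) :
    mob c (mob c' g) = mob (c + c') g := by
  refine eq_mob hg ?_
  have h1 := mob_mul (c := c') hg
  have h2 := mob_mul (c := c) (constantCoeff_mob (c := c') hg)
  rw [map_add]
  have h3 : (1 + (MvPowerSeries.C c + MvPowerSeries.C c') * g : XSeries) =
      (1 + MvPowerSeries.C c * mob c' g) * (1 + MvPowerSeries.C c' * g) := by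
    linear_combination (-MvPowerSeries.C c) * h1
  rw [h3, ← mul_assoc, h2, h1]

theorem mob_neg (c : K) (g : XSeries) (hg : MvPowerSeries.constantCoeff g = 0) :
    mob c (-g) = -mob (-c) g := by
  symm
  refine eq_mob (by rw [map_neg, hg, neg_zero]) ?_
  have := mob_mul (c := -c) hg
  rw [map_neg] at this
  linear_combination -this

theorem subst_mob {a : ℕ → XSeries} (ha : MvPowerSeries.HasSubst a)
    (ha0 : ∀ i, MvPowerSeries.constantCoeff (a i) = 0) (c : K) {g : XSeries}
    (hg : MvPowerSeries.constantCoeff g = 0) :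
    MvPowerSeries.subst a (mob c g) = mob c (MvPowerSeries.subst a g) := by
  refine eq_mob (MvPowerSeries.constantCoeff_subst_eq_zero ha ha0 hg) ?_
  conv_rhs => rw [← mob_mul (c := c) hg]
  rw [MvPowerSeries.subst_mul ha, MvPowerSeries.subst_add ha, MvPowerSeries.subst_mul ha,
    subst_C_K, subst_one_K]

/-- The substitution `x_i ↦ x_i / (1 + c x_i)`. -/
noncomputable def substMob (c : K) (f : XSeries) : XSeries :=
  MvPowerSeries.subst (fun i : ℕ => mob c (MvPowerSeries.X i)) f

theorem hasSubst_mob (c : K) :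
    MvPowerSeries.HasSubst (fun i : ℕ => mob c (MvPowerSeries.X i : XSeries)) :=
  hasSubst_X_mul fun i => (1 + MvPowerSeries.C c * MvPowerSeries.X i)⁻¹

theorem constantCoeff_mob_X (c : K) (i : ℕ) :
    MvPowerSeries.constantCoeff (mob c (MvPowerSeries.X i : XSeries)) = 0 :=
  constantCoeff_mob (MvPowerSeries.constantCoeff_X i)

theorem substBeta_eq : substBeta = substMob (β / 2) := rfl

theorem substMob_substMob (c c' : K) (f : XSeries) :
    substMob c (substMob c' f) = substMob (c + c') f := by
  rw [substMob, substMob, MvPowerSeries.subst_comp_subst_apply (hasSubst_mob c') (hasSubst_mob c),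
    substMob]
  congr 1
  funext i
  rw [subst_mob (hasSubst_mob c) (constantCoeff_mob_X c) _ (MvPowerSeries.constantCoeff_X i),
    MvPowerSeries.subst_X (hasSubst_mob c), mob_mob (MvPowerSeries.constantCoeff_X i), add_comm]

theorem substMob_zero (f : XSeries) : substMob 0 f = f := by
  have : (fun i : ℕ => mob 0 (MvPowerSeries.X i : XSeries)) = MvPowerSeries.X :=
    funext fun i => zero_mob _ (MvPowerSeries.constantCoeff_X i)
  rw [substMob, this, MvPowerSeries.subst_self]; rfl

theorem substMob_neg_substMob (c : K) (f : XSeries) : substMob (-c) (substMob c f) = f := by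
  rw [substMob_substMob, neg_add_cancel, substMob_zero]

theorem substMob_substMob_neg (c : K) (f : XSeries) : substMob c (substMob (-c) f) = f := by
  rw [substMob_substMob, add_neg_cancel, substMob_zero]

/-! ### Setting a variable to zero -/

/-- The series obtained by setting the variable `j` to zero. -/
noncomputable def killVar (j : ℕ) (f : XSeries) : XSeries := fun d =>
  if d j = 0 then MvPowerSeries.coeff d f else 0

theorem coeff_killVar (j : ℕ) (f : XSeries) (d : ℕ →₀ ℕ) :
    MvPowerSeries.coeff d (killVar j f) = if d j = 0 then MvPowerSeries.coeff d f else 0 := rfl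

/-- The substitution `x_j ↦ 0`. -/
noncomputable def killSubst (j : ℕ) (i : ℕ) : XSeries :=
  MvPowerSeries.X i * (if i = j then 0 else 1)

theorem killSubst_self (j : ℕ) : killSubst j j = 0 := by simp [killSubst]

theorem killSubst_of_ne {i j : ℕ} (h : i ≠ j) : killSubst j i = MvPowerSeries.X i := by
  simp [killSubst, h]

theorem hasSubst_killSubst (j : ℕ) : MvPowerSeries.HasSubst (killSubst j) :=
  hasSubst_X_mul fun i => if i = j then 0 else 1

theorem constantCoeff_killSubst (j i : ℕ) : MvPowerSeries.constantCoeff (killSubst j i) = 0 := by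
  rw [killSubst, map_mul, MvPowerSeries.constantCoeff_X, zero_mul]

theorem killSubst_prod (j : ℕ) (e : ℕ →₀ ℕ) : (e.prod fun s n => killSubst j s ^ n) =
    if e j = 0 then MvPowerSeries.monomial e (1 : K) else 0 := by
  split_ifs with h
  · rw [MvPowerSeries.monomial_one_eq]
    refine Finset.prod_congr rfl fun i hi => ?_
    dsimp only
    rw [killSubst_of_ne]
    rintro rfl
    exact Finsupp.mem_support_iff.mp hi h
  · refine Finset.prod_eq_zero (Finsupp.mem_support_iff.mpr h) ?_
    dsimp only
    rw [killSubst_self, zero_pow h]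

theorem killVar_eq_subst (j : ℕ) (f : XSeries) :
    killVar j f = MvPowerSeries.subst (killSubst j) f := by
  classical
  ext d
  rw [MvPowerSeries.coeff_subst (hasSubst_killSubst j), finsum_eq_single _ d]
  · rw [killSubst_prod, coeff_killVar]
    split_ifs <;> simp
  · intro e he
    rw [killSubst_prod]
    split_ifs
    · rw [MvPowerSeries.coeff_monomial, if_neg he.symm, smul_zero]
    · rw [map_zero, smul_zero]

/-- The Möbius maps fix `0` and act on each variable separately. This moves both the recursion for
`q_n` and independence of the first variable through the substitution. -/
theorem killVar_substMob (j : ℕ) (c : K) (f : XSeries) :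
    killVar j (substMob c f) = substMob c (killVar j f) := by
  rw [killVar_eq_subst, killVar_eq_subst, substMob, substMob,
    MvPowerSeries.subst_comp_subst_apply (hasSubst_mob c) (hasSubst_killSubst j),
    MvPowerSeries.subst_comp_subst_apply (hasSubst_killSubst j) (hasSubst_mob c)]
  congr 1
  funext i
  rw [subst_mob (hasSubst_killSubst j) (constantCoeff_killSubst j) _
    (MvPowerSeries.constantCoeff_X i), MvPowerSeries.subst_X (hasSubst_killSubst j)]
  by_cases hij : i = j
  · subst hij
    rw [killSubst_self, mob_zero, ← MvPowerSeries.coe_substAlgHom (hasSubst_mob c), map_zero]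
  · rw [killSubst_of_ne hij, MvPowerSeries.subst_X (hasSubst_mob c)]

/-! ### The functions `q_n` in the variables `x / (1 + β x / 2)` -/

/-- The coefficient of `x^k` in `(1 + y z) / (1 - y z)` with `y = x / (1 + β x / 2)`. -/
noncomputable def qBetaCoeff (k : ℕ) : K[X] :=
  if k = 0 then 1 else 2 * X * (X - C (β / 2)) ^ (k - 1)

/-- The coefficient of `x^e` in `∏ (1 + y_i z) / (1 - y_i z)` with `y = x / (1 + β x / 2)`. -/
noncomputable def qBetaPoly (e : ℕ →₀ ℕ) : K[X] := e.prod fun _ k => qBetaCoeff k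

/-- The coefficient of `z^i` in `∏ (1 + y_i z) / (1 - y_i z)` with `y = x / (1 + β x / 2)`. -/
noncomputable def schurqBeta (i : ℕ) : XSeries := fun e => (qBetaPoly e).coeff i

theorem coeff_schurqBeta (i : ℕ) (e : ℕ →₀ ℕ) :
    MvPowerSeries.coeff e (schurqBeta i) = (qBetaPoly e).coeff i := rfl

theorem qBetaPoly_eq_mul_erase (e : ℕ →₀ ℕ) (j : ℕ) :
    qBetaPoly e = qBetaCoeff (e j) * qBetaPoly (e.erase j) :=
  (Finsupp.mul_prod_erase' e j (fun _ k => qBetaCoeff k) fun _ => rfl).symm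

theorem erase_sub_single (e : ℕ →₀ ℕ) (j k : ℕ) :
    (e - Finsupp.single j k).erase j = e.erase j := by
  ext i
  by_cases hi : i = j
  · subst hi; simp
  · simp [Finsupp.erase_ne hi, Finsupp.single_eq_of_ne hi]

theorem qBetaPoly_sub_single (e : ℕ →₀ ℕ) (j k : ℕ) :
    qBetaPoly (e - Finsupp.single j k) = qBetaCoeff (e j - k) * qBetaPoly (e.erase j) := by
  rw [qBetaPoly_eq_mul_erase _ j, erase_sub_single]
  simp

/-- With `X` in the role of `z`, the factor of one variable is `1 + 2Xx / (1 - (X - β/2)x)`: its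
coefficients start with `1, 2X` and are then geometric with ratio `X - β/2`. -/
theorem qBetaPoly_step (e : ℕ →₀ ℕ) (j : ℕ) (hj : e j ≠ 0) : qBetaPoly e =
    (if e j = 1 then 2 * X else X - C (β / 2)) * qBetaPoly (e - Finsupp.single j 1) := by
  rw [qBetaPoly_sub_single, qBetaPoly_eq_mul_erase e j, ← mul_assoc]
  congr 1
  split_ifs with h
  · simp [h, qBetaCoeff]
  · obtain ⟨k, hk⟩ := Nat.exists_eq_add_of_le (show 2 ≤ e j by omega)
    rw [hk, qBetaCoeff, qBetaCoeff, if_neg (by omega), if_neg (by omega),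
      show 2 + k - 1 = k + 1 by omega, show k + 1 - 1 = k by omega]
    ring

theorem qBetaPoly_zero : qBetaPoly 0 = 1 := by simp [qBetaPoly]

theorem schurqBeta_zero : schurqBeta 0 = 1 := by
  classical
  ext e
  rw [coeff_schurqBeta, MvPowerSeries.coeff_one]
  split_ifs with h
  · rw [h, qBetaPoly_zero, coeff_one_zero]
  · obtain ⟨j, hj⟩ := Finsupp.support_nonempty_iff.mpr h
    rw [qBetaPoly, Finsupp.prod, coeff_zero_eq_eval_zero, eval_prod]
    refine Finset.prod_eq_zero hj ?_
    rw [qBetaCoeff, if_neg (Finsupp.mem_support_iff.mp hj)]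
    simp

theorem coeff_schurq (n : ℕ) (d : ℕ →₀ ℕ) : MvPowerSeries.coeff d (schurq n) =
    if d.degree = n then 2 ^ d.support.card else 0 := rfl

theorem schurq_zero : schurq 0 = 1 := by
  classical
  ext d
  rw [coeff_schurq, MvPowerSeries.coeff_one]
  simp only [Finsupp.degree_eq_zero_iff]
  split_ifs with h
  · simp [h]
  · rfl

theorem constantCoeff_schurq_succ (n : ℕ) : MvPowerSeries.constantCoeff (schurq (n + 1)) = 0 := by
  rw [← MvPowerSeries.coeff_zero_eq_constantCoeff_apply, coeff_schurq, if_neg (by simp)]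

/-- `(1 - x_j z) q(z) = (1 + x_j z) q(z)|_{x_j = 0}`. -/
theorem schurq_killVar (n j : ℕ) : schurq (n + 1) =
    MvPowerSeries.X j * schurq n + killVar j (schurq (n + 1)) +
      MvPowerSeries.X j * killVar j (schurq n) := by
  ext d
  rw [map_add, map_add, coeff_X_mul_ite, coeff_X_mul_ite, coeff_killVar]
  by_cases h0 : d j = 0
  · simp [h0]
  · have hmem : j ∈ d.support := Finsupp.mem_support_iff.mpr h0
    have hdeg := degree_sub_single_add_one hmem
    rw [if_neg h0, if_neg h0, if_neg h0, add_zero, coeff_killVar, coeff_schurq, coeff_schurq]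
    have hv : (d - Finsupp.single j 1 : ℕ →₀ ℕ) j = d j - 1 := by simp
    rw [hv]
    by_cases h1 : d j = 1
    · have hs : d.support.card = (d - Finsupp.single j 1).support.card + 1 := by
        have : (d - Finsupp.single j 1).support = d.support.erase j := by
          ext i
          by_cases hi : i = j
          · subst hi; simp [h1]
          · simp [hi, Finsupp.single_eq_of_ne hi]
        rw [this, Finset.card_erase_add_one hmem]
      rw [h1, if_pos rfl, hs, ← hdeg]
      simp only [add_left_inj]
      split_ifs
      · ring
      · ring
    · have hs : d.support = (d - Finsupp.single j 1).support := by
        ext i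
        by_cases hi : i = j
        · subst hi; simp; omega
        · simp [Finsupp.single_eq_of_ne hi]
      rw [if_neg (show ¬ (d j - 1 = 0) by omega), ← hs, ← hdeg]
      simp only [add_left_inj, add_zero]

/-- The recursion `schurq_killVar` after the substitution, with the denominator `1 + βx_j/2`
cleared. -/
theorem substBeta_schurq_killVar (n j : ℕ) :
    (1 + MvPowerSeries.C (β / 2) * MvPowerSeries.X j) * substBeta (schurq (n + 1)) =
    MvPowerSeries.X j * substBeta (schurq n) +
      (1 + MvPowerSeries.C (β / 2) * MvPowerSeries.X j) * killVar j (substBeta (schurq (n + 1))) +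
      MvPowerSeries.X j * killVar j (substBeta (schurq n)) := by
  have h := congrArg (substMob (β / 2)) (schurq_killVar n j)
  rw [substMob, substMob, MvPowerSeries.subst_add (hasSubst_mob _),
    MvPowerSeries.subst_add (hasSubst_mob _), MvPowerSeries.subst_mul (hasSubst_mob _),
    MvPowerSeries.subst_mul (hasSubst_mob _), MvPowerSeries.subst_X (hasSubst_mob _)] at h
  rw [substBeta_eq, killVar_substMob, killVar_substMob]
  have hm := mob_mul (c := β / 2) (MvPowerSeries.constantCoeff_X (R := K) j)
  unfold substMob
  linear_combination (1 + MvPowerSeries.C (β / 2) * MvPowerSeries.X j) * h +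
    (MvPowerSeries.subst (fun i : ℕ => mob (β / 2) (MvPowerSeries.X i)) (schurq n) +
      MvPowerSeries.subst (fun i : ℕ => mob (β / 2) (MvPowerSeries.X i)) (killVar j (schurq n))) * hm

/-- Lowering one exponent by `1` reduces both sides by the same recursion, so induction on the
degree of the monomial applies. -/
theorem substBeta_schurq (n : ℕ) : substBeta (schurq n) = schurqBeta n := by
  rcases n with _ | n
  · rw [schurq_zero, schurqBeta_zero, substBeta_eq, substMob, subst_one_K]
  ext e
  induction hk : e.degree generalizing e n with
  | zero =>
    rw [Finsupp.degree_eq_zero_iff] at hk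
    subst hk
    rw [coeff_schurqBeta, qBetaPoly_zero, MvPowerSeries.coeff_zero_eq_constantCoeff_apply,
      substBeta_eq, substMob, MvPowerSeries.constantCoeff_subst_eq_zero (hasSubst_mob _)
      (constantCoeff_mob_X _) (constantCoeff_schurq_succ n), coeff_one, if_neg (by omega)]
  | succ k ih =>
    have he : e ≠ 0 := by rintro rfl; simp at hk
    obtain ⟨j, hj⟩ := Finsupp.support_nonempty_iff.mpr he
    have hj0 := Finsupp.mem_support_iff.mp hj
    have hdeg := degree_sub_single_add_one hj
    have ih' : ∀ n, MvPowerSeries.coeff (e - Finsupp.single j 1) (substBeta (schurq n)) =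
        (qBetaPoly (e - Finsupp.single j 1)).coeff n := by
      intro n
      rcases n with _ | n
      · rw [schurq_zero, substBeta_eq, substMob, subst_one_K, ← schurqBeta_zero, coeff_schurqBeta]
      · exact ih n _ (by omega)
    have h := congrArg (MvPowerSeries.coeff e) (substBeta_schurq_killVar n j)
    simp only [add_mul, one_mul, mul_assoc, map_add, MvPowerSeries.coeff_C_mul, coeff_X_mul_ite,
      if_neg hj0, coeff_killVar, ih'] at h
    rw [eq_sub_of_add_eq h, coeff_schurqBeta, qBetaPoly_step e j hj0]
    have hv : (e - Finsupp.single j 1 : ℕ →₀ ℕ) j = e j - 1 := by simp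
    rw [hv]
    -- The `killVar` terms survive only if the reduced exponent no longer contains `x_j`. They turn
    -- the factor `X - β/2` into `2X`.
    by_cases h1 : e j = 1
    · rw [h1, if_pos rfl, if_pos rfl, if_pos rfl, mul_comm (2 : K[X]), mul_assoc, coeff_X_mul,
        coeff_ofNat_mul]
      ring
    · rw [if_neg (by omega), if_neg (by omega), if_neg h1, sub_mul, coeff_sub, coeff_X_mul,
        coeff_C_mul]
      ring

/-! ### The substitution `p_n ↦ p_n(x)` -/

/-- For `F(x) = (1 + (X + β/2)x) / (1 - (X - β/2)x)`, the logarithmic derivative `x F'/F` is `∑ 2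
P_k x^k`, with `P_k = betaPoly k`. The identity is the coefficient of `x^{m+1}` in `x F' = (x F'/F)
F`. -/
theorem sum_betaPoly_mul_qBetaCoeff (m : ℕ) :
    ∑ k ∈ Finset.range (m + 1), (2 * betaPoly (k + 1)) * qBetaCoeff (m - k) =
      (m + 1 : ℕ) * qBetaCoeff (m + 1) := by
  have hb : ∀ k, 2 * betaPoly k = (X - C (β / 2)) ^ k - (-X - C (β / 2)) ^ k := by
    intro k
    rw [betaPoly, ← mul_assoc, show (2 : K[X]) = C 2 from (map_ofNat _ 2).symm, ← C_mul]
    simp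
  have hsucc : ∀ k, qBetaCoeff (k + 1) = 2 * X * (X - C (β / 2)) ^ k := by
    intro k; simp [qBetaCoeff]
  simp only [hb]
  induction m with
  | zero => simp [qBetaCoeff]; ring
  | succ m ih =>
    rw [Finset.sum_range_succ, Finset.sum_range_succ]
    rw [Finset.sum_range_succ] at ih
    -- Away from its constant term, `qBetaCoeff` is geometric. The terms where it is taken at `0`
    -- are excluded here and treated by hand.
    have h1 : ∑ k ∈ Finset.range m, ((X - C (β / 2)) ^ (k + 1) - (-X - C (β / 2)) ^ (k + 1)) *
        qBetaCoeff (m + 1 - k) = (X - C (β / 2)) *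
        ∑ k ∈ Finset.range m, ((X - C (β / 2)) ^ (k + 1) - (-X - C (β / 2)) ^ (k + 1)) *
        qBetaCoeff (m - k) := by
      rw [Finset.mul_sum]
      refine Finset.sum_congr rfl fun k hk => ?_
      rw [Finset.mem_range] at hk
      obtain ⟨r, hr⟩ := Nat.exists_eq_add_of_lt hk
      rw [show m + 1 - k = (r + 1) + 1 by omega, show m - k = r + 1 by omega, hsucc, hsucc]
      ring
    rw [h1, eq_sub_of_add_eq ih, hsucc, hsucc, show m + 1 - m = 0 + 1 by omega, hsucc,
      Nat.sub_self, Nat.sub_self]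
    simp only [qBetaCoeff, if_true]
    push_cast
    ring

/-- `∑_n n h_n p_n(x)`. -/
noncomputable def eulerForm : MvPowerSeries ℕ K[X] := fun e =>
  if e.support.card = 1 then 2 * betaPoly e.degree else 0

theorem coeff_eulerForm (e : ℕ →₀ ℕ) : MvPowerSeries.coeff e eulerForm =
    if e.support.card = 1 then 2 * betaPoly e.degree else 0 := rfl

theorem coeff_eulerForm_single (j k : ℕ) :
    MvPowerSeries.coeff (Finsupp.single j (k + 1)) eulerForm = 2 * betaPoly (k + 1) := by
  rw [coeff_eulerForm, Finsupp.support_single _ k.succ_ne_zero, Finset.card_singleton, if_pos rfl,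
    Finsupp.degree_single]

/-- The Euler equation of `∏ (1 + y_i z) / (1 - y_i z)`. -/
theorem degree_smul_qBetaPoly (e : ℕ →₀ ℕ) : e.degree • qBetaPoly e =
    ∑ p ∈ Finset.HasAntidiagonal.antidiagonal e,
      MvPowerSeries.coeff p.1 eulerForm * qBetaPoly p.2 := by
  have h1 : e.degree • qBetaPoly e = ∑ j ∈ e.support, ∑ k ∈ Finset.range (e j),
      (2 * betaPoly (k + 1)) * qBetaPoly (e - Finsupp.single j (k + 1)) := by
    rw [Finsupp.degree_apply, Finset.sum_smul]
    refine Finset.sum_congr rfl fun j hj => ?_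
    obtain ⟨m, hm⟩ := Nat.exists_eq_succ_of_ne_zero (Finsupp.mem_support_iff.mp hj)
    simp_rw [qBetaPoly_sub_single, ← mul_assoc]
    rw [← Finset.sum_mul, qBetaPoly_eq_mul_erase e j, hm, Nat.succ_eq_add_one]
    have := sum_betaPoly_mul_qBetaCoeff m
    simp_rw [Nat.add_sub_add_right]
    rw [this, nsmul_eq_mul, mul_assoc]
  rw [h1, Finset.sum_sigma']
  refine Finset.sum_of_injOn
    (fun x => (Finsupp.single x.1 (x.2 + 1), e - Finsupp.single x.1 (x.2 + 1))) ?_ ?_ ?_ ?_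
  · rintro ⟨j, k⟩ _ ⟨j', k'⟩ _ h
    have h := congrArg Prod.fst h
    dsimp only at h
    rcases (Finsupp.single_eq_single_iff _ _ _ _).mp h with ⟨rfl, h2⟩ | ⟨h2, _⟩
    · obtain rfl : k = k' := by omega
      rfl
    · omega
  · rintro ⟨j, k⟩ hjk
    simp only [Finset.mem_coe, Finset.mem_sigma, Finset.mem_range] at hjk
    simp only [Finset.mem_coe, Finset.HasAntidiagonal.mem_antidiagonal]
    refine add_tsub_cancel_of_le ?_
    rw [Finsupp.single_le_iff]
    omega
  · rintro ⟨a, b⟩ hab hn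
    rw [Finset.HasAntidiagonal.mem_antidiagonal] at hab
    rw [coeff_eulerForm, if_neg, zero_mul]
    intro ha
    obtain ⟨j, k, hk, hjk⟩ := Finsupp.card_support_eq_one'.mp ha
    dsimp only at hab hjk
    subst hjk
    obtain ⟨k, rfl⟩ := Nat.exists_eq_succ_of_ne_zero hk
    refine hn ⟨⟨j, k⟩, ?_, ?_⟩
    · simp only [Finset.mem_coe, Finset.mem_sigma, Finset.mem_range, Finsupp.mem_support_iff, ← hab,
        Finsupp.add_apply, Finsupp.single_eq_same]
      omega
    · rw [← hab]
      simp
  · rintro ⟨j, k⟩ _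
    rw [coeff_eulerForm_single]

/-- The degree of `p^a` when `p_n` has degree `n`. -/
noncomputable def psumDegree (a : ℕ+ →₀ ℕ) : ℕ := a.sum fun n k => k * (n : ℕ)

theorem coeff_powerSum (n : ℕ+) (d : ℕ →₀ ℕ) [Decidable (∃ i, d = Finsupp.single i (n : ℕ))] :
    MvPowerSeries.coeff d (powerSum n) = if ∃ i, d = Finsupp.single i (n : ℕ) then 1 else 0 := by
  rw [MvPowerSeries.coeff_apply, powerSum]
  congr

theorem degree_eq_mul_of_pow {f : XSeries} {n : ℕ}
    (hf : ∀ d, MvPowerSeries.coeff d f ≠ 0 → d.degree = n) (k : ℕ) (d : ℕ →₀ ℕ)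
    (hd : MvPowerSeries.coeff d (f ^ k) ≠ 0) : d.degree = k * n := by
  classical
  induction k generalizing d with
  | zero =>
    rw [pow_zero, MvPowerSeries.coeff_one] at hd
    have : d = 0 := by by_contra h; simp [h] at hd
    simp [this]
  | succ k ih =>
    rw [pow_succ, MvPowerSeries.coeff_mul] at hd
    obtain ⟨p, hp, hne⟩ := Finset.exists_ne_zero_of_sum_ne_zero hd
    rw [Finset.HasAntidiagonal.mem_antidiagonal] at hp
    rw [← hp, map_add, ih _ (left_ne_zero_of_mul hne), hf _ (right_ne_zero_of_mul hne)]
    ring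

theorem degree_eq_psumDegree {a : ℕ+ →₀ ℕ} {d : ℕ →₀ ℕ}
    (hd : MvPowerSeries.coeff d (a.prod fun n k => powerSum n ^ k) ≠ 0) :
    d.degree = psumDegree a := by
  classical
  have hp : ∀ (n : ℕ+) (d : ℕ →₀ ℕ), MvPowerSeries.coeff d (powerSum n) ≠ 0 →
      d.degree = n := by
    intro n d h
    rw [coeff_powerSum] at h
    obtain ⟨i, rfl⟩ : ∃ i, d = Finsupp.single i (n : ℕ) := by
      by_contra hc
      rw [if_neg hc] at h
      exact h rfl
    rw [Finsupp.degree_single]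
  rw [Finsupp.prod] at hd
  rw [psumDegree, Finsupp.sum]
  generalize a.support = s at hd ⊢
  induction s using Finset.induction_on generalizing d with
  | empty =>
    rw [Finset.prod_empty, MvPowerSeries.coeff_one] at hd
    have : d = 0 := by by_contra h; simp [h] at hd
    simp [this]
  | insert n s hn ih =>
    rw [Finset.prod_insert hn, MvPowerSeries.coeff_mul] at hd
    obtain ⟨p, hp', hne⟩ := Finset.exists_ne_zero_of_sum_ne_zero hd
    rw [Finset.HasAntidiagonal.mem_antidiagonal] at hp'
    rw [← hp', map_add, ih (right_ne_zero_of_mul hne), Finset.sum_insert hn,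
      degree_eq_mul_of_pow (hp n) _ _ (left_ne_zero_of_mul hne)]

/-- `∑_n n (h_n)_l p_n`. -/
noncomputable def eulerLin (l : ℕ) : MvPowerSeries ℕ+ K :=
  linSeries fun n => (n : K) * (hamPoly n).coeff l

theorem coeff_two_mul_betaPoly (n : ℕ+) (l : ℕ) :
    (n : K) * (hamPoly n).coeff l = (2 * betaPoly n).coeff l := by
  have hn : ((n : ℕ) : K) ≠ 0 := Nat.cast_ne_zero.mpr n.ne_zero
  rw [hamPoly, coeff_C_mul, coeff_ofNat_mul, ← mul_assoc, mul_div_cancel₀ _ hn]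

/-- The weighted Euler equation of `exp (∑ h_n p_n)`. -/
theorem psumDegree_mul_coeff_hamQ (i : ℕ) (a : ℕ+ →₀ ℕ) :
    (psumDegree a : K) * MvPowerSeries.coeff a (hamQ i) = MvPowerSeries.coeff a
      (∑ p ∈ Finset.HasAntidiagonal.antidiagonal i, eulerLin p.1 * hamQ p.2) := by
  rw [map_sum]
  simp_rw [eulerLin, coeff_linSeries_mul]
  rw [Finset.sum_comm, psumDegree, Finsupp.sum, Nat.cast_sum, Finset.sum_mul]
  refine Finset.sum_congr rfl fun n hn => ?_
  simp_rw [mul_assoc, coeff_hamQ]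
  rw [← Finset.mul_sum, ← coeff_mul, ← smul_expPoly _ _ hn, coeff_smul, nsmul_eq_mul,
    Nat.cast_mul]
  ring

/-- As `p^a(x)` is homogeneous of degree `∑ n a_n`, the Euler operator in the `x_i` corresponds to
the Euler operator in the `p_n` weighted by `n`. -/
theorem degree_mul_coeff_subst_powerSum {f g : MvPowerSeries ℕ+ K}
    (h : ∀ a, (psumDegree a : K) * MvPowerSeries.coeff a f = MvPowerSeries.coeff a g)
    (e : ℕ →₀ ℕ) : (e.degree : K) * MvPowerSeries.coeff e (MvPowerSeries.subst powerSum f) =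
      MvPowerSeries.coeff e (MvPowerSeries.subst powerSum g) := by
  rw [MvPowerSeries.coeff_subst hasSubst_powerSum, MvPowerSeries.coeff_subst hasSubst_powerSum,
    ← smul_eq_mul, smul_finsum]
  refine finsum_congr fun a => ?_
  by_cases ha : MvPowerSeries.coeff e (a.prod fun n k => powerSum n ^ k) = 0
  · rw [ha, smul_zero, smul_zero, smul_zero]
  · rw [degree_eq_psumDegree ha, ← h, smul_eq_mul, smul_eq_mul, smul_eq_mul, mul_assoc]

theorem prod_powerSum_single (n : ℕ+) :
    ((Finsupp.single n 1).prod fun (n : ℕ+) (k : ℕ) => powerSum n ^ k) = powerSum n := by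
  rw [Finsupp.prod_single_index (h := fun (n : ℕ+) (k : ℕ) => powerSum n ^ k) (pow_zero _),
    pow_one]

theorem coeff_subst_eulerLin (l : ℕ) (e : ℕ →₀ ℕ) :
    MvPowerSeries.coeff e (MvPowerSeries.subst powerSum (eulerLin l)) =
      (MvPowerSeries.coeff e eulerForm).coeff l := by
  classical
  have hlin : ∀ a : ℕ+ →₀ ℕ, MvPowerSeries.coeff a (eulerLin l) •
      MvPowerSeries.coeff e (a.prod fun n k => powerSum n ^ k) ≠ 0 →
      ∃ (n : ℕ+) (i : ℕ), a = Finsupp.single n 1 ∧ e = Finsupp.single i (n : ℕ) := by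
    intro a ha
    have h1 := left_ne_zero_of_smul ha
    have h2 := right_ne_zero_of_smul ha
    have hdeg : a.degree = 1 := by
      by_contra hc
      exact h1 (by rw [eulerLin, coeff_linSeries, if_neg hc])
    obtain ⟨n, rfl⟩ := exists_eq_single_of_degree_eq_one hdeg
    rw [prod_powerSum_single, coeff_powerSum] at h2
    by_contra hc
    rw [if_neg (fun ⟨i, hi⟩ => hc ⟨n, i, rfl, hi⟩)] at h2
    exact h2 rfl
  rw [MvPowerSeries.coeff_subst hasSubst_powerSum, coeff_eulerForm]
  split_ifs with hc
  · obtain ⟨i, k, hk, rfl⟩ := Finsupp.card_support_eq_one'.mp hc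
    obtain ⟨k, rfl⟩ : ∃ k' : ℕ+, (k' : ℕ) = k := ⟨⟨k, Nat.pos_of_ne_zero hk⟩, rfl⟩
    rw [finsum_eq_single _ (Finsupp.single k 1)]
    · rw [prod_powerSum_single, coeff_powerSum, if_pos ⟨i, rfl⟩,
        eulerLin, coeff_linSeries_single, coeff_two_mul_betaPoly, Finsupp.degree_single,
        smul_eq_mul, mul_one]
    · intro a ha
      by_contra hne
      obtain ⟨n, j, rfl, hj⟩ := hlin a hne
      apply ha
      rcases (Finsupp.single_eq_single_iff _ _ _ _).mp hj with ⟨_, h2⟩ | ⟨h2, _⟩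
      · congr 1
        exact PNat.coe_injective h2.symm
      · exact absurd h2 hk
  · rw [coeff_zero]
    refine finsum_eq_zero_of_forall_eq_zero fun a => ?_
    by_contra hne
    obtain ⟨n, j, _, rfl⟩ := hlin a hne
    exact hc (by rw [Finsupp.support_single _ n.ne_zero, Finset.card_singleton])

theorem coeff_zero_subst_powerSum (f : MvPowerSeries ℕ+ K) :
    MvPowerSeries.coeff 0 (MvPowerSeries.subst powerSum f) = MvPowerSeries.coeff 0 f := by
  rw [MvPowerSeries.coeff_subst hasSubst_powerSum, finsum_eq_single _ 0]
  · simp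
  · intro a ha
    by_contra hne
    have h := degree_eq_psumDegree (right_ne_zero_of_smul hne)
    rw [map_zero, psumDegree, Finsupp.sum, eq_comm, Finset.sum_eq_zero_iff] at h
    apply ha
    ext n
    by_contra hn
    have := h n (Finsupp.mem_support_iff.mpr hn)
    rcases Nat.mul_eq_zero.mp this with h0 | h0
    · exact hn h0
    · exact n.ne_zero h0

/-- Both generating functions have constant term `1` and logarithmic Euler derivative `eulerForm`.
The latter has no constant term, so the equation determines each coefficient from those of lower
degree. -/
theorem subst_powerSum_hamQ (i : ℕ) :
    MvPowerSeries.subst powerSum (hamQ i) = schurqBeta i := by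
  classical
  ext e
  induction hk : e.degree using Nat.strong_induction_on generalizing e i with
  | _ k ih =>
    rcases Nat.eq_zero_or_pos k with hk0 | hk0
    · rw [hk0, Finsupp.degree_eq_zero_iff] at hk
      rw [hk, coeff_zero_subst_powerSum, coeff_hamQ, coeff_schurqBeta, expPoly_zero,
        qBetaPoly_zero]
    · have hne : ((k : ℕ) : K) ≠ 0 := Nat.cast_ne_zero.mpr hk0.ne'
      apply mul_left_cancel₀ hne
      have h1 := degree_mul_coeff_subst_powerSum (psumDegree_mul_coeff_hamQ i) e
      have h2 := congrArg (fun p : K[X] => p.coeff i) (degree_smul_qBetaPoly e)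
      rw [coeff_smul, nsmul_eq_mul, finsetSum_coeff] at h2
      rw [hk] at h1 h2
      rw [h1, coeff_schurqBeta, h2, ← MvPowerSeries.coe_substAlgHom hasSubst_powerSum, map_sum,
        map_sum]
      simp_rw [map_mul, MvPowerSeries.coe_substAlgHom hasSubst_powerSum, MvPowerSeries.coeff_mul,
        coeff_mul, coeff_subst_eulerLin]
      rw [Finset.sum_comm]
      refine Finset.sum_congr rfl fun p hp => ?_
      rw [Finset.HasAntidiagonal.mem_antidiagonal] at hp
      by_cases hp0 : p.1 = 0
      · rw [hp0, coeff_eulerForm, if_neg (by simp)]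
        simp
      · refine Finset.sum_congr rfl fun q _ => ?_
        have hd := congrArg Finsupp.degree hp
        rw [map_add, hk] at hd
        have : p.1.degree ≠ 0 := fun h => hp0 ((Finsupp.degree_eq_zero_iff _).mp h)
        rw [ih p.2.degree (by omega) q.2 p.2 rfl, coeff_schurqBeta]

theorem subst_powerSum_hamQ_eq (i : ℕ) :
    MvPowerSeries.subst powerSum (hamQ i) = substBeta (schurq i) := by
  rw [subst_powerSum_hamQ, substBeta_schurq]

/-! ### `Q_λ(x / (1 + β x / 2)) = ⟨0| e^{H^{(β)}} |λ⟩` -/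

/-- The substitution `p_n ↦ p_n(x)` as an algebra homomorphism. -/
noncomputable def psumHom : MvPowerSeries ℕ+ K →ₐ[K] XSeries :=
  MvPowerSeries.substAlgHom hasSubst_powerSum

theorem psumHom_apply (f : MvPowerSeries ℕ+ K) :
    psumHom f = MvPowerSeries.subst powerSum f := MvPowerSeries.substAlgHom_apply _ f

/-- The substitution `x_i ↦ x_i / (1 + c x_i)` as an algebra homomorphism. -/
noncomputable def mobHom (c : K) : XSeries →ₐ[K] XSeries :=
  MvPowerSeries.substAlgHom (hasSubst_mob c)

theorem mobHom_apply (c : K) (f : XSeries) : mobHom c f = substMob c f :=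
  MvPowerSeries.substAlgHom_apply _ f

theorem mobHom_schurQTwo (m n : ℕ) : mobHom (β / 2) (schurQTwo m n) = psumHom (hamQTwo m n) := by
  have h : ∀ i, mobHom (β / 2) (schurq i) = psumHom (hamQ i) := fun i => by
    rw [mobHom_apply, psumHom_apply, subst_powerSum_hamQ_eq, substBeta_eq]
  simp only [schurQTwo, hamQTwo, map_add, map_mul, map_sum, map_pow, map_neg, map_one, map_ofNat, h]

/-- The Pfaffian and the vacuum expectation value obey the same expansion along the first entry.
Even length makes the tail odd, as Wick's expansion requires. -/
theorem mobHom_pfaffian : ∀ (l : List ℕ), Even l.length →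
    mobHom (β / 2) (pfaffian schurQTwo l) = psumHom (vevOf (ketList l))
  | [], _ => by rw [pfaffian, ketList_nil, vevOf_vacuum, map_one, map_one]
  | m :: l, h => by
    have hl : Odd l.length := by
      rw [List.length_cons, Nat.even_add_one, Nat.not_even_iff_odd] at h
      exact h
    rw [pfaffian, vevOf_ketList_cons m hl, map_sum, map_sum]
    refine Finset.sum_congr rfl fun j _ => ?_
    have hlen := List.length_eraseIdx_of_lt j.2
    have hev : Even (l.eraseIdx j).length := by
      rw [hlen]
      exact Nat.Odd.sub_odd hl odd_one
    simp only [map_mul, map_pow, map_neg, map_one, mobHom_schurQTwo,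
      mobHom_pfaffian (l.eraseIdx j) hev]
termination_by l => l.length
decreasing_by
  have := List.length_eraseIdx_of_lt j.2
  simp only [List.length_cons]
  omega

theorem even_length_padded (l : StrictPartition) : Even l.padded.length := by
  rw [StrictPartition.padded]
  split_ifs with h
  · exact h
  · rw [List.length_append, List.length_singleton, Nat.even_add_one]
    exact h

theorem substBeta_schurQ (l : StrictPartition) : substBeta (schurQ l) = vev l := by
  rw [vev, vevSeries_eq, ket_eq, ← psumHom_apply, ← mobHom_pfaffian _ (even_length_padded l),
    mobHom_apply, substBeta_eq, schurQ]

end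

/-! ### Symmetric series -/

theorem coeff_mapDomain_rename (σ : Equiv.Perm ℕ) (f : XSeries) (d : ℕ →₀ ℕ) :
    MvPowerSeries.coeff (d.mapDomain σ) (MvPowerSeries.rename σ f) = MvPowerSeries.coeff d f := by
  have h := MvPowerSeries.coeff_embDomain_rename σ.toEmbedding f d
  rw [Finsupp.embDomain_eq_mapDomain] at h
  exact h

theorem mapDomain_mapDomain_symm (σ : Equiv.Perm ℕ) (d : ℕ →₀ ℕ) :
    (d.mapDomain σ.symm).mapDomain σ = d := by
  rw [← Finsupp.mapDomain_comp, Equiv.self_comp_symm, Finsupp.mapDomain_id]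

theorem isSymm_iff (f : XSeries) :
    IsSymm f ↔ ∀ σ : Equiv.Perm ℕ, MvPowerSeries.rename σ f = f := by
  constructor
  · intro h σ
    ext d
    conv_lhs => rw [← mapDomain_mapDomain_symm σ d, coeff_mapDomain_rename]
    rw [← h σ, mapDomain_mapDomain_symm]
  · intro h σ d
    conv_lhs => rw [← h σ, coeff_mapDomain_rename]

theorem hasSubst_X_comp (σ : Equiv.Perm ℕ) :
    MvPowerSeries.HasSubst (MvPowerSeries.X ∘ σ : ℕ → XSeries) :=
  MvPowerSeries.HasSubst.X_comp σ

theorem rename_substMob (σ : Equiv.Perm ℕ) (c : K) (f : XSeries) :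
    MvPowerSeries.rename σ (substMob c f) = substMob c (MvPowerSeries.rename σ f) := by
  rw [MvPowerSeries.rename_eq_subst, MvPowerSeries.rename_eq_subst, substMob, substMob,
    MvPowerSeries.subst_comp_subst_apply (hasSubst_mob c) (hasSubst_X_comp σ),
    MvPowerSeries.subst_comp_subst_apply (hasSubst_X_comp σ) (hasSubst_mob c)]
  congr 1
  funext i
  rw [subst_mob (hasSubst_X_comp σ) (fun i => MvPowerSeries.constantCoeff_X _) _
    (MvPowerSeries.constantCoeff_X i), MvPowerSeries.subst_X (hasSubst_X_comp σ),
    Function.comp_apply, MvPowerSeries.subst_X (hasSubst_mob c)]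

theorem substMob_injective (c : K) : Function.Injective (substMob c) :=
  Function.LeftInverse.injective (substMob_neg_substMob c)

theorem isSymm_substMob (c : K) (f : XSeries) : IsSymm (substMob c f) ↔ IsSymm f := by
  rw [isSymm_iff, isSymm_iff]
  refine forall_congr' fun σ => ?_
  rw [rename_substMob, (substMob_injective c).eq_iff]

/-! ### The cancellation property -/

theorem indepFirst_iff (f : XSeries) : IndepFirst f ↔ killVar 0 f = f := by
  constructor
  · intro h
    ext d
    rw [coeff_killVar]
    split_ifs with hd
    · rfl
    · rw [h d hd]
  · intro h d hd
    rw [← h, coeff_killVar, if_neg hd]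

theorem indepFirst_substMob (c : K) (f : XSeries) : IndepFirst (substMob c f) ↔ IndepFirst f := by
  rw [indepFirst_iff, indepFirst_iff, killVar_substMob, (substMob_injective c).eq_iff]

/-- The substitution `x_1 ↦ t`, `x_2 ↦ -t / (1 - c t)`. -/
noncomputable def twoVar (c : K) (i : ℕ) : XSeries :=
  if i = 0 then MvPowerSeries.X 0 else if i = 1 then mob c (-MvPowerSeries.X 0)
    else MvPowerSeries.X i

theorem hasSubst_twoVar (c : K) : MvPowerSeries.HasSubst (twoVar c) := by
  have h := hasSubst_substTwo (-(1 + MvPowerSeries.C c * -MvPowerSeries.X 0)⁻¹)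
  have e : (MvPowerSeries.X 0 * -(1 + MvPowerSeries.C c * -MvPowerSeries.X 0)⁻¹ : XSeries) =
      mob c (-MvPowerSeries.X 0) := by rw [mob, mul_neg, neg_mul]
  rw [e] at h
  exact h

theorem constantCoeff_neg_X (i : ℕ) :
    MvPowerSeries.constantCoeff (-MvPowerSeries.X i : XSeries) = 0 := by
  rw [map_neg, MvPowerSeries.constantCoeff_X, neg_zero]

theorem constantCoeff_twoVar (c : K) (i : ℕ) :
    MvPowerSeries.constantCoeff (twoVar c i) = 0 := by
  rw [twoVar]
  split_ifs
  · exact MvPowerSeries.constantCoeff_X _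
  · exact constantCoeff_mob (constantCoeff_neg_X 0)
  · exact MvPowerSeries.constantCoeff_X _

/-- On the second variable both sides give the Möbius transform of `-t` with parameter `b + c`:
commuting with negation turns `b` into `-b`, which accounts for the shift by `2b`. For `b = β/2` it
carries `c = -β` to `0`. -/
theorem subst_twoVar_substMob (b c : K) (f : XSeries) :
    MvPowerSeries.subst (twoVar c) (substMob b f) =
      substMob b (MvPowerSeries.subst (twoVar (c + 2 * b)) f) := by
  rw [substMob, substMob,
    MvPowerSeries.subst_comp_subst_apply (hasSubst_mob b) (hasSubst_twoVar c),
    MvPowerSeries.subst_comp_subst_apply (hasSubst_twoVar _) (hasSubst_mob b)]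
  congr 1
  funext i
  rw [subst_mob (hasSubst_twoVar c) (constantCoeff_twoVar c) _
    (MvPowerSeries.constantCoeff_X i), MvPowerSeries.subst_X (hasSubst_twoVar c), twoVar, twoVar]
  split_ifs with h0 h1
  · rw [MvPowerSeries.subst_X (hasSubst_mob b)]
  · rw [mob_mob (constantCoeff_neg_X 0), subst_mob (hasSubst_mob b) (constantCoeff_mob_X b) _
      (constantCoeff_neg_X 0), ← MvPowerSeries.coe_substAlgHom (hasSubst_mob b), map_neg,
      MvPowerSeries.coe_substAlgHom, MvPowerSeries.subst_X (hasSubst_mob b),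
      ← neg_neg b, ← mob_neg _ _ (MvPowerSeries.constantCoeff_X 0),
      mob_mob (constantCoeff_neg_X 0)]
    congr 1
    ring
  · rw [MvPowerSeries.subst_X (hasSubst_mob b)]

/-- The symmetric series `f` such that `f(t, -t / (1 - c t), x₃, …)` does not depend on `t`. -/
noncomputable def cancelAlg (c : K) : Subalgebra K XSeries :=
  (⨅ σ : Equiv.Perm ℕ, AlgHom.equalizer (MvPowerSeries.rename σ) (AlgHom.id K XSeries)) ⊓
    AlgHom.equalizer ((MvPowerSeries.substAlgHom (hasSubst_killSubst 0)).comp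
      (MvPowerSeries.substAlgHom (hasSubst_twoVar c)))
      (MvPowerSeries.substAlgHom (hasSubst_twoVar c))

theorem mem_cancelAlg {c : K} {f : XSeries} :
    f ∈ cancelAlg c ↔ IsSymm f ∧ IndepFirst (MvPowerSeries.subst (twoVar c) f) := by
  rw [isSymm_iff, indepFirst_iff, cancelAlg, Algebra.mem_inf, Algebra.mem_iInf,
    AlgHom.mem_equalizer, AlgHom.comp_apply, MvPowerSeries.substAlgHom_apply,
    MvPowerSeries.substAlgHom_apply, killVar_eq_subst]
  rfl

theorem substMob_mem_cancelAlg {b c : K} {f : XSeries} :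
    substMob b f ∈ cancelAlg c ↔ f ∈ cancelAlg (c + 2 * b) := by
  rw [mem_cancelAlg, mem_cancelAlg, isSymm_substMob, subst_twoVar_substMob, indepFirst_substMob]

theorem mem_cancelAlg_zero {f : XSeries} : f ∈ cancelAlg 0 ↔ IsSymm f ∧ QCancel f := by
  rw [mem_cancelAlg, QCancel, substTwo]
  unfold twoVar
  rw [zero_mob _ (constantCoeff_neg_X 0)]

theorem mem_cancelAlg_neg_beta {f : XSeries} : f ∈ cancelAlg (-β) ↔ IsSymm f ∧ KQCancel f := by
  rw [mem_cancelAlg, KQCancel, substTwo]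
  unfold twoVar mob
  rw [map_neg, neg_mul_neg]

/-- Symmetry and cancellation are equalizer conditions for algebra homomorphisms, so the generating
set is already a subalgebra and its span is no larger. The same applies to `GGamma`. -/
theorem toSubmodule_cancelAlg_zero : Subalgebra.toSubmodule (cancelAlg 0) = GammaHat := by
  have : {f | IsSymm f ∧ QCancel f} = (Subalgebra.toSubmodule (cancelAlg 0) : Set XSeries) := by
    ext f
    exact mem_cancelAlg_zero.symm
  rw [GammaHat, this, Submodule.span_eq]

theorem GGamma_eq : GGamma = cancelAlg (-β) := by
  have : {f | IsSymm f ∧ KQCancel f} = (cancelAlg (-β) : Set XSeries) := by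
    ext f
    exact mem_cancelAlg_neg_beta.symm
  rw [GGamma, this, Algebra.adjoin_eq]

theorem substBeta_mem_GGamma {f : XSeries} : substBeta f ∈ GGamma ↔ f ∈ cancelAlg 0 := by
  rw [GGamma_eq, substBeta_eq, substMob_mem_cancelAlg]
  congr! 2
  ring

/-! ### Cancellation in terms of coefficients -/

/-- The part of an exponent involving only `x₃, x₄, …`. -/
noncomputable def restTwo (d : ℕ →₀ ℕ) : ℕ →₀ ℕ := (d.erase 0).erase 1

/-- The exponent `x₁^i x₂^j x^e`. -/
noncomputable def addTwo (e : ℕ →₀ ℕ) (p : ℕ × ℕ) : ℕ →₀ ℕ :=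
  e + (Finsupp.single 0 p.1 + Finsupp.single 1 p.2)

theorem restTwo_zero (d : ℕ →₀ ℕ) : restTwo d 0 = 0 := by simp [restTwo]

theorem restTwo_one (d : ℕ →₀ ℕ) : restTwo d 1 = 0 := by simp [restTwo]

theorem restTwo_of_two_le (d : ℕ →₀ ℕ) {i : ℕ} (hi : 2 ≤ i) : restTwo d i = d i := by
  rw [restTwo, Finsupp.erase_ne (by omega), Finsupp.erase_ne (by omega)]

theorem addTwo_apply_zero {e : ℕ →₀ ℕ} (h0 : e 0 = 0) (p : ℕ × ℕ) : addTwo e p 0 = p.1 := by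
  simp [addTwo, h0]

theorem addTwo_apply_one {e : ℕ →₀ ℕ} (h1 : e 1 = 0) (p : ℕ × ℕ) : addTwo e p 1 = p.2 := by
  simp [addTwo, h1]

theorem addTwo_of_two_le (e : ℕ →₀ ℕ) (p : ℕ × ℕ) {i : ℕ} (hi : 2 ≤ i) :
    addTwo e p i = e i := by
  simp [addTwo, Finsupp.single_eq_of_ne (show i ≠ 0 by omega),
    Finsupp.single_eq_of_ne (show i ≠ 1 by omega)]

theorem addTwo_restTwo (d : ℕ →₀ ℕ) : addTwo (restTwo d) (d 0, d 1) = d := by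
  ext i
  rcases i with _ | _ | i
  · rw [addTwo_apply_zero (restTwo_zero d)]
  · rw [addTwo_apply_one (restTwo_one d)]
  · rw [addTwo_of_two_le _ _ (by omega), restTwo_of_two_le _ (by omega)]

theorem restTwo_addTwo {e : ℕ →₀ ℕ} (h0 : e 0 = 0) (h1 : e 1 = 0) (p : ℕ × ℕ) :
    restTwo (addTwo e p) = e := by
  ext i
  rcases i with _ | _ | i
  · rw [restTwo_zero, h0]
  · rw [restTwo_one, h1]
  · rw [restTwo_of_two_le _ (by omega), addTwo_of_two_le _ _ (by omega)]

theorem twoVar_prod (d : ℕ →₀ ℕ) : (d.prod fun s n => twoVar 0 s ^ n) =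
    (-1) ^ d 1 * MvPowerSeries.monomial (addTwo (restTwo d) (d 0 + d 1, 0)) (1 : K) := by
  have h := Finsupp.mul_prod_erase' d 0 (fun s n => twoVar 0 s ^ n) fun _ => pow_zero _
  have h' := Finsupp.mul_prod_erase' (d.erase 0) 1 (fun s n => twoVar 0 s ^ n) fun _ => pow_zero _
  rw [← h, ← h', Finsupp.erase_ne one_ne_zero, ← restTwo]
  have h0 : twoVar 0 0 = MvPowerSeries.X 0 := by simp [twoVar]
  have h1 : twoVar 0 1 = -MvPowerSeries.X 0 := by
    simp [twoVar, zero_mob _ (constantCoeff_neg_X 0)]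
  have hr : ((restTwo d).prod fun s n => twoVar 0 s ^ n) =
      MvPowerSeries.monomial (restTwo d) (1 : K) := by
    rw [MvPowerSeries.monomial_one_eq]
    refine Finset.prod_congr rfl fun i hi => ?_
    dsimp only
    rw [Finsupp.mem_support_iff] at hi
    have hi0 : i ≠ 0 := by rintro rfl; exact hi (restTwo_zero d)
    have hi1 : i ≠ 1 := by rintro rfl; exact hi (restTwo_one d)
    rw [twoVar, if_neg hi0, if_neg hi1]
  rw [hr, h0, h1, neg_pow, addTwo, Finsupp.single_zero, add_zero,
    ← one_mul (1 : K), ← MvPowerSeries.monomial_mul_monomial, ← MvPowerSeries.X_pow_eq, one_mul,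
    pow_add]
  ring

/-- Precisely the monomials `x₁^i x₂^j x^e` with `i + j = m` collapse to `t^m x^e`, with sign
`(-1)^j`. -/
theorem coeff_subst_twoVar {e : ℕ →₀ ℕ} (h0 : e 0 = 0) (h1 : e 1 = 0) (m : ℕ) (f : XSeries) :
    MvPowerSeries.coeff (addTwo e (m, 0)) (MvPowerSeries.subst (twoVar 0) f) =
      ∑ p ∈ Finset.HasAntidiagonal.antidiagonal m,
        (-1) ^ p.2 * MvPowerSeries.coeff (addTwo e p) f := by
  classical
  have hterm : ∀ d : ℕ →₀ ℕ, MvPowerSeries.coeff (addTwo e (m, 0))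
      (d.prod fun s n => twoVar 0 s ^ n) = if restTwo d = e ∧ d 0 + d 1 = m then (-1) ^ d 1
        else 0 := by
    intro d
    rw [twoVar_prod]
    have hC : ((-1) ^ d 1 : XSeries) = MvPowerSeries.C ((-1) ^ d 1) := by simp
    rw [hC, MvPowerSeries.coeff_C_mul, MvPowerSeries.coeff_monomial]
    have hiff : addTwo e (m, 0) = addTwo (restTwo d) (d 0 + d 1, 0) ↔
        restTwo d = e ∧ d 0 + d 1 = m := by
      constructor
      · intro h
        constructor
        · have := congrArg restTwo h
          rw [restTwo_addTwo h0 h1, restTwo_addTwo (restTwo_zero d) (restTwo_one d)] at this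
          exact this.symm
        · have := DFunLike.congr_fun h 0
          rw [addTwo_apply_zero h0, addTwo_apply_zero (restTwo_zero d)] at this
          exact this.symm
      · rintro ⟨h, h'⟩
        rw [h, h']
    rw [if_congr hiff rfl rfl]
    split_ifs <;> simp
  have hinj : Set.InjOn (addTwo e) (Finset.HasAntidiagonal.antidiagonal m : Finset (ℕ × ℕ)) := by
    intro p _ q _ h
    have hp := DFunLike.congr_fun h 0
    have hq := DFunLike.congr_fun h 1
    rw [addTwo_apply_zero h0, addTwo_apply_zero h0] at hp
    rw [addTwo_apply_one h1, addTwo_apply_one h1] at hq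
    exact Prod.ext hp hq
  rw [MvPowerSeries.coeff_subst (hasSubst_twoVar 0),
    finsum_eq_sum_of_support_subset (s := (Finset.HasAntidiagonal.antidiagonal m).image (addTwo e)),
    Finset.sum_image hinj]
  · refine Finset.sum_congr rfl fun p hp => ?_
    rw [hterm, restTwo_addTwo h0 h1, addTwo_apply_zero h0, addTwo_apply_one h1, if_pos ⟨rfl, by
      rwa [Finset.HasAntidiagonal.mem_antidiagonal] at hp⟩, smul_eq_mul, mul_comm]
  · intro d hd
    rw [Function.mem_support, hterm] at hd
    have hc : restTwo d = e ∧ d 0 + d 1 = m := by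
      by_contra hc
      rw [if_neg hc, smul_zero] at hd
      exact hd rfl
    rw [Finset.coe_image]
    refine ⟨(d 0, d 1), ?_, ?_⟩
    · rw [Finset.mem_coe, Finset.HasAntidiagonal.mem_antidiagonal]
      exact hc.2
    · rw [← hc.1, addTwo_restTwo]

theorem coeff_subst_twoVar_of_one_ne_zero {d : ℕ →₀ ℕ} (h : d 1 ≠ 0) (f : XSeries) :
    MvPowerSeries.coeff d (MvPowerSeries.subst (twoVar 0) f) = 0 := by
  classical
  rw [MvPowerSeries.coeff_subst (hasSubst_twoVar 0)]
  refine finsum_eq_zero_of_forall_eq_zero fun a => ?_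
  have hC : ((-1) ^ a 1 : XSeries) = MvPowerSeries.C ((-1) ^ a 1) := by simp
  rw [twoVar_prod, hC, MvPowerSeries.coeff_C_mul, MvPowerSeries.coeff_monomial, if_neg, mul_zero,
    smul_zero]
  rintro rfl
  exact h (addTwo_apply_one (restTwo_one a) _)

/-- Turns cancellation into linear equations, each in finitely many coefficients. They show that the
condition is closed and allow coefficients to be eliminated. -/
theorem indepFirst_subst_twoVar_iff (f : XSeries) :
    IndepFirst (MvPowerSeries.subst (twoVar 0) f) ↔
      ∀ e : ℕ →₀ ℕ, e 0 = 0 → e 1 = 0 → ∀ m : ℕ, m ≠ 0 →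
        ∑ p ∈ Finset.HasAntidiagonal.antidiagonal m,
          (-1) ^ p.2 * MvPowerSeries.coeff (addTwo e p) f = 0 := by
  constructor
  · intro h e h0 h1 m hm
    rw [← coeff_subst_twoVar h0 h1]
    exact h _ (by rwa [addTwo_apply_zero h0])
  · intro h d hd
    by_cases h1 : d 1 = 0
    · rw [← addTwo_restTwo d, h1, coeff_subst_twoVar (restTwo_zero d) (restTwo_one d)]
      exact h _ (restTwo_zero d) (restTwo_one d) _ hd
    · exact coeff_subst_twoVar_of_one_ne_zero h1 f

/-! ### `q_n` has the cancellation property -/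

theorem isSymm_schurq (n : ℕ) : IsSymm (schurq n) := by
  intro σ d
  rw [coeff_schurq, coeff_schurq, Finsupp.degree_mapDomain,
    Finsupp.mapDomain_support_of_injective σ.injective, Finset.card_image_of_injective _ σ.injective]

theorem sum_neg_one_pow_antidiagonal (k : ℕ) :
    ∑ p ∈ Finset.HasAntidiagonal.antidiagonal k, (2 : K) * (-1) ^ p.2 = 1 + (-1) ^ k := by
  induction k with
  | zero => simp; norm_num
  | succ k ih =>
    rw [Finset.Nat.sum_antidiagonal_succ']
    simp only [pow_succ, pow_zero, mul_neg, mul_one, Finset.sum_neg_distrib, ih]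
    ring

/-- The coefficients of `(1 + t) / (1 - t)`. -/
noncomputable def qCoeff (k : ℕ) : K := if k = 0 then 1 else 2

/-- The coefficient of `t^m` in `(1 + t)/(1 - t) · (1 - t)/(1 + t) = 1`. -/
theorem sum_qCoeff (m : ℕ) (hm : m ≠ 0) : ∑ p ∈ Finset.HasAntidiagonal.antidiagonal m,
    (-1) ^ p.2 * (qCoeff p.1 * qCoeff p.2) = 0 := by
  obtain ⟨m, rfl⟩ := Nat.exists_eq_succ_of_ne_zero hm
  rw [Finset.Nat.sum_antidiagonal_succ]
  rcases m with _ | m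
  · simp [qCoeff]
  · rw [Finset.Nat.sum_antidiagonal_succ']
    simp only [qCoeff, Nat.succ_ne_zero, if_true, if_false, pow_succ, pow_zero]
    have h := sum_neg_one_pow_antidiagonal m
    have h2 : ∑ x ∈ Finset.HasAntidiagonal.antidiagonal m, (-1) ^ x.2 * -1 * ((2 : K) * 2) =
        -2 * (1 + (-1) ^ m) := by
      rw [← h, Finset.mul_sum]
      exact Finset.sum_congr rfl fun p _ => by ring
    rw [h2]
    ring

theorem two_pow_card_support (d : ℕ →₀ ℕ) :
    (2 : K) ^ d.support.card = d.prod fun _ k => qCoeff k := by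
  rw [Finsupp.prod, Finset.prod_congr rfl (g := fun _ => (2 : K)), Finset.prod_const]
  intro i hi
  rw [qCoeff, if_neg (Finsupp.mem_support_iff.mp hi)]

theorem two_pow_card_support_addTwo {e : ℕ →₀ ℕ} (h0 : e 0 = 0) (h1 : e 1 = 0) (p : ℕ × ℕ) :
    (2 : K) ^ (addTwo e p).support.card = qCoeff p.1 * qCoeff p.2 * 2 ^ e.support.card := by
  have hz : ∀ i : ℕ, (fun (_ : ℕ) k => qCoeff k) i 0 = 1 := fun _ => by simp [qCoeff]
  rw [two_pow_card_support, two_pow_card_support, ← Finsupp.mul_prod_erase' _ 0 _ hz,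
    ← Finsupp.mul_prod_erase' ((addTwo e p).erase 0) 1 _ hz, Finsupp.erase_ne one_ne_zero,
    ← restTwo, restTwo_addTwo h0 h1, addTwo_apply_zero h0, addTwo_apply_one h1, mul_assoc]

theorem degree_addTwo (e : ℕ →₀ ℕ) (p : ℕ × ℕ) :
    (addTwo e p).degree = e.degree + (p.1 + p.2) := by
  rw [addTwo, map_add, map_add, Finsupp.degree_single, Finsupp.degree_single]

theorem schurq_mem_cancelAlg (n : ℕ) : schurq n ∈ cancelAlg 0 := by
  rw [mem_cancelAlg, indepFirst_subst_twoVar_iff]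
  refine ⟨isSymm_schurq n, fun e h0 h1 m hm => ?_⟩
  have : ∀ p ∈ Finset.HasAntidiagonal.antidiagonal m,
      (-1) ^ p.2 * MvPowerSeries.coeff (addTwo e p) (schurq n) =
      (-1) ^ p.2 * (qCoeff p.1 * qCoeff p.2) *
        (if e.degree + m = n then 2 ^ e.support.card else 0) := by
    intro p hp
    rw [Finset.HasAntidiagonal.mem_antidiagonal] at hp
    rw [coeff_schurq, degree_addTwo, hp, two_pow_card_support_addTwo h0 h1]
    split_ifs
    · ring
    · ring
  rw [Finset.sum_congr rfl this, ← Finset.sum_mul, sum_qCoeff m hm, zero_mul]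

theorem Gamma_le_cancelAlg : Gamma ≤ cancelAlg 0 := by
  rw [Gamma, Algebra.adjoin_le_iff]
  rintro _ ⟨n, rfl⟩
  exact schurq_mem_cancelAlg n

theorem schurQTwo_mem_Gamma (m n : ℕ) : schurQTwo m n ∈ Gamma := by
  have h : ∀ i, schurq i ∈ Gamma := fun i => Algebra.subset_adjoin ⟨i, rfl⟩
  refine add_mem (mul_mem (h m) (h n)) (mul_mem (ofNat_mem _ 2) (sum_mem fun i _ => ?_))
  exact mul_mem (pow_mem (neg_mem (one_mem _)) i) (mul_mem (h _) (h _))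

theorem pfaffian_mem {A : Subalgebra K XSeries} {a : ℕ → ℕ → XSeries} (ha : ∀ m n, a m n ∈ A) :
    ∀ l : List ℕ, pfaffian a l ∈ A
  | [] => by rw [pfaffian]; exact one_mem A
  | m :: l => by
    rw [pfaffian]
    refine sum_mem fun j _ => mul_mem (pow_mem (neg_mem (one_mem _)) _) (mul_mem (ha _ _) ?_)
    have := List.length_eraseIdx_of_lt j.2
    exact pfaffian_mem ha _
termination_by l => l.length

theorem schurQ_mem_Gamma (l : StrictPartition) : schurQ l ∈ Gamma :=
  pfaffian_mem schurQTwo_mem_Gamma _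

/-! ### A series with the cancellation property is determined by its strict coefficients -/

/-- The sum of the squares of the exponents. -/
noncomputable def sqSum (d : ℕ →₀ ℕ) : ℕ := d.sum fun _ k => k ^ 2

theorem sqSum_addTwo {e : ℕ →₀ ℕ} (h0 : e 0 = 0) (h1 : e 1 = 0) (p : ℕ × ℕ) :
    sqSum (addTwo e p) = p.1 ^ 2 + (p.2 ^ 2 + sqSum e) := by
  have hz : ∀ i : ℕ, (fun (_ : ℕ) k => k ^ 2) i 0 = 0 := fun _ => rfl
  rw [sqSum, ← Finsupp.add_sum_erase' _ 0 _ hz,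
    ← Finsupp.add_sum_erase' ((addTwo e p).erase 0) 1 _ hz, Finsupp.erase_ne one_ne_zero,
    ← restTwo, restTwo_addTwo h0 h1, addTwo_apply_zero h0, addTwo_apply_one h1, sqSum]

theorem sqSum_le (d : ℕ →₀ ℕ) : sqSum d ≤ d.degree * d.degree := by
  have h : sqSum d ≤ ∑ i ∈ d.support, d i * d.degree :=
    Finset.sum_le_sum fun i _ => by
      dsimp only
      rw [pow_two]
      exact Nat.mul_le_mul_left _ (Finsupp.le_degree i d)
  rwa [← Finset.sum_mul, ← Finsupp.degree_apply] at h

theorem sqSum_mapDomain (σ : Equiv.Perm ℕ) (d : ℕ →₀ ℕ) :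
    sqSum (d.mapDomain σ) = sqSum d :=
  Finsupp.sum_mapDomain_index_inj (h := fun _ k => k ^ 2) σ.injective

theorem mapDomain_apply_perm (σ : Equiv.Perm ℕ) (d : ℕ →₀ ℕ) (i : ℕ) :
    d.mapDomain σ (σ i) = d i := Finsupp.mapDomain_apply σ.injective d i

theorem exists_perm_zero_one {i j : ℕ} (h : i ≠ j) : ∃ σ : Equiv.Perm ℕ, σ i = 0 ∧ σ j = 1 := by
  obtain ⟨σ, hσ⟩ := Equiv.Perm.exists_extending_pair ![i, j] ![0, 1]
    (by intro a b; fin_cases a <;> fin_cases b <;> simp [h, h.symm])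
    (by intro a b; fin_cases a <;> fin_cases b <;> simp)
  exact ⟨σ, hσ 0, hσ 1⟩

/-- If two variables carry the same exponent `a > 0`, the cancellation equation with `m = 2a`
expresses that coefficient through those with `(a, a)` replaced by `(p, q)`, `p + q = 2a`, `p ≠ q`.
They have the same degree and a larger sum of squares, which is bounded by the squared degree. -/
theorem coeff_eq_zero_of_strict {f : XSeries} (hf : f ∈ cancelAlg 0) {N : ℕ}
    (h : ∀ d : ℕ →₀ ℕ, d.degree ≤ N → Set.InjOn d d.support → MvPowerSeries.coeff d f = 0)
    (d : ℕ →₀ ℕ) (hd : d.degree ≤ N) : MvPowerSeries.coeff d f = 0 := by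
  rw [mem_cancelAlg, indepFirst_subst_twoVar_iff] at hf
  obtain ⟨hsymm, hcancel⟩ := hf
  induction hk : N * N - sqSum d using Nat.strong_induction_on generalizing d with
  | _ k ih =>
    by_cases hinj : Set.InjOn d d.support
    · exact h d hd hinj
    · simp only [Set.InjOn, not_forall] at hinj
      obtain ⟨i, hi, j, _, hij, hne⟩ := hinj
      obtain ⟨σ, hσi, hσj⟩ := exists_perm_zero_one hne
      rw [← hsymm σ d]
      have hd0 : d.mapDomain σ 0 = d i := by rw [← hσi, mapDomain_apply_perm]
      have hd1 : d.mapDomain σ 1 = d i := by rw [← hσj, mapDomain_apply_perm, hij]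
      have hsq : sqSum (d.mapDomain σ) = sqSum d := sqSum_mapDomain σ d
      have hdeg : (d.mapDomain σ).degree ≤ N := by rw [Finsupp.degree_mapDomain]; exact hd
      set d' := d.mapDomain σ
      have h0 := restTwo_zero d'
      have h1 := restTwo_one d'
      have hd' := addTwo_restTwo d'
      rw [hd0, hd1] at hd'
      set e := restTwo d'
      have hi0 : d i ≠ 0 := Finsupp.mem_support_iff.mp (Finset.mem_coe.mp hi)
      set a := d i
      rw [← hd'] at hsq hdeg ⊢
      have hsum := hcancel e h0 h1 (a + a) (by omega)
      rw [Finset.sum_eq_single (a, a)] at hsum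
      · exact (mul_eq_zero.mp hsum).resolve_left (pow_ne_zero _ (by norm_num))
      · rintro ⟨p, q⟩ hp hpq
        rw [Finset.HasAntidiagonal.mem_antidiagonal] at hp
        dsimp only at hp
        have hdeg' : (addTwo e (p, q)).degree ≤ N := by
          rw [degree_addTwo] at hdeg ⊢
          dsimp only at hdeg ⊢
          omega
        have hlt : sqSum d < sqSum (addTwo e (p, q)) := by
          rw [← hsq, sqSum_addTwo h0 h1, sqSum_addTwo h0 h1]
          dsimp only
          have hpa : p ≠ a := by
            rintro rfl
            exact hpq (by rw [show q = a by omega])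
          -- With `q = 2a - p` one has `p² + q² - 2a² = 2 (p - a)²`.
          have hpos : 0 < ((p : ℤ) - a) ^ 2 := by
            have : (p : ℤ) - a ≠ 0 := by omega
            positivity
          have hq : (q : ℤ) = 2 * a - p := by omega
          zify
          rw [hq]
          nlinarith
        have hle := sqSum_le (addTwo e (p, q))
        have hle' := Nat.mul_le_mul hdeg' hdeg'
        rw [ih (N * N - sqSum (addTwo e (p, q))) (by omega) _ hdeg' rfl, mul_zero]
      · intro hc
        simp at hc

/-! ### Schur's `Q`-functions modulo 2 -/

/-- The inclusion of integral power series. -/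
noncomputable def intMap : MvPowerSeries ℕ ℤ →+* XSeries := MvPowerSeries.map (Int.castRingHom K)

/-- Reduction modulo 2. -/
noncomputable def modTwo : MvPowerSeries ℕ ℤ →+* MvPowerSeries ℕ (ZMod 2) :=
  MvPowerSeries.map (Int.castRingHom (ZMod 2))

theorem coeff_intMap (g : MvPowerSeries ℕ ℤ) (d : ℕ →₀ ℕ) :
    MvPowerSeries.coeff d (intMap g) = ((MvPowerSeries.coeff d g : ℤ) : K) :=
  MvPowerSeries.coeff_map _ _ _

theorem coeff_modTwo (g : MvPowerSeries ℕ ℤ) (d : ℕ →₀ ℕ) :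
    MvPowerSeries.coeff d (modTwo g) = ((MvPowerSeries.coeff d g : ℤ) : ZMod 2) :=
  MvPowerSeries.coeff_map _ _ _

/-- The power sum modulo 2. -/
noncomputable def psumTwo (a : ℕ) : MvPowerSeries ℕ (ZMod 2) := fun d =>
  if d.support.card = 1 ∧ d.degree = a then 1 else 0

theorem coeff_psumTwo (a : ℕ) (d : ℕ →₀ ℕ) : MvPowerSeries.coeff d (psumTwo a) =
    if d.support.card = 1 ∧ d.degree = a then 1 else 0 := rfl

/-- The product of the power sums `p_a`, `a ∈ s`, modulo 2. -/
noncomputable def psumProd (s : Multiset ℕ) : MvPowerSeries ℕ (ZMod 2) := (s.map psumTwo).prod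

theorem psumProd_cons (a : ℕ) (s : Multiset ℕ) :
    psumProd (a ::ₘ s) = psumTwo a * psumProd s := by
  rw [psumProd, Multiset.map_cons, Multiset.prod_cons, psumProd]

theorem psumProd_zero : psumProd 0 = 1 := rfl

theorem psumProd_add (s t : Multiset ℕ) : psumProd (s + t) = psumProd s * psumProd t := by
  rw [psumProd, Multiset.map_add, Multiset.prod_add, psumProd, psumProd]

theorem card_support_add_le (a b : ℕ →₀ ℕ) :
    (a + b).support.card ≤ a.support.card + b.support.card :=
  (Finset.card_le_card Finsupp.support_add).trans (Finset.card_union_le _ _)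

theorem coeff_psumProd_eq_zero (s : Multiset ℕ) {d : ℕ →₀ ℕ}
    (hd : Multiset.card s < d.support.card) : MvPowerSeries.coeff d (psumProd s) = 0 := by
  classical
  induction s using Multiset.induction_on generalizing d with
  | empty =>
    rw [psumProd_zero, MvPowerSeries.coeff_one, if_neg]
    rintro rfl
    simp at hd
  | cons a s ih =>
    rw [psumProd_cons, MvPowerSeries.coeff_mul]
    refine Finset.sum_eq_zero fun p hp => ?_
    rw [Finset.HasAntidiagonal.mem_antidiagonal] at hp
    rw [Multiset.card_cons, ← hp] at hd
    have := card_support_add_le p.1 p.2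
    by_cases h1 : p.1.support.card = 1
    · rw [ih (by omega), mul_zero]
    · rw [coeff_psumTwo, if_neg (fun h => h1 h.1), zero_mul]

/-- `f = 2^r g` with `g` integral, where `g` agrees modulo 2 with the product of the power sums of
the `r` elements of `s` on the monomials with at least `r` variables. -/
def PsumLeading (s : Multiset ℕ) (f : XSeries) : Prop :=
  ∃ g : MvPowerSeries ℕ ℤ, f = 2 ^ Multiset.card s * intMap g ∧
    ∀ d : ℕ →₀ ℕ, Multiset.card s ≤ d.support.card →
      MvPowerSeries.coeff d (modTwo g) = MvPowerSeries.coeff d (psumProd s)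

theorem PsumLeading.one : PsumLeading 0 1 :=
  ⟨1, by simp, fun d _ => by rw [map_one, psumProd_zero]⟩

/-- When a monomial with at least `|s| + |t|` variables is split and one part has too few variables,
the other has too many. There the product of power sums vanishes, and so does the series congruent
to it. -/
theorem PsumLeading.mul {s t : Multiset ℕ} {f f' : XSeries} (h : PsumLeading s f)
    (h' : PsumLeading t f') : PsumLeading (s + t) (f * f') := by
  classical
  obtain ⟨g, rfl, hg⟩ := h
  obtain ⟨g', rfl, hg'⟩ := h'
  refine ⟨g * g', ?_, fun d hd => ?_⟩
  · rw [Multiset.card_add, pow_add, map_mul]; ring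
  · rw [map_mul, psumProd_add, MvPowerSeries.coeff_mul, MvPowerSeries.coeff_mul]
    refine Finset.sum_congr rfl fun p hp => ?_
    rw [Finset.HasAntidiagonal.mem_antidiagonal] at hp
    rw [Multiset.card_add, ← hp] at hd
    have hle := card_support_add_le p.1 p.2
    by_cases h1 : Multiset.card s ≤ p.1.support.card
    · by_cases h2 : Multiset.card t ≤ p.2.support.card
      · rw [hg _ h1, hg' _ h2]
      · rw [hg _ h1, coeff_psumProd_eq_zero s (by omega), zero_mul, zero_mul]
    · rw [hg' p.2 (by omega), coeff_psumProd_eq_zero t (by omega), mul_zero, mul_zero]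

theorem neg_one_pow_zmod_two (j : ℕ) : (-1 : ZMod 2) ^ j = 1 := by
  rw [show (-1 : ZMod 2) = 1 from rfl, one_pow]

/-- Signs disappear modulo 2, and an odd number of equal terms adds up to one of them. The row
expansion of a Pfaffian has an odd number of terms. -/
theorem PsumLeading.alternatingSum {s : Multiset ℕ} {k : ℕ} (hk : Odd k) (f : Fin k → XSeries)
    (h : ∀ j, PsumLeading s (f j)) : PsumLeading s (∑ j : Fin k, (-1) ^ (j : ℕ) * f j) := by
  choose g hf hg using h
  refine ⟨∑ j : Fin k, (-1) ^ (j : ℕ) * g j, ?_, fun d hd => ?_⟩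
  · rw [map_sum, Finset.mul_sum]
    refine Finset.sum_congr rfl fun j _ => ?_
    rw [hf, map_mul, map_pow, map_neg, map_one]
    ring
  · rw [map_sum, map_sum]
    have : ∀ j : Fin k, MvPowerSeries.coeff d (modTwo ((-1) ^ (j : ℕ) * g j)) =
        MvPowerSeries.coeff d (psumProd s) := by
      intro j
      rw [map_mul, map_pow, map_neg, map_one, ← hg j d hd]
      have hC : ((-1) ^ (j : ℕ) : MvPowerSeries ℕ (ZMod 2)) = MvPowerSeries.C ((-1) ^ (j : ℕ)) := by
        rw [map_pow, map_neg, map_one]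
      rw [hC, MvPowerSeries.coeff_C_mul, neg_one_pow_zmod_two, one_mul]
    rw [Finset.sum_congr rfl fun j _ => this j, Finset.sum_const, Finset.card_univ, Fintype.card_fin,
      nsmul_eq_mul]
    obtain ⟨r, rfl⟩ := hk
    have h2 : ((2 * r + 1 : ℕ) : ZMod 2) = 1 := by
      rw [Nat.cast_add, Nat.cast_mul, Nat.cast_one, show ((2 : ℕ) : ZMod 2) = 0 from rfl, zero_mul,
        zero_add]
    rw [h2, one_mul]

/-- `q_n / 2`. -/
noncomputable def halfq (n : ℕ) : MvPowerSeries ℕ ℤ := fun d =>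
  if d.degree = n then 2 ^ (d.support.card - 1) else 0

theorem coeff_halfq (n : ℕ) (d : ℕ →₀ ℕ) : MvPowerSeries.coeff d (halfq n) =
    if d.degree = n then 2 ^ (d.support.card - 1) else 0 := rfl

theorem card_support_pos {d : ℕ →₀ ℕ} (hd : d.degree ≠ 0) : 0 < d.support.card := by
  rw [Finset.card_pos, Finsupp.support_nonempty_iff]
  rintro rfl
  simp at hd

theorem schurq_eq_halfq {n : ℕ} (hn : n ≠ 0) : schurq n = 2 * intMap (halfq n) := by
  ext d
  rw [show (2 : XSeries) = MvPowerSeries.C 2 from (map_ofNat _ 2).symm, MvPowerSeries.coeff_C_mul,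
    coeff_intMap, coeff_halfq, coeff_schurq]
  split_ifs with h
  · have := card_support_pos (d := d) (by omega)
    obtain ⟨k, hk⟩ := Nat.exists_eq_succ_of_ne_zero this.ne'
    rw [hk, Nat.succ_sub_one]
    push_cast
    rw [pow_succ']
  · simp

/-- The coefficient `2^{j-1}` is odd only for `j = 1`, that is, for pure powers `x_i^n`. -/
theorem modTwo_halfq {n : ℕ} (hn : n ≠ 0) : modTwo (halfq n) = psumTwo n := by
  ext d
  rw [coeff_modTwo, coeff_halfq, coeff_psumTwo]
  by_cases h : d.degree = n
  · have := card_support_pos (d := d) (by omega)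
    rw [if_pos h]
    by_cases h1 : d.support.card = 1
    · rw [if_pos ⟨h1, h⟩, h1]; simp
    · rw [if_neg (fun h' => h1 h'.1), Int.cast_pow, Int.cast_ofNat,
        show (2 : ZMod 2) = 0 from rfl, zero_pow (by omega)]
  · rw [if_neg h, if_neg (fun h' => h h'.2), Int.cast_zero]

theorem psumLeading_schurQTwo_zero {m : ℕ} (hm : m ≠ 0) : PsumLeading {m} (schurQTwo m 0) := by
  refine ⟨halfq m, ?_, fun d _ => ?_⟩
  · simp [schurQTwo, schurq_zero, schurq_eq_halfq hm]
  · rw [modTwo_halfq hm, psumProd, Multiset.map_singleton, Multiset.prod_singleton]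

/-- After division by `4` the terms with `1 ≤ i < n` are even, while the last one is `± q_{m+n}/2`,
since `q_0 = 1`. Modulo 2 it is a power sum, invisible on monomials with at least two variables;
this is why `PsumLeading` restricts the monomials. -/
theorem psumLeading_schurQTwo {m n : ℕ} (hm : m ≠ 0) (hn : n ≠ 0) :
    PsumLeading {m, n} (schurQTwo m n) := by
  obtain ⟨n, rfl⟩ := Nat.exists_eq_succ_of_ne_zero hn
  rw [Nat.succ_eq_add_one] at hn ⊢
  refine ⟨halfq m * halfq (n + 1) + 2 * ∑ i ∈ Finset.Icc 1 n,
    (-1) ^ i * (halfq (m + i) * halfq (n + 1 - i)) + (-1) ^ (n + 1) * halfq (m + (n + 1)),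
    ?_, fun d hd => ?_⟩
  · rw [schurQTwo, Finset.sum_Icc_succ_top (by omega), schurq_eq_halfq hm, schurq_eq_halfq hn,
      Nat.sub_self, schurq_zero, schurq_eq_halfq (show m + (n + 1) ≠ 0 by omega)]
    have : ∀ i ∈ Finset.Icc 1 n, (-1 : XSeries) ^ i * (schurq (m + i) * schurq (n + 1 - i)) =
        4 * intMap ((-1) ^ i * (halfq (m + i) * halfq (n + 1 - i))) := by
      intro i hi
      rw [Finset.mem_Icc] at hi
      rw [schurq_eq_halfq (by omega), schurq_eq_halfq (show n + 1 - i ≠ 0 by omega), map_mul,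
        map_mul, map_pow, map_neg, map_one]
      ring
    rw [Finset.sum_congr rfl this, ← Finset.mul_sum, ← map_sum]
    simp only [map_add, map_mul, map_pow, map_neg, map_one, map_ofNat, Multiset.insert_eq_cons,
      Multiset.card_cons, Multiset.card_singleton]
    ring
  · have h2 : (2 : MvPowerSeries ℕ (ZMod 2)) = 0 := by
      rw [show (2 : MvPowerSeries ℕ (ZMod 2)) = MvPowerSeries.C 2 from (map_ofNat _ 2).symm,
        show (2 : ZMod 2) = 0 from rfl, map_zero]
    have h1 : (-1 : MvPowerSeries ℕ (ZMod 2)) = 1 := by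
      rw [neg_eq_iff_add_eq_zero, one_add_one_eq_two, h2]
    rw [Multiset.insert_eq_cons, Multiset.card_cons, Multiset.card_singleton] at hd
    simp only [map_add modTwo, map_mul modTwo, map_pow modTwo, map_neg modTwo, map_one modTwo,
      map_ofNat modTwo, h2, h1, zero_mul, add_zero, one_pow, one_mul, modTwo_halfq hm,
      modTwo_halfq hn, modTwo_halfq (show m + (n + 1) ≠ 0 by omega)]
    rw [map_add, coeff_psumTwo, if_neg (by omega),
      add_zero, Multiset.insert_eq_cons, psumProd_cons, psumProd, Multiset.map_singleton,
      Multiset.prod_singleton]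

/-- The nonzero entries of a list. -/
def nonzeroParts (l : List ℕ) : Multiset ℕ := (l : Multiset ℕ).filter (· ≠ 0)

theorem nonzeroParts_cons_zero (l : List ℕ) : nonzeroParts (0 :: l) = nonzeroParts l := by
  simp [nonzeroParts]

theorem nonzeroParts_cons {m : ℕ} (hm : m ≠ 0) (l : List ℕ) :
    nonzeroParts (m :: l) = m ::ₘ nonzeroParts l := by
  simp [nonzeroParts, hm]

theorem nonzeroParts_eraseIdx (l : List ℕ) (j : Fin l.length) :
    nonzeroParts l = nonzeroParts (l[j] :: l.eraseIdx j) := by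
  have h : (l : Multiset ℕ) = (l[j] :: l.eraseIdx j : List ℕ) :=
    Multiset.coe_eq_coe.mpr (List.getElem_cons_eraseIdx_perm j.2).symm
  rw [nonzeroParts, h, nonzeroParts]

/-- All terms of the row expansion have the same multiset of nonzero parts, and there is an odd
number of them. Strictness makes the first entry nonzero, so at most the last entry is a padding
zero. -/
theorem psumLeading_pfaffian : ∀ (l : List ℕ), l.Pairwise (· > ·) → Even l.length →
    PsumLeading (nonzeroParts l) (pfaffian schurQTwo l)
  | [], _, _ => by
    rw [pfaffian]
    exact PsumLeading.one
  | m :: l, hp, he => by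
    have hl : Odd l.length := by
      rw [List.length_cons, Nat.even_add_one, Nat.not_even_iff_odd] at he
      exact he
    rw [List.pairwise_cons] at hp
    have hm : m ≠ 0 := by
      have := hp.1 (l[0]'hl.pos) (List.getElem_mem _)
      omega
    rw [pfaffian]
    refine PsumLeading.alternatingSum hl _ fun j => ?_
    have hlen := List.length_eraseIdx_of_lt j.2
    have ih := psumLeading_pfaffian (l.eraseIdx j) (hp.2.sublist (List.eraseIdx_sublist _ _))
      (by rw [hlen]; exact Nat.Odd.sub_odd hl odd_one)
    rw [nonzeroParts_cons hm, nonzeroParts_eraseIdx l j]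
    by_cases h0 : l[j] = 0
    · rw [h0, nonzeroParts_cons_zero]
      exact (psumLeading_schurQTwo_zero hm).mul ih
    · rw [nonzeroParts_cons h0]
      exact (psumLeading_schurQTwo hm h0).mul ih
termination_by l => l.length
decreasing_by
  have := List.length_eraseIdx_of_lt j.2
  simp only [List.length_cons]
  omega

theorem psumLeading_schurQ (l : StrictPartition) : PsumLeading (l.1 : Multiset ℕ) (schurQ l) := by
  have h1 : nonzeroParts l.1 = (l.1 : Multiset ℕ) := by
    rw [nonzeroParts, Multiset.filter_eq_self]
    exact fun a ha => (l.2.2 a ha).ne'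
  have h2 : nonzeroParts l.padded = (l.1 : Multiset ℕ) := by
    rw [← h1, StrictPartition.padded]
    split_ifs
    · rfl
    · simp [nonzeroParts]
  rw [← h2]
  refine psumLeading_pfaffian _ ?_ (even_length_padded l)
  rw [StrictPartition.padded]
  split_ifs
  · exact l.2.1
  · rw [List.pairwise_append]
    refine ⟨l.2.1, List.pairwise_singleton _ _, fun a ha b hb => ?_⟩
    rw [List.mem_singleton.mp hb]
    exact l.2.2 a ha

/-! ### The coefficients at strict exponents -/

/-- The exponent `∏_{a ∈ T} x_a^a`. -/
noncomputable def expo (T : Finset ℕ) : ℕ →₀ ℕ := ∑ a ∈ T, Finsupp.single a a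

theorem expo_apply (T : Finset ℕ) (i : ℕ) : expo T i = if i ∈ T then i else 0 := by
  rw [expo, Finsupp.finsetSum_apply]
  simp [Finsupp.single_apply]

theorem support_expo {T : Finset ℕ} (hT : 0 ∉ T) : (expo T).support = T := by
  ext i
  rw [Finsupp.mem_support_iff, expo_apply]
  split_ifs with h
  · exact iff_of_true (fun h0 => hT (h0 ▸ h)) h
  · simp [h]

theorem expo_eq_add_erase {T : Finset ℕ} {a : ℕ} (ha : a ∈ T) :
    expo T = Finsupp.single a a + expo (T.erase a) := by
  rw [expo, expo, Finset.add_sum_erase _ (fun a => Finsupp.single a a) ha]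

/-- With at least as many variables as factors, every factor must use up a variable of its own. As
`x_i` occurs with exponent `i`, the factor `p_a` can only contribute `x_a^a`. -/
theorem coeff_expo_psumProd : ∀ (l : List ℕ) (T : Finset ℕ), l.Nodup → (∀ a ∈ l, 0 < a) → 0 ∉ T →
    l.length ≤ T.card → MvPowerSeries.coeff (expo T) (psumProd l) =
      if l.toFinset = T then 1 else 0
  | [], T, _, _, hT, _ => by
    classical
    rw [Multiset.coe_nil, psumProd_zero, MvPowerSeries.coeff_one, List.toFinset_nil]
    have : expo T = 0 ↔ ∅ = T := by
      rw [← Finsupp.support_eq_empty, support_expo hT, eq_comm]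
    simp only [this]
  | a :: l, T, hnd, hpos, hT, hlen => by
    classical
    rw [List.nodup_cons] at hnd
    have ha : 0 < a := hpos a List.mem_cons_self
    rw [List.length_cons] at hlen
    rw [← Multiset.cons_coe, psumProd_cons, MvPowerSeries.coeff_mul]
    have key : ∀ p ∈ Finset.HasAntidiagonal.antidiagonal (expo T),
        MvPowerSeries.coeff p.1 (psumTwo a) * MvPowerSeries.coeff p.2 (psumProd l) ≠ 0 →
        a ∈ T ∧ p = (Finsupp.single a a, expo (T.erase a)) := by
      rintro ⟨u, v⟩ hp hne
      rw [Finset.HasAntidiagonal.mem_antidiagonal] at hp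
      dsimp only at hp hne
      have h1 := left_ne_zero_of_mul hne
      have h2 := right_ne_zero_of_mul hne
      have hu : u.support.card = 1 ∧ u.degree = a := by
        by_contra hc
        rw [coeff_psumTwo, if_neg hc] at h1
        exact h1 rfl
      have hv : v.support.card ≤ l.length := by
        by_contra hc
        exact h2 (coeff_psumProd_eq_zero _ (by rw [Multiset.coe_card]; omega))
      obtain ⟨i, k, hk, rfl⟩ := Finsupp.card_support_eq_one'.mp hu.1
      obtain rfl : k = a := by rw [← hu.2, Finsupp.degree_single]
      have hiT : i ∈ T := by
        by_contra hc
        have := DFunLike.congr_fun hp i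
        rw [expo_apply, if_neg hc, Finsupp.add_apply, Finsupp.single_eq_same] at this
        omega
      -- If `x_i` still occurred in `v`, then `v` would contain all variables of `T`, more than the
      -- remaining factors can produce.
      have hvi : v i = 0 := by
        by_contra hc
        have hsub : T ⊆ v.support := by
          intro j hj
          rw [Finsupp.mem_support_iff]
          by_cases hji : j = i
          · rw [hji]; exact hc
          · have := DFunLike.congr_fun hp j
            rw [expo_apply, if_pos hj, Finsupp.add_apply, Finsupp.single_eq_of_ne hji,
              zero_add] at this
            rw [this]
            rintro rfl
            exact hT hj
        have := Finset.card_le_card hsub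
        omega
      have hki := DFunLike.congr_fun hp i
      rw [expo_apply, if_pos hiT, Finsupp.add_apply, Finsupp.single_eq_same, hvi, add_zero] at hki
      subst hki
      refine ⟨hiT, ?_⟩
      rw [expo_eq_add_erase hiT, add_right_inj] at hp
      rw [hp]
    by_cases haT : a ∈ T
    · rw [Finset.sum_eq_single (Finsupp.single a a, expo (T.erase a)),
        coeff_expo_psumProd l (T.erase a) hnd.2 (fun b hb => hpos b (List.mem_cons_of_mem _ hb))
          (fun h => hT (Finset.mem_of_mem_erase h)) (by rw [Finset.card_erase_of_mem haT]; omega),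
        coeff_psumTwo, if_pos ⟨by rw [Finsupp.support_single _ ha.ne', Finset.card_singleton],
          Finsupp.degree_single _ _⟩, one_mul, List.toFinset_cons]
      · refine if_congr ?_ rfl rfl
        have hal : a ∉ l.toFinset := fun h => hnd.1 (List.mem_toFinset.mp h)
        constructor
        · intro h
          rw [h, Finset.insert_erase haT]
        · intro h
          rw [← h, Finset.erase_insert hal]
      · intro p hp hne
        by_contra hc
        exact hne (key p hp hc).2
      · intro hc
        exact absurd (Finset.HasAntidiagonal.mem_antidiagonal.mpr (expo_eq_add_erase haT).symm) hc
    · rw [if_neg, Finset.sum_eq_zero]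
      · intro p hp
        by_contra hc
        exact haT (key p hp hc).1
      · rintro rfl
        simp at haT

/-- The set of parts of a strict partition. -/
def partSet (l : StrictPartition) : Finset ℕ := l.1.toFinset

theorem nodup_strictPartition (l : StrictPartition) : l.1.Nodup :=
  l.2.1.imp fun h => ne_of_gt h

theorem card_partSet (l : StrictPartition) : (partSet l).card = l.1.length :=
  List.toFinset_card_of_nodup (nodup_strictPartition l)

theorem zero_notMem_partSet (l : StrictPartition) : 0 ∉ partSet l := fun h =>
  lt_irrefl 0 (l.2.2 0 (List.mem_toFinset.mp h))

theorem partSet_injective : Function.Injective partSet := by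
  intro l l' h
  refine Subtype.ext ?_
  have hp := List.perm_of_nodup_nodup_toFinset_eq (nodup_strictPartition l)
    (nodup_strictPartition l') h
  exact hp.eq_of_pairwise (fun a b _ _ h1 h2 => absurd h1 (not_lt_of_gt h2)) l.2.1 l'.2.1

/-- The coefficient of `Q_l` at the exponent of `μ`. -/
noncomputable def strictCoeff (l μ : StrictPartition) : K :=
  MvPowerSeries.coeff (expo (partSet μ)) (schurQ l)

/-- The matrix of coefficients of the `Q_l` at strict exponents is invertible: after division of
the rows by powers of 2 it is integral and unitriangular modulo 2. -/
theorem det_strictCoeff_ne_zero (s : Finset StrictPartition) :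
    letI := Classical.decEq StrictPartition
    (Matrix.of fun l μ : s => strictCoeff l μ).det ≠ 0 := by
  classical
  choose g hg hmod using psumLeading_schurQ
  set M : Matrix s s ℤ := Matrix.of fun l μ =>
    MvPowerSeries.coeff (expo (partSet (μ : StrictPartition))) (g l) with hM
  have hent : ∀ l μ : s, (l : StrictPartition).1.length ≤ (μ : StrictPartition).1.length →
      ((M l μ : ℤ) : ZMod 2) = if l = μ then 1 else 0 := by
    intro l μ hlen
    have h1 := hmod l (expo (partSet (μ : StrictPartition))) (by
      rw [support_expo (zero_notMem_partSet _), card_partSet, Multiset.coe_card]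
      exact hlen)
    rw [coeff_modTwo, coeff_expo_psumProd _ _ (nodup_strictPartition _) (l : StrictPartition).2.2
      (zero_notMem_partSet _) (by rw [card_partSet]; exact hlen)] at h1
    rw [hM, Matrix.of_apply, h1]
    refine if_congr ?_ rfl rfl
    exact ⟨fun h => Subtype.ext (partSet_injective h), fun h => by rw [h]; rfl⟩
  have hdet : (M.map (Int.castRingHom (ZMod 2))).det = 1 := by
    -- Entries are known modulo 2 only if the column is at least as long as the row: zero for a
    -- longer column, identity for equal lengths. Hence the blocks are ordered by decreasing length.
    have htri : (M.map (Int.castRingHom (ZMod 2))).BlockTriangular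
        (fun l : s => OrderDual.toDual (l : StrictPartition).1.length) := by
      intro l μ hlt
      rw [OrderDual.toDual_lt_toDual] at hlt
      rw [Matrix.map_apply, eq_intCast, hent l μ hlt.le, if_neg]
      rintro rfl
      exact lt_irrefl _ hlt
    rw [htri.det]
    refine Finset.prod_eq_one fun k _ => ?_
    have : (M.map (Int.castRingHom (ZMod 2))).toSquareBlock
        (fun l : s => OrderDual.toDual (l : StrictPartition).1.length) k = 1 := by
      ext l μ
      have hlen : (l : s).1.1.length = (μ : s).1.1.length :=
        OrderDual.toDual.injective (l.2.trans μ.2.symm)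
      rw [Matrix.toSquareBlock_def, Matrix.of_apply, Matrix.map_apply, eq_intCast,
        hent _ _ hlen.le, Matrix.one_apply]
      exact if_congr Subtype.ext_iff.symm rfl rfl
    rw [this, Matrix.det_one]
  have hM0 : M.det ≠ 0 := by
    intro h0
    rw [← RingHom.mapMatrix_apply, ← RingHom.map_det, h0, map_zero] at hdet
    exact zero_ne_one hdet
  -- Restores the powers of 2 removed from the rows.
  have hN : (Matrix.of fun l μ : s => strictCoeff l μ) =
      Matrix.diagonal (fun l : s => (2 : K) ^ (l : StrictPartition).1.length) *
        M.map (Int.castRingHom K) := by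
    ext l μ
    rw [Matrix.diagonal_mul, Matrix.of_apply, Matrix.map_apply, strictCoeff, hg l]
    have h2 : (2 ^ Multiset.card ((l : StrictPartition).1 : Multiset ℕ) : XSeries) =
        MvPowerSeries.C (2 ^ (l : StrictPartition).1.length) := by
      rw [Multiset.coe_card, map_pow, map_ofNat]
    rw [h2, MvPowerSeries.coeff_C_mul, coeff_intMap]
    rfl
  have hMK : (M.map (Int.castRingHom K)).det ≠ 0 := by
    rw [← RingHom.mapMatrix_apply, ← RingHom.map_det, eq_intCast]
    exact Int.cast_ne_zero.mpr hM0
  convert mul_ne_zero (Finset.prod_ne_zero_iff.mpr fun l _ => ?_) hMK using 1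
  · rw [hN, Matrix.det_mul, Matrix.det_diagonal]
  · exact pow_ne_zero _ two_ne_zero

/-! ### Linear independence and approximation by Schur's `Q`-functions. -/

theorem linearIndependent_schurQ : LinearIndependent K schurQ := by
  classical
  rw [linearIndependent_iff']
  intro s c hc l hl
  have hdet := det_strictCoeff_ne_zero s
  have h0 : Matrix.vecMul (fun l : s => c l) (Matrix.of fun l μ : s => strictCoeff l μ) = 0 := by
    funext μ
    have h := congrArg (MvPowerSeries.coeff (expo (partSet (μ : StrictPartition)))) hc
    rw [map_sum, map_zero, ← Finset.sum_coe_sort] at h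
    rw [Matrix.vecMul, dotProduct, Pi.zero_apply, ← h]
    rfl
  have := Matrix.eq_zero_of_vecMul_eq_zero (by convert hdet) h0
  exact congrFun this ⟨l, hl⟩

/-- The strict partition with parts the positive elements of a finite set. -/
noncomputable def ofFinset (T : Finset ℕ) : StrictPartition :=
  ⟨(T.filter (0 < ·)).sort (· ≥ ·), (Finset.sortedGT_sort _).pairwise, fun a ha => by
    rw [Finset.mem_sort, Finset.mem_filter] at ha
    exact ha.2⟩

theorem partSet_ofFinset {T : Finset ℕ} (hT : 0 ∉ T) : partSet (ofFinset T) = T := by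
  rw [partSet, ofFinset, Finset.sort_toFinset, Finset.filter_eq_self]
  exact fun a ha => Nat.pos_of_ne_zero fun h => hT (h ▸ ha)

/-- Since the nonzero exponents are distinct, each variable can be moved to the position equal to
its exponent, and this injection extends to a permutation. -/
theorem exists_mapDomain_eq_expo {d : ℕ →₀ ℕ} (hd : Set.InjOn d d.support) :
    ∃ σ : Equiv.Perm ℕ, d.mapDomain σ = expo (d.support.image d) := by
  obtain ⟨σ, hσ⟩ := Equiv.Perm.exists_extending_pair (fun i : d.support => (i : ℕ))
    (fun i : d.support => d i) Subtype.val_injective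
    (fun i j h => Subtype.ext (hd i.2 j.2 h))
  refine ⟨σ, ?_⟩
  ext k
  obtain ⟨i, rfl⟩ := σ.surjective k
  rw [mapDomain_apply_perm, expo_apply]
  by_cases hi : i ∈ d.support
  · rw [hσ ⟨i, hi⟩, if_pos (Finset.mem_image_of_mem _ hi)]
  · rw [if_neg]
    · exact Finsupp.notMem_support_iff.mp hi
    · intro h
      obtain ⟨j, hj, hji⟩ := Finset.mem_image.mp h
      rw [← hσ ⟨j, hj⟩] at hji
      exact hi (σ.injective hji ▸ hj)

/-- Solve the invertible linear system that prescribes the coefficients of `f` at strict exponents.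
The difference then vanishes through degree `N` by `coeff_eq_zero_of_strict`. -/
theorem exists_approx {f : XSeries} (hf : f ∈ cancelAlg 0) (N : ℕ) :
    ∃ g ∈ Submodule.span K (Set.range schurQ), ∀ d : ℕ →₀ ℕ, d.degree ≤ N →
      MvPowerSeries.coeff d g = MvPowerSeries.coeff d f := by
  classical
  -- All strict partitions with parts at most `N`. Those of size above `N` do no harm, because every
  -- finite set gives an invertible matrix.
  set s : Finset StrictPartition := ((Finset.range (N + 1)).powerset).image ofFinset
  have hdet := det_strictCoeff_ne_zero s
  set A : Matrix s s K := Matrix.of fun l μ => strictCoeff l μ with hA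
  have hdet' : A.det ≠ 0 := by convert hdet
  set c : s → K := Matrix.vecMul
    (fun μ : s => MvPowerSeries.coeff (expo (partSet (μ : StrictPartition))) f) A⁻¹
  have hc : Matrix.vecMul c A =
      fun μ : s => MvPowerSeries.coeff (expo (partSet (μ : StrictPartition))) f := by
    rw [Matrix.vecMul_vecMul, Matrix.nonsing_inv_mul _ (isUnit_iff_ne_zero.mpr hdet'),
      Matrix.vecMul_one]
  set g : XSeries := ∑ l : s, c l • schurQ l with hg
  have hgspan : g ∈ Submodule.span K (Set.range schurQ) :=
    sum_mem fun l _ => Submodule.smul_mem _ _ (Submodule.subset_span ⟨l, rfl⟩)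
  have hgV : g ∈ cancelAlg 0 :=
    sum_mem fun l _ => Subalgebra.smul_mem _ (Gamma_le_cancelAlg (schurQ_mem_Gamma l)) _
  refine ⟨g, hgspan, fun d hd => ?_⟩
  rw [← sub_eq_zero, ← map_sub]
  refine coeff_eq_zero_of_strict (sub_mem hgV hf) (fun d hd hinj => ?_) d hd
  have hsymm := (mem_cancelAlg.mp (sub_mem hgV hf)).1
  obtain ⟨σ, hσ⟩ := exists_mapDomain_eq_expo hinj
  rw [← hsymm σ d, hσ]
  set T := d.support.image d
  have hT0 : 0 ∉ T := by
    intro h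
    obtain ⟨j, hj, hj0⟩ := Finset.mem_image.mp h
    exact Finsupp.mem_support_iff.mp hj hj0
  have hTs : ofFinset T ∈ s := by
    refine Finset.mem_image_of_mem _ (Finset.mem_powerset.mpr fun a ha => ?_)
    obtain ⟨j, _, rfl⟩ := Finset.mem_image.mp ha
    rw [Finset.mem_range]
    have := Finsupp.le_degree j d
    omega
  have := congrFun hc ⟨ofFinset T, hTs⟩
  dsimp only at this
  rw [partSet_ofFinset hT0] at this
  rw [map_sub, ← this, hg, map_sum, Matrix.vecMul, dotProduct, sub_eq_zero]
  refine Finset.sum_congr rfl fun l _ => ?_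
  rw [hA, Matrix.of_apply, strictCoeff, partSet_ofFinset hT0, MvPowerSeries.coeff_smul]

/-! ### Topology -/

theorem continuous_substMob (c : K) : Continuous (substMob c) := by
  let : UniformSpace K := ⊥
  have : DiscreteUniformity K := ⟨rfl⟩
  exact MvPowerSeries.continuous_subst (hasSubst_mob c)

theorem isClosed_cancelAlg_zero : IsClosed (cancelAlg 0 : Set XSeries) := by
  have : (cancelAlg 0 : Set XSeries) =
      {f | ∀ (σ : Equiv.Perm ℕ) (d : ℕ →₀ ℕ),
        MvPowerSeries.coeff (d.mapDomain σ) f = MvPowerSeries.coeff d f} ∩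
      {f | ∀ e : ℕ →₀ ℕ, e 0 = 0 → e 1 = 0 → ∀ m : ℕ, m ≠ 0 →
        ∑ p ∈ Finset.HasAntidiagonal.antidiagonal m,
          (-1) ^ p.2 * MvPowerSeries.coeff (addTwo e p) f = 0} := by
    ext f
    rw [SetLike.mem_coe, mem_cancelAlg, indepFirst_subst_twoVar_iff]
    rfl
  have hc : ∀ d : ℕ →₀ ℕ, Continuous fun f : XSeries => MvPowerSeries.coeff d f :=
    fun d => MvPowerSeries.WithPiTopology.continuous_coeff K d
  rw [this]
  refine IsClosed.inter ?_ ?_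
  · simp only [Set.ofPred_forall]
    exact isClosed_iInter fun σ => isClosed_iInter fun d => isClosed_eq (hc _) (hc _)
  · simp only [Set.ofPred_forall]
    exact isClosed_iInter fun e => isClosed_iInter fun _ => isClosed_iInter fun _ =>
      isClosed_iInter fun m => isClosed_iInter fun _ =>
        isClosed_eq (continuous_finsetSum _ fun p _ => continuous_const.mul (hc _)) continuous_const

theorem cancelAlg_zero_subset_closure_span :
    (cancelAlg 0 : Set XSeries) ⊆ closure (Submodule.span K (Set.range schurQ) : Set XSeries) := by
  intro f hf
  choose g hg hgf using exists_approx hf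
  refine mem_closure_of_tendsto (f := g) (b := Filter.atTop) ?_ (.of_forall hg)
  rw [MvPowerSeries.WithPiTopology.tendsto_iff_coeff_tendsto]
  intro d
  refine tendsto_const_nhds.congr' ?_
  filter_upwards [Filter.eventually_ge_atTop d.degree] with N hN
  exact (hgf N d hN).symm

theorem span_schurQ_le_Gamma :
    (Submodule.span K (Set.range schurQ) : Set XSeries) ⊆ (Gamma : Set XSeries) := by
  refine (Submodule.span_le (p := Subalgebra.toSubmodule Gamma)).mpr ?_
  rintro _ ⟨l, rfl⟩
  exact schurQ_mem_Gamma l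

/-- The span of the `Q_λ` lies in `Γ`, which lies in the closed set `cancelAlg 0`, and that span is
already dense there. -/
theorem cancelAlg_zero_eq_closure : (cancelAlg 0 : Set XSeries) = closure (Gamma : Set XSeries) :=
  Set.Subset.antisymm
    (cancelAlg_zero_subset_closure_span.trans (closure_mono span_schurQ_le_Gamma))
    (closure_minimal Gamma_le_cancelAlg isClosed_cancelAlg_zero)

/-! ### Transport to `GΓ` along the Möbius substitution. -/

theorem vev_eq_mobHom_comp : vev = mobHom (β / 2) ∘ schurQ := by
  funext l
  rw [Function.comp_apply, mobHom_apply, ← substBeta_eq, substBeta_schurQ]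

theorem linearIndependent_vev : LinearIndependent K vev := by
  rw [vev_eq_mobHom_comp]
  refine linearIndependent_schurQ.map' (mobHom (β / 2)).toLinearMap (LinearMap.ker_eq_bot.mpr ?_)
  intro f g h
  refine substMob_injective (β / 2) ?_
  rw [← mobHom_apply, ← mobHom_apply]
  exact h

theorem schurQ_mem_cancelAlg (l : StrictPartition) : schurQ l ∈ cancelAlg 0 :=
  Gamma_le_cancelAlg (schurQ_mem_Gamma l)

theorem vev_mem_GGamma (l : StrictPartition) : vev l ∈ GGamma := by
  rw [← substBeta_schurQ, substBeta_mem_GGamma]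
  exact schurQ_mem_cancelAlg l

theorem substMob_neg_mem_cancelAlg {g : XSeries} (hg : g ∈ GGamma) :
    substMob (-(β / 2)) g ∈ cancelAlg 0 := by
  rwa [← substBeta_mem_GGamma, substBeta_eq, substMob_substMob_neg]

/-- Pull back by the inverse substitution, approximate by `Q_λ`, and push forward by continuity. -/
theorem GGamma_subset_closure :
    (GGamma : Set XSeries) ⊆ closure (Submodule.span K (Set.range vev) : Set XSeries) := by
  intro g hg
  have h1 := image_closure_subset_closure_image (continuous_substMob (β / 2))
    (Set.mem_image_of_mem _ (cancelAlg_zero_subset_closure_span (substMob_neg_mem_cancelAlg hg)))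
  rw [substMob_substMob_neg] at h1
  refine closure_mono ?_ h1
  rintro _ ⟨f, hf, rfl⟩
  rw [SetLike.mem_coe, vev_eq_mobHom_comp, Set.range_comp, ← AlgHom.coe_toLinearMap,
    Submodule.span_image]
  exact ⟨f, hf, mobHom_apply _ f⟩

/-- The isomorphism `Γ̂ ≃ GΓ` given by the substitution `x ↦ x / (1 + β x / 2)`. -/
noncomputable def cancelEquiv : cancelAlg 0 ≃ₐ[K] GGamma :=
  AlgEquiv.ofAlgHom
    (((mobHom (β / 2)).comp (cancelAlg 0).val).codRestrict GGamma fun f => by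
      rw [AlgHom.comp_apply, mobHom_apply, ← substBeta_eq, substBeta_mem_GGamma]
      exact f.2)
    (((mobHom (-(β / 2))).comp GGamma.val).codRestrict (cancelAlg 0) fun g => by
      rw [AlgHom.comp_apply, mobHom_apply]
      exact substMob_neg_mem_cancelAlg g.2)
    (AlgHom.ext fun g => Subtype.ext (by
      simp only [AlgHom.comp_apply, AlgHom.coe_codRestrict, Subalgebra.coe_val, mobHom_apply,
        substMob_substMob_neg, AlgHom.id_apply]))
    (AlgHom.ext fun f => Subtype.ext (by
      simp only [AlgHom.comp_apply, AlgHom.coe_codRestrict, Subalgebra.coe_val, mobHom_apply,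
        substMob_neg_substMob, AlgHom.id_apply]))

theorem coe_cancelEquiv (f : cancelAlg 0) : (cancelEquiv f : XSeries) = substMob (β / 2) f :=
  mobHom_apply _ _

theorem coe_cancelEquiv_symm (g : GGamma) :
    (cancelEquiv.symm g : XSeries) = substMob (-(β / 2)) g :=
  mobHom_apply _ _

theorem isHomeomorph_cancelEquiv : IsHomeomorph cancelEquiv := by
  rw [isHomeomorph_iff_exists_inverse]
  refine ⟨?_, cancelEquiv.symm, cancelEquiv.left_inv, cancelEquiv.right_inv, ?_⟩
  · rw [continuous_induced_rng]
    exact ((continuous_substMob _).comp continuous_subtype_val).congr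
      fun f => (coe_cancelEquiv f).symm
  · rw [continuous_induced_rng]
    exact ((continuous_substMob _).comp continuous_subtype_val).congr
      fun g => (coe_cancelEquiv_symm g).symm

end NeutralFermion

theorem mainTheorem6 :
    (∀ l : StrictPartition, substBeta (schurQ l) = vev l) ∧
    (LinearIndependent K vev ∧
      (∀ l : StrictPartition, vev l ∈ GGamma) ∧
      (GGamma : Set XSeries) ⊆ closure (Submodule.span K (Set.range vev) : Set XSeries)) ∧
    ((GammaHat : Set XSeries) = closure (Gamma : Set XSeries) ∧
      ∃ A : Subalgebra K XSeries, Subalgebra.toSubmodule A = GammaHat ∧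
        ∃ e : A ≃ₐ[K] GGamma,
          (∀ f : A, (e f : XSeries) = substBeta (f : XSeries)) ∧ IsHomeomorph e) := by
  refine ⟨substBeta_schurQ, ⟨linearIndependent_vev, vev_mem_GGamma, GGamma_subset_closure⟩, ?_,
    cancelAlg 0, toSubmodule_cancelAlg_zero, cancelEquiv, coe_cancelEquiv,
    isHomeomorph_cancelEquiv⟩
  rw [← toSubmodule_cancelAlg_zero, Subalgebra.coe_toSubmodule, cancelAlg_zero_eq_closure]
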